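/- **Setting.** Let $G$ be a discrete group acting by homeomorphisms on a locally compact Hausdorff space $X$, written $\varphi_t(x)=t\cdot x$, and let $\alpha_t(a)=a\circ\varphi_{t^{-1}}$ be the corresponding action on $C_0(X)$ (complex-valued functions); every action of $G$ on $C_0(X)$ by $*$-automorphisms has this form, and $\varphi$ is its dual action. All spaces and algebras are complex, and "ideal" means closed two-sided ideal. *The universal algebra.* $F(\alpha)=\ell^1(G,C_0(X))$ is the Banach algebra with norm $\|b\|_1=\sum_{t}\|b(t)\|_\infty$ and product $(a*b)(r)=\sum_{st=r}a(s)\,\alpha_s(b(t))$. The algebra $C_0(X)$ embeds in $F(\alpha)$ by $a\mapsto a\delta_1$. A representation of a Banach algebra $B$ on a Banach space $E$ is a contractive homomorphism $\psi:B\to \mathcal B(E)$; it is non-degenerate if $\psi(B)E$ spans a dense subspace of $E$. *Full norms.* For $p\in[1,\infty)$ let $\|b\|_{L^p}=\sup\|\psi(b)\|$, where $\psi$ runs over all non-degenerate representations of $F(\alpha)$ on $L^p$-spaces (Banach spaces isometrically isomorphic to $L^p(\mu)$ for some measure $\mu$). For $p=\infty$ take instead all non-degenerate representations on $C_0$-spaces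 (Banach spaces isometrically isomorphic to $C_0(\Omega)$ for some topological space $\Omega$). *Regular and trivial representations.* For $p\in[1,\infty)$ let $\Lambda_p$ be the representation of $F(\alpha)$ on $\ell^p(X\times G)$, and $\Lambda_p^{\mathrm{tr}}$ the one on $\ell^p(X)$, given by $$\Lambda_p(b)\xi(x,t)=\sum_{s\in G}b(s)(x)\,\xi(s^{-1}x,s^{-1}t),\qquad \Lambda^{\mathrm{tr}}_p(b)\xi(x)=\sum_{s\in G}b(s)(x)\,\xi(s^{-1}x).$$ The same formulas define $\Lambda_\infty$ on $c_0(X\times G)$ and $\Lambda_\infty^{\mathrm{tr}}$ on $c_0(X)$. *The algebras $F^P(\alpha)$.* For a non-empty $P\subseteq[1,\infty]$, let $F^P(\alpha)$ and $F^P_{\mathrm r}(\alpha)$ be the Hausdorff completions of $F(\alpha)$ in the seminorms $\sup_{p\in P}\|b\|_{L^p}$ and $\sup_{p\in P}\|\Lambda_p(b)\|$, respectively. Let $\Lambda_P:F^P(\alpha)\to F^P_{\mathrm r}(\alpha)$ be the canonical homomorphism extending the identity of $F(\alpha)$, and let $\Lambda_P^{\mathrm{tr}}$ be the extension to $F^P(\alpha)$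 of the $\ell^\infty$-direct sum $\bigoplus_{p\in P}\Lambda_p^{\mathrm{tr}}$, acting on the $\ell^\infty$-direct sum of the underlying spaces. For $P=\emptyset$ put $F^\emptyset(\alpha)=F^\emptyset_{\mathrm r}(\alpha)=F(\alpha)$, $\Lambda_\emptyset=\mathrm{id}$ and $\Lambda_\emptyset^{\mathrm{tr}}=\bigoplus_{p\in[1,\infty]}\Lambda_p^{\mathrm{tr}}$. *Terminology.* The action $\varphi$ is topologically free if $\{x\in X:t\cdot x=x\}$ has empty interior for every $t\in G\setminus\{1\}$. An inclusion $A\subseteq B$ of Banach algebras has the generalised intersection property with hidden ideal $N$ if $N$ is the largest ideal of $B$ with $N\cap A=\{0\}$. The subalgebra $A$ detects ideals in $B$ if $J\cap A\neq\{0\}$ for every non-zero ideal $J$ of $B$. **Theorem.** For every $P\subseteq[1,\infty]$ the following conditions are equivalent: 1. The dual action $\varphi$ of $G$ on $X$ is topologically free. 2. $C_0(X)\subseteq F^P(\alpha)$ has the generalised intersection property with hidden ideal $\ker\Lambda_P$. 3. $\ker\Lambda_P^{\mathrm{tr}}\subseteq\ker\Lambda_P$. 4. $C_0(X)$ detects ideals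 in $F^T(\alpha)$ for some $T\subseteq\{1,\infty\}$. 5. $C_0(X)$ detects ideals in $F^T(\alpha)$ for all $T\subseteq\{1,\infty\}$. -/

import Mathlib

open scoped ENNReal ZeroAtInfty Topology

universe u v w w'

noncomputable section

namespace BanachCrossedProduct

section Action

variable {G : Type u} {X : Type v} [Group G] [TopologicalSpace X] [MulAction G X]
  [ContinuousConstSMul G X]

/-- The homeomorphism `x ↦ t • x` of `X`, as a cocompact map. -/
def smulCocompact (t : G) : CocompactMap X X where
  toFun x := t • x
  continuous_toFun := continuous_const_smul t
  cocompact_tendsto' := (Homeomorph.smul t).isClosedEmbedding.tendsto_cocompact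

/-- The action of `G` on `C₀(X)`: `(α_t a)(x) = a (t⁻¹ • x)`. -/
def act (t : G) : C₀(X, ℂ) →ₙₐ[ℂ] C₀(X, ℂ) :=
  ZeroAtInftyContinuousMap.compNonUnitalAlgHom (smulCocompact t⁻¹)

@[simp] theorem act_apply (t : G) (a : C₀(X, ℂ)) (x : X) : act t a x = a (t⁻¹ • x) := rfl

theorem act_mul (s t : G) (a : C₀(X, ℂ)) : act (s * t) a = act s (act t a) := by
  ext x; simp [mul_smul]

theorem act_one (a : C₀(X, ℂ)) : act (1 : G) a = a := by
  ext x; simp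

theorem norm_apply_le (a : C₀(X, ℂ)) (x : X) : ‖a x‖ ≤ ‖a‖ := by
  rw [← ZeroAtInftyContinuousMap.norm_toBCF_eq_norm]
  exact a.toBCF.norm_coe_le_norm x

theorem norm_le_of (a : C₀(X, ℂ)) {C : ℝ} (hC : 0 ≤ C) (h : ∀ x, ‖a x‖ ≤ C) : ‖a‖ ≤ C := by
  rw [← ZeroAtInftyContinuousMap.norm_toBCF_eq_norm]
  exact (BoundedContinuousFunction.norm_le hC).2 h

theorem norm_act_le (t : G) (a : C₀(X, ℂ)) : ‖act t a‖ ≤ ‖a‖ :=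
  norm_le_of _ (norm_nonneg _) fun _ => norm_apply_le a _

theorem continuous_act (t : G) : Continuous (act t : C₀(X, ℂ) → C₀(X, ℂ)) :=
  AddMonoidHomClass.continuous_of_bound (act t) 1 fun a => by simpa using norm_act_le t a

end Action

/-- The underlying Banach space `ℓ¹(G, C₀(X))` of the universal crossed product `F(α)`. -/
def L1Algebra (G : Type u) (X : Type v) [TopologicalSpace X] : Type max u v :=
  lp (fun _ : G => C₀(X, ℂ)) 1

namespace L1Algebra

section Space

variable {G : Type u} {X : Type v} [TopologicalSpace X]

instance : NormedAddCommGroup (L1Algebra G X) :=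
  inferInstanceAs (NormedAddCommGroup (lp (fun _ : G => C₀(X, ℂ)) 1))

instance : NormedSpace ℂ (L1Algebra G X) :=
  inferInstanceAs (NormedSpace ℂ (lp (fun _ : G => C₀(X, ℂ)) 1))

instance : CompleteSpace (L1Algebra G X) :=
  inferInstanceAs (CompleteSpace (lp (fun _ : G => C₀(X, ℂ)) 1))

/-- The family of coefficients of an element of `F(α)`. -/
def coeffs (b : L1Algebra G X) : G → C₀(X, ℂ) :=
  ((show lp (fun _ : G => C₀(X, ℂ)) 1 from b) : ∀ _ : G, C₀(X, ℂ))

instance : CoeFun (L1Algebra G X) fun _ => G → C₀(X, ℂ) := ⟨coeffs⟩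

theorem ext {a b : L1Algebra G X} (h : ∀ t, a t = b t) : a = b := lp.ext (funext h)

@[simp] theorem add_apply (a b : L1Algebra G X) (t : G) : (a + b) t = a t + b t := rfl
@[simp] theorem zero_apply (t : G) : (0 : L1Algebra G X) t = 0 := rfl
@[simp] theorem smul_apply (c : ℂ) (a : L1Algebra G X) (t : G) : (c • a) t = c • a t := rfl

theorem summable_norm (a : L1Algebra G X) : Summable fun t => ‖a t‖ := by
  have h := (lp.memℓp (show lp (fun _ : G => C₀(X, ℂ)) 1 from a)).summable (by simp)
  simp only [ENNReal.toReal_one, Real.rpow_one] at h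
  exact h

theorem norm_eq_tsum (a : L1Algebra G X) : ‖a‖ = ∑' t, ‖a t‖ := by
  have h := lp.norm_eq_tsum_rpow (p := 1) (by simp) (show lp (fun _ : G => C₀(X, ℂ)) 1 from a)
  simp only [ENNReal.toReal_one, Real.rpow_one, div_one] at h
  exact h

theorem norm_apply_le (a : L1Algebra G X) (t : G) : ‖a t‖ ≤ ‖a‖ :=
  lp.norm_apply_le_norm (p := 1) (by simp) (show lp (fun _ : G => C₀(X, ℂ)) 1 from a) t

/-- The element `Σ_t a_t δ_t` for a family of coefficients with summable norms. -/
def mk (a : G → C₀(X, ℂ)) (ha : Summable fun t => ‖a t‖) : L1Algebra G X :=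
  (⟨a, memℓp_gen (by simpa using ha)⟩ : lp (fun _ : G => C₀(X, ℂ)) 1)

@[simp] theorem mk_apply (a : G → C₀(X, ℂ)) (ha : Summable fun t => ‖a t‖) (t : G) :
    mk a ha t = a t := rfl

end Space

section Summable

variable {G : Type u} {X : Type v} [Group G] [TopologicalSpace X]

theorem summable_pair (a b : L1Algebra G X) :
    Summable fun z : G × G => ‖a z.1‖ * ‖b (z.1⁻¹ * z.2)‖ := by
  have h := a.summable_norm.mul_of_nonneg b.summable_norm (fun _ => norm_nonneg _)
    (fun _ => norm_nonneg _)
  exact ((Equiv.prodShear (Equiv.refl G) fun s => Equiv.mulLeft s⁻¹).summable_iff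
    (f := fun z : G × G => ‖a z.1‖ * ‖b z.2‖)).2 h

theorem summable_pair_swap (a b : L1Algebra G X) :
    Summable fun z : G × G => ‖a z.2‖ * ‖b (z.2⁻¹ * z.1)‖ :=
  (summable_pair a b).prod_symm

end Summable

section Algebra

variable {G : Type u} {X : Type v} [Group G] [TopologicalSpace X] [MulAction G X]
  [ContinuousConstSMul G X]

theorem norm_term_le (a b : L1Algebra G X) (r s : G) :
    ‖a s * act s (b (s⁻¹ * r))‖ ≤ ‖a s‖ * ‖b (s⁻¹ * r)‖ :=
  (norm_mul_le _ _).trans (mul_le_mul_of_nonneg_left (norm_act_le _ _) (norm_nonneg _))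

theorem summable_norm_term (a b : L1Algebra G X) (r : G) :
    Summable fun s => ‖a s * act s (b (s⁻¹ * r))‖ :=
  ((summable_pair_swap a b).prod_factor r).of_nonneg_of_le (fun _ => norm_nonneg _)
    (norm_term_le a b r)

theorem summable_term (a b : L1Algebra G X) (r : G) :
    Summable fun s => a s * act s (b (s⁻¹ * r)) := (summable_norm_term a b r).of_norm

theorem norm_conv_le (a b : L1Algebra G X) (r : G) :
    ‖∑' s, a s * act s (b (s⁻¹ * r))‖ ≤ ∑' s, ‖a s‖ * ‖b (s⁻¹ * r)‖ :=
  (norm_tsum_le_tsum_norm (summable_norm_term a b r)).trans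
    ((summable_norm_term a b r).tsum_le_tsum (norm_term_le a b r)
      ((summable_pair_swap a b).prod_factor r))

theorem summable_norm_conv (a b : L1Algebra G X) :
    Summable fun r => ‖∑' s, a s * act s (b (s⁻¹ * r))‖ :=
  (summable_pair_swap a b).prod.of_nonneg_of_le (fun _ => norm_nonneg _) (norm_conv_le a b)

/-- The multiplication of `F(α)`: `(a * b)(r) = ∑_{st = r} a(s) α_s(b(t))`. -/
instance : Mul (L1Algebra G X) :=
  ⟨fun a b => mk (fun r => ∑' s, a s * act s (b (s⁻¹ * r))) (summable_norm_conv a b)⟩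

theorem mul_apply (a b : L1Algebra G X) (r : G) :
    (a * b) r = ∑' s, a s * act s (b (s⁻¹ * r)) := rfl

theorem norm_mul_le' (a b : L1Algebra G X) : ‖a * b‖ ≤ ‖a‖ * ‖b‖ := by
  have h : Summable (Function.uncurry fun s r : G => ‖a s‖ * ‖b (s⁻¹ * r)‖) := by
    rw [Function.uncurry_def]; exact summable_pair a b
  have h' (s : G) : ∑' r, ‖b (s⁻¹ * r)‖ = ‖b‖ := by
    rw [norm_eq_tsum b]
    exact (Equiv.mulLeft s⁻¹).tsum_eq fun t => ‖b t‖
  calc ‖a * b‖ = ∑' r, ‖∑' s, a s * act s (b (s⁻¹ * r))‖ := norm_eq_tsum _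
    _ ≤ ∑' r, ∑' s, ‖a s‖ * ‖b (s⁻¹ * r)‖ :=
      (summable_norm_conv a b).tsum_le_tsum (norm_conv_le a b) (summable_pair_swap a b).prod
    _ = ∑' s, ∑' r, ‖a s‖ * ‖b (s⁻¹ * r)‖ :=
      h.tsum_comm
    _ = ∑' s, ‖a s‖ * ‖b‖ := by
      refine tsum_congr fun s => ?_
      rw [tsum_mul_left, h']
    _ = ‖a‖ * ‖b‖ := by rw [tsum_mul_right, ← norm_eq_tsum]

theorem mul_assoc' (a b c : L1Algebra G X) : a * b * c = a * (b * c) := by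
  refine ext fun r => ?_
  have hsum : Summable (Function.uncurry fun s t : G =>
      a s * act s (b (s⁻¹ * t)) * act t (c (t⁻¹ * r))) := by
    rw [Function.uncurry_def]
    refine Summable.of_norm (((summable_pair a b).mul_right ‖c‖).of_nonneg_of_le
      (fun _ => norm_nonneg _) fun z => ?_)
    exact (norm_mul_le _ _).trans (mul_le_mul (norm_term_le a b z.2 z.1)
      ((norm_act_le _ _).trans (norm_apply_le _ _)) (norm_nonneg _) (by positivity))
  calc (a * b * c) r
      = ∑' t, ∑' s, a s * act s (b (s⁻¹ * t)) * act t (c (t⁻¹ * r)) := by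
        rw [mul_apply]
        refine tsum_congr fun t => ?_
        rw [mul_apply, (summable_term a b t).tsum_mul_right]
    _ = ∑' s, ∑' t, a s * act s (b (s⁻¹ * t)) * act t (c (t⁻¹ * r)) := hsum.tsum_comm
    _ = (a * (b * c)) r := by
        rw [mul_apply]
        refine tsum_congr fun s => ?_
        have hs : Summable fun t => act s (b t * act t (c (t⁻¹ * (s⁻¹ * r)))) :=
          (summable_term b c (s⁻¹ * r)).map (act s) (continuous_act s)
        rw [mul_apply, (summable_term b c _).map_tsum (act s) (continuous_act s),
          ← hs.tsum_mul_left (a s),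
          ← (Equiv.mulLeft s).tsum_eq]
        refine tsum_congr fun t => ?_
        rw [Equiv.coe_mulLeft, map_mul, ← act_mul, inv_mul_cancel_left, mul_assoc, mul_inv_rev,
          mul_assoc t⁻¹]

instance : NonUnitalNormedRing (L1Algebra G X) where
  __ := (inferInstance : NormedAddCommGroup (L1Algebra G X))
  mul := (· * ·)
  zero_mul a := ext fun r => by simp [mul_apply]
  mul_zero a := ext fun r => by simp [mul_apply]
  left_distrib a b c := ext fun r => by
    simp only [mul_apply, add_apply, map_add, mul_add]
    exact (summable_term a b r).tsum_add (summable_term a c r)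
  right_distrib a b c := ext fun r => by
    simp only [mul_apply, add_apply, add_mul]
    exact (summable_term a c r).tsum_add (summable_term b c r)
  mul_assoc := mul_assoc'
  norm_mul_le := norm_mul_le'

instance : IsScalarTower ℂ (L1Algebra G X) (L1Algebra G X) :=
  ⟨fun k a b => ext fun r => by
    simp only [smul_eq_mul, mul_apply, smul_apply, smul_mul_assoc]
    exact (summable_term a b r).tsum_const_smul k⟩

instance : SMulCommClass ℂ (L1Algebra G X) (L1Algebra G X) :=
  ⟨fun k a b => ext fun r => by
    simp only [smul_eq_mul, mul_apply, smul_apply, map_smul, mul_smul_comm]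
    exact ((summable_term a b r).tsum_const_smul k).symm⟩

open Classical in
/-- The inclusion `a ↦ a δ_1` of `C₀(X)` into `F(α)`. -/
def coeff : C₀(X, ℂ) →ₙₐ[ℂ] L1Algebra G X where
  toFun a := mk (Pi.single 1 a) (summable_of_hasFiniteSupport
    ((Set.finite_singleton (1 : G)).subset fun t ht => by
      by_contra h
      simp [Pi.single_eq_of_ne (show t ≠ 1 from h)] at ht))
  map_smul' k a := ext fun t => by by_cases h : t = 1 <;> simp [h]
  map_zero' := ext fun t => by simp
  map_add' a b := ext fun t => by simp [Pi.single_add]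
  map_mul' a b := ext fun r => by
    rw [mul_apply, tsum_eq_single 1]
    · by_cases h : r = 1
      · subst h; simp [act_one]
      · simp [Pi.single_eq_of_ne h]
    · intro s hs
      simp [Pi.single_eq_of_ne hs]

theorem coeff_apply_one (a : C₀(X, ℂ)) : coeff (G := G) a 1 = a := by
  simp [coeff]

open Classical in
theorem coeff_apply_ne (a : C₀(X, ℂ)) {t : G} (ht : t ≠ 1) : coeff a t = 0 := by
  simp [coeff, Pi.single_eq_of_ne ht]

end Algebra

end L1Algebra

/-- A submultiplicative seminorm on a Banach algebra that is dominated by the norm. -/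
structure AlgSeminorm (B : Type u) [NonUnitalNormedRing B] [NormedSpace ℂ B] extends
    Seminorm ℂ B where
  mul_le' : ∀ a b : B, toFun (a * b) ≤ toFun a * toFun b
  le_norm' : ∀ a : B, toFun a ≤ ‖a‖

section Seminorm

variable {B : Type u} [NonUnitalNormedRing B] [NormedSpace ℂ B]

instance : CoeFun (AlgSeminorm B) fun _ => B → ℝ := ⟨fun N => N.toSeminorm⟩

namespace AlgSeminorm

theorem nonneg (N : AlgSeminorm B) (a : B) : 0 ≤ N a := apply_nonneg N.toSeminorm a
theorem le_norm (N : AlgSeminorm B) (a : B) : N a ≤ ‖a‖ := N.le_norm' a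
theorem mul_le (N : AlgSeminorm B) (a b : B) : N (a * b) ≤ N a * N b := N.mul_le' a b
theorem map_add_le (N : AlgSeminorm B) (a b : B) : N (a + b) ≤ N a + N b :=
  map_add_le_add N.toSeminorm a b
theorem map_smul (N : AlgSeminorm B) (k : ℂ) (a : B) : N (k • a) = ‖k‖ * N a :=
  map_smul_eq_mul N.toSeminorm k a

variable (B) in
/-- The norm of `B`. -/
def ofNorm : AlgSeminorm B where
  toSeminorm := normSeminorm ℂ B
  mul_le' := norm_mul_le
  le_norm' _ := le_rfl

theorem bddAbove (S : Set (AlgSeminorm B)) (a : B) :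
    BddAbove (Set.range fun N : S => N.1 a) :=
  ⟨‖a‖, by rintro _ ⟨N, rfl⟩; exact N.1.le_norm a⟩

theorem le_iSup {S : Set (AlgSeminorm B)} {N : AlgSeminorm B} (hN : N ∈ S) (a : B) :
    N a ≤ ⨆ N : S, N.1 a := le_ciSup (bddAbove S a) ⟨N, hN⟩

/-- The pointwise supremum of a set of seminorms (zero if the set is empty). -/
def sup (S : Set (AlgSeminorm B)) : AlgSeminorm B where
  toSeminorm := Seminorm.of (fun a => ⨆ N : S, N.1 a)
    (fun a b => Real.iSup_le (fun N => (N.1.map_add_le a b).trans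
        (add_le_add (le_iSup N.2 a) (le_iSup N.2 b)))
      (add_nonneg (Real.iSup_nonneg fun N => N.1.nonneg a)
        (Real.iSup_nonneg fun N => N.1.nonneg b)))
    (fun k a => by
      simp only [AlgSeminorm.map_smul]
      exact (Real.mul_iSup_of_nonneg (norm_nonneg k) _).symm)
  mul_le' a b := Real.iSup_le (fun N => (N.1.mul_le a b).trans
        (mul_le_mul (le_iSup N.2 a) (le_iSup N.2 b) (N.1.nonneg b)
          (Real.iSup_nonneg fun N => N.1.nonneg a)))
      (mul_nonneg (Real.iSup_nonneg fun N => N.1.nonneg a)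
        (Real.iSup_nonneg fun N => N.1.nonneg b))
  le_norm' a := Real.iSup_le (fun N => N.1.le_norm a) (norm_nonneg a)

theorem sup_apply (S : Set (AlgSeminorm B)) (a : B) : sup S a = ⨆ N : S, N.1 a := rfl

theorem le_sup {S : Set (AlgSeminorm B)} {N : AlgSeminorm B} (hN : N ∈ S) (a : B) :
    N a ≤ sup S a := le_iSup hN a

theorem sup_le {S : Set (AlgSeminorm B)} {a : B} {C : ℝ} (hC : 0 ≤ C)
    (h : ∀ N ∈ S, N a ≤ C) : sup S a ≤ C := Real.iSup_le (fun N => h N.1 N.2) hC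

end AlgSeminorm

/-- A copy of the algebra `B`, equipped with the seminorm `N`. -/
def WithSeminorm (_N : AlgSeminorm B) : Type u := B

instance (N : AlgSeminorm B) : NonUnitalRing (WithSeminorm N) :=
  inferInstanceAs (NonUnitalRing B)

instance (N : AlgSeminorm B) : Module ℂ (WithSeminorm N) := inferInstanceAs (Module ℂ B)

instance (N : AlgSeminorm B) : SeminormedAddCommGroup (WithSeminorm N) :=
  AddGroupSeminorm.toSeminormedAddCommGroup (E := WithSeminorm N)
    { toFun := fun b => N b
      map_zero' := map_zero N.toSeminorm
      add_le' := N.map_add_le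
      neg' := map_neg_eq_map N.toSeminorm }

instance (N : AlgSeminorm B) : NonUnitalSeminormedRing (WithSeminorm N) where
  __ := (inferInstance : SeminormedAddCommGroup (WithSeminorm N))
  __ := (inferInstance : NonUnitalRing (WithSeminorm N))
  norm_mul_le := N.mul_le

instance (N : AlgSeminorm B) : NormedSpace ℂ (WithSeminorm N) where
  norm_smul_le k a := (N.map_smul k a).le

instance (N : AlgSeminorm B) [IsScalarTower ℂ B B] :
    IsScalarTower ℂ (WithSeminorm N) (WithSeminorm N) :=
  ⟨fun k a b => smul_assoc k (show B from a) (show B from b)⟩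

instance (N : AlgSeminorm B) [SMulCommClass ℂ B B] :
    SMulCommClass ℂ (WithSeminorm N) (WithSeminorm N) :=
  ⟨fun k a b => smul_comm k (show B from a) (show B from b)⟩

/-- The Hausdorff completion of the algebra `B` in the seminorm `N`. -/
def HausdorffCompletion (N : AlgSeminorm B) : Type u :=
  UniformSpace.Completion (WithSeminorm N)

namespace HausdorffCompletion

variable (N : AlgSeminorm B)

instance : NormedAddCommGroup (HausdorffCompletion N) :=
  inferInstanceAs (NormedAddCommGroup (UniformSpace.Completion (WithSeminorm N)))

instance : NormedSpace ℂ (HausdorffCompletion N) :=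
  inferInstanceAs (NormedSpace ℂ (UniformSpace.Completion (WithSeminorm N)))

instance : CompleteSpace (HausdorffCompletion N) :=
  inferInstanceAs (CompleteSpace (UniformSpace.Completion (WithSeminorm N)))

variable {N}

/-- The canonical linear map of `B` into its Hausdorff completion. -/
def of : B →ₗ[ℂ] HausdorffCompletion N where
  toFun b := ((show WithSeminorm N from b) : UniformSpace.Completion (WithSeminorm N))
  map_add' a b := UniformSpace.Completion.coe_add (α := WithSeminorm N) a b
  map_smul' k b := UniformSpace.Completion.coe_smul (X := WithSeminorm N) k b

theorem norm_of (b : B) : ‖(of b : HausdorffCompletion N)‖ = N b :=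
  UniformSpace.Completion.norm_coe (E := WithSeminorm N) b

theorem denseRange_of : DenseRange (of : B → HausdorffCompletion N) :=
  UniformSpace.Completion.denseRange_coe (α := WithSeminorm N)

theorem continuous_of : Continuous (of : B → HausdorffCompletion N) :=
  AddMonoidHomClass.continuous_of_bound (of : B →ₗ[ℂ] HausdorffCompletion N) 1 fun b => by
    simpa [norm_of] using N.le_norm b

/-- A linear map into a Banach space that is bounded by `N` extends to the completion. -/
def extendCLM {A : Type w} [NormedAddCommGroup A] [NormedSpace ℂ A] [CompleteSpace A]
    (f : B →ₗ[ℂ] A) (hf : ∀ b, ‖f b‖ ≤ N b) : HausdorffCompletion N →L[ℂ] A :=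
  ContinuousLinearMap.extend
    (LinearMap.mkContinuous (E := WithSeminorm N) f 1 fun b =>
      (hf b).trans (one_mul (N b)).ge)
    (UniformSpace.Completion.toComplL (𝕜 := ℂ) (E := WithSeminorm N))

theorem extendCLM_of {A : Type w} [NormedAddCommGroup A] [NormedSpace ℂ A] [CompleteSpace A]
    (f : B →ₗ[ℂ] A) (hf : ∀ b, ‖f b‖ ≤ N b) (b : B) : extendCLM f hf (of b) = f b :=
  ContinuousLinearMap.extend_eq _ UniformSpace.Completion.denseRange_coe
    (UniformSpace.Completion.isUniformInducing_coe _) (show WithSeminorm N from b)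

/-- The multiplication of the completion: the continuous extension of that of `B`. -/
instance : Mul (HausdorffCompletion N) :=
  ⟨fun x y => (UniformSpace.Completion.isDenseInducing_coe.prodMap
    UniformSpace.Completion.isDenseInducing_coe).extend
      (fun z : WithSeminorm N × WithSeminorm N =>
        ((z.1 * z.2 : WithSeminorm N) : UniformSpace.Completion (WithSeminorm N))) (x, y)⟩

theorem of_mul (a b : B) : (of (a * b) : HausdorffCompletion N) = of a * of b :=
  ((UniformSpace.Completion.isDenseInducing_coe.prodMap
    UniformSpace.Completion.isDenseInducing_coe).extend_eq
      ((UniformSpace.Completion.continuous_coe (WithSeminorm N)).comp continuous_mul)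
      ((a, b) : WithSeminorm N × WithSeminorm N)).symm

instance : ContinuousMul (HausdorffCompletion N) where
  continuous_mul := by
    let m := (AddMonoidHom.mul : WithSeminorm N →+ WithSeminorm N →+ WithSeminorm N).compr₂
      UniformSpace.Completion.toCompl
    have : Continuous fun p : WithSeminorm N × WithSeminorm N => m p.1 p.2 :=
      (UniformSpace.Completion.continuous_coe _).comp continuous_mul
    have di : IsDenseInducing (UniformSpace.Completion.toCompl :
        WithSeminorm N → UniformSpace.Completion (WithSeminorm N)) :=
      UniformSpace.Completion.isDenseInducing_coe
    exact (di.extend_Z_bilin di this :)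

@[elab_as_elim]
theorem induction {p : HausdorffCompletion N → Prop} (x : HausdorffCompletion N)
    (hp : IsClosed {x | p x}) (h : ∀ b : B, p (of b)) : p x :=
  UniformSpace.Completion.induction_on (α := WithSeminorm N) x hp h

theorem add_mul' (x y z : HausdorffCompletion N) : (x + y) * z = x * z + y * z := by
  have h : Continuous fun q : HausdorffCompletion N × HausdorffCompletion N ×
      HausdorffCompletion N => (q.1 + q.2.1) * q.2.2 := by fun_prop
  have h' : Continuous fun q : HausdorffCompletion N × HausdorffCompletion N ×
      HausdorffCompletion N => q.1 * q.2.2 + q.2.1 * q.2.2 := by fun_prop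
  refine denseRange_of.induction_on₃ (isClosed_eq h h') (fun a b c => ?_) x y z
  simp only [← map_add, ← of_mul, add_mul]

theorem mul_add' (x y z : HausdorffCompletion N) : x * (y + z) = x * y + x * z := by
  have h : Continuous fun q : HausdorffCompletion N × HausdorffCompletion N ×
      HausdorffCompletion N => q.1 * (q.2.1 + q.2.2) := by fun_prop
  have h' : Continuous fun q : HausdorffCompletion N × HausdorffCompletion N ×
      HausdorffCompletion N => q.1 * q.2.1 + q.1 * q.2.2 := by fun_prop
  refine denseRange_of.induction_on₃ (isClosed_eq h h') (fun a b c => ?_) x y z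
  simp only [← map_add, ← of_mul, mul_add]

theorem mul_assoc' (x y z : HausdorffCompletion N) : x * y * z = x * (y * z) := by
  have h : Continuous fun q : HausdorffCompletion N × HausdorffCompletion N ×
      HausdorffCompletion N => q.1 * q.2.1 * q.2.2 :=
    (continuous_fst.mul continuous_snd.fst).mul continuous_snd.snd
  have h' : Continuous fun q : HausdorffCompletion N × HausdorffCompletion N ×
      HausdorffCompletion N => q.1 * (q.2.1 * q.2.2) :=
    continuous_fst.mul (continuous_snd.fst.mul continuous_snd.snd)
  refine denseRange_of.induction_on₃ (isClosed_eq h h') (fun a b c => ?_) x y z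
  simp only [← of_mul, mul_assoc]

theorem norm_mul_le' (x y : HausdorffCompletion N) : ‖x * y‖ ≤ ‖x‖ * ‖y‖ := by
  induction x using induction with
  | hp => exact isClosed_le (by fun_prop) (by fun_prop)
  | h a =>
  induction y using induction with
  | hp => exact isClosed_le (by fun_prop) (by fun_prop)
  | h b =>
  simpa only [← of_mul, norm_of] using N.mul_le a b

instance : NonUnitalNormedRing (HausdorffCompletion N) where
  __ := (inferInstance : NormedAddCommGroup (HausdorffCompletion N))
  __ := (inferInstance : Mul (HausdorffCompletion N))
  zero_mul x := by simpa using add_mul' (0 : HausdorffCompletion N) 0 x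
  mul_zero x := by simpa using mul_add' x (0 : HausdorffCompletion N) 0
  left_distrib := mul_add'
  right_distrib := add_mul'
  mul_assoc := mul_assoc'
  norm_mul_le := norm_mul_le'

theorem smul_mul_assoc' [IsScalarTower ℂ B B] (k : ℂ) (x y : HausdorffCompletion N) :
    k • x * y = k • (x * y) := by
  have h : Continuous fun q : HausdorffCompletion N × HausdorffCompletion N =>
      k • q.1 * q.2 := (continuous_fst.const_smul k).mul continuous_snd
  have h' : Continuous fun q : HausdorffCompletion N × HausdorffCompletion N =>
      k • (q.1 * q.2) := (continuous_fst.mul continuous_snd).const_smul k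
  refine denseRange_of.induction_on₂ (isClosed_eq h h') (fun a b => ?_) x y
  simp only [← map_smul, ← of_mul, smul_mul_assoc]

theorem mul_smul_comm' [SMulCommClass ℂ B B] (k : ℂ) (x y : HausdorffCompletion N) :
    x * (k • y) = k • (x * y) := by
  have h : Continuous fun q : HausdorffCompletion N × HausdorffCompletion N =>
      q.1 * (k • q.2) := continuous_fst.mul (continuous_snd.const_smul k)
  have h' : Continuous fun q : HausdorffCompletion N × HausdorffCompletion N =>
      k • (q.1 * q.2) := (continuous_fst.mul continuous_snd).const_smul k
  refine denseRange_of.induction_on₂ (isClosed_eq h h') (fun a b => ?_) x y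
  simp only [← map_smul, ← of_mul, mul_smul_comm]

instance [IsScalarTower ℂ B B] :
    IsScalarTower ℂ (HausdorffCompletion N) (HausdorffCompletion N) :=
  ⟨fun k x y => smul_mul_assoc' k x y⟩

instance [SMulCommClass ℂ B B] :
    SMulCommClass ℂ (HausdorffCompletion N) (HausdorffCompletion N) :=
  ⟨fun k x y => (mul_smul_comm' k x y).symm⟩

variable (N) in
/-- The canonical homomorphism of `B` into its Hausdorff completion. -/
def ofHom : B →ₙₐ[ℂ] HausdorffCompletion N where
  toFun := of
  map_smul' k b := map_smul of k b
  map_zero' := map_zero of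
  map_add' a b := map_add of a b
  map_mul' := of_mul

/-- A homomorphism into a Banach algebra that is bounded by `N` extends to the completion. -/
def extend {A : Type w} [NonUnitalNormedRing A] [NormedSpace ℂ A] [CompleteSpace A]
    (f : B →ₙₐ[ℂ] A) (hf : ∀ b, ‖f b‖ ≤ N b) : HausdorffCompletion N →ₙₐ[ℂ] A where
  toFun := extendCLM (f : B →ₗ[ℂ] A) hf
  map_smul' k b := map_smul _ k b
  map_zero' := map_zero _
  map_add' a b := map_add _ a b
  map_mul' x y := by
    induction x using induction with
    | hp => exact isClosed_eq (by fun_prop) (by fun_prop)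
    | h a =>
    induction y using induction with
    | hp => exact isClosed_eq (by fun_prop) (by fun_prop)
    | h b =>
      have h (c : B) : extendCLM (f : B →ₗ[ℂ] A) hf (of c) = f c := extendCLM_of _ _ c
      exact (congrArg _ (of_mul a b)).symm.trans
        ((h _).trans ((map_mul f a b).trans (congrArg₂ _ (h a).symm (h b).symm)))

theorem extend_of {A : Type w} [NonUnitalNormedRing A] [NormedSpace ℂ A] [CompleteSpace A]
    (f : B →ₙₐ[ℂ] A) (hf : ∀ b, ‖f b‖ ≤ N b) (b : B) : extend f hf (ofHom N b) = f b :=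
  extendCLM_of (f : B →ₗ[ℂ] A) hf b

theorem continuous_extend {A : Type w} [NonUnitalNormedRing A] [NormedSpace ℂ A]
    [CompleteSpace A] (f : B →ₙₐ[ℂ] A) (hf : ∀ b, ‖f b‖ ≤ N b) : Continuous (extend f hf) :=
  (extendCLM (f : B →ₗ[ℂ] A) hf).continuous

theorem norm_extend_le {A : Type w} [NonUnitalNormedRing A] [NormedSpace ℂ A]
    [CompleteSpace A] (f : B →ₙₐ[ℂ] A) (hf : ∀ b, ‖f b‖ ≤ N b) (x : HausdorffCompletion N) :
    ‖extend f hf x‖ ≤ ‖x‖ := by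
  induction x using induction with
  | hp => exact isClosed_le (continuous_extend f hf).norm continuous_norm
  | h b => exact (congrArg norm (extend_of f hf b)).le.trans ((hf b).trans (norm_of b).ge)

end HausdorffCompletion

end Seminorm

/-- A representation of a Banach algebra `B` on a normed space `E`: a contractive homomorphism
into the bounded operators on `E`. -/
structure BanachRep (B : Type u) (E : Type w) [NonUnitalNormedRing B] [NormedSpace ℂ B]
    [NormedAddCommGroup E] [NormedSpace ℂ E] where
  toHom : B →ₙₐ[ℂ] (E →L[ℂ] E)
  contractive : ∀ b, ‖toHom b‖ ≤ ‖b‖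

namespace BanachRep

variable {B : Type u} {E : Type w} [NonUnitalNormedRing B] [NormedSpace ℂ B]
  [NormedAddCommGroup E] [NormedSpace ℂ E]

instance : CoeFun (BanachRep B E) fun _ => B → E →L[ℂ] E := ⟨fun ψ => ψ.toHom⟩

/-- `ψ` is non-degenerate if the vectors `ψ(b)ξ` span a dense subspace. -/
def Nondegenerate (ψ : BanachRep B E) : Prop :=
  (Submodule.span ℂ {η : E | ∃ (b : B) (ξ : E), ψ b ξ = η}).topologicalClosure = ⊤

/-- The seminorm `b ↦ ‖ψ(b)‖`. -/
def seminorm (ψ : BanachRep B E) : AlgSeminorm B where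
  toSeminorm := Seminorm.of (fun b => ‖ψ b‖)
    (fun a b => by rw [map_add]; exact norm_add_le _ _)
    (fun k b => by rw [map_smul]; exact norm_smul _ _)
  mul_le' a b := by
    change ‖ψ (a * b)‖ ≤ ‖ψ a‖ * ‖ψ b‖
    rw [map_mul]; exact norm_mul_le _ _
  le_norm' := ψ.contractive

theorem seminorm_apply (ψ : BanachRep B E) (b : B) : ψ.seminorm b = ‖ψ b‖ := rfl

/-- Transport of a representation along an isometric isomorphism. -/
def conj {E' : Type w'} [NormedAddCommGroup E'] [NormedSpace ℂ E'] (ψ : BanachRep B E)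
    (e : E ≃ₗᵢ[ℂ] E') : BanachRep B E' where
  toHom :=
    { toFun := fun b => (e.toContinuousLinearEquiv : E →L[ℂ] E') ∘L ψ b ∘L
        (e.symm.toContinuousLinearEquiv : E' →L[ℂ] E)
      map_smul' := fun k b => by ext; simp
      map_zero' := by ext; simp
      map_add' := fun a b => by ext; simp
      map_mul' := fun a b => by ext; simp }
  contractive b := ContinuousLinearMap.opNorm_le_bound _ (norm_nonneg _) fun η => by
    have h : ‖ψ b (e.symm η)‖ ≤ ‖b‖ * ‖e.symm η‖ :=
      (ψ b).le_of_opNorm_le (ψ.contractive b) _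
    simpa using h

theorem conj_apply {E' : Type w'} [NormedAddCommGroup E'] [NormedSpace ℂ E']
    (ψ : BanachRep B E) (e : E ≃ₗᵢ[ℂ] E') (b : B) (η : E') :
    ψ.conj e b η = e (ψ b (e.symm η)) := rfl

theorem norm_le_conj {E' : Type w'} [NormedAddCommGroup E'] [NormedSpace ℂ E']
    (ψ : BanachRep B E) (e : E ≃ₗᵢ[ℂ] E') (b : B) : ‖ψ b‖ ≤ ‖ψ.conj e b‖ :=
  ContinuousLinearMap.opNorm_le_bound _ (norm_nonneg _) fun ξ => by
    have h := (ψ.conj e b).le_opNorm (e ξ)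
    simpa [conj_apply] using h

theorem Nondegenerate.conj {E' : Type w'} [NormedAddCommGroup E'] [NormedSpace ℂ E']
    {ψ : BanachRep B E} (hψ : ψ.Nondegenerate) (e : E ≃ₗᵢ[ℂ] E') :
    (ψ.conj e).Nondegenerate := by
  rw [Nondegenerate, ← Submodule.dense_iff_topologicalClosure_eq_top] at hψ ⊢
  have h := e.surjective.denseRange.dense_image e.continuous hψ
  refine h.mono ?_
  rintro _ ⟨ξ, hξ, rfl⟩
  have h2 : e.toLinearEquiv.toLinearMap ξ ∈
      (Submodule.span ℂ {η : E | ∃ (b : B) (ξ : E), ψ b ξ = η}).map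
        e.toLinearEquiv.toLinearMap := Submodule.mem_map_of_mem hξ
  rw [Submodule.map_span] at h2
  refine Submodule.span_mono ?_ h2
  rintro _ ⟨_, ⟨b, ξ, rfl⟩, rfl⟩
  exact ⟨b, e ξ, by simp [conj_apply]⟩

section DirectSum

variable {ι : Type v} {F : ι → Type w} [∀ i, NormedAddCommGroup (F i)] [∀ i, NormedSpace ℂ (F i)]

theorem norm_component_le (ψ : ∀ i, BanachRep B (F i)) (b : B) (ξ : lp F ∞) (i : ι) :
    ‖ψ i b (ξ i)‖ ≤ ‖b‖ * ‖ξ‖ :=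
  ((ψ i b).le_of_opNorm_le ((ψ i).contractive b) _).trans
    (mul_le_mul_of_nonneg_left (lp.norm_apply_le_norm ENNReal.top_ne_zero ξ i) (norm_nonneg b))

/-- The operator `(ξ_i)_i ↦ (ψ_i(b) ξ_i)_i` on the `ℓ^∞`-direct sum. -/
def directSumOp (ψ : ∀ i, BanachRep B (F i)) (b : B) : lp F ∞ →L[ℂ] lp F ∞ :=
  LinearMap.mkContinuous
    { toFun := fun ξ => ⟨fun i => ψ i b (ξ i), memℓp_infty
        ⟨‖b‖ * ‖ξ‖, by rintro _ ⟨i, rfl⟩; exact norm_component_le ψ b ξ i⟩⟩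
      map_add' := fun ξ η => by ext i; exact (ψ i b).map_add _ _
      map_smul' := fun k ξ => by ext i; simp } ‖b‖
    fun ξ => lp.norm_le_of_forall_le (by positivity) (norm_component_le ψ b ξ)

theorem directSumOp_apply (ψ : ∀ i, BanachRep B (F i)) (b : B) (ξ : lp F ∞) (i : ι) :
    (directSumOp ψ b ξ : ∀ i, F i) i = ψ i b (ξ i) := rfl

/-- The `ℓ^∞`-direct sum of a family of representations, acting on the `ℓ^∞`-direct sum of
the underlying spaces by `((⊕ ψ_i)(b) ξ)_i = ψ_i(b) ξ_i`. -/
def directSum (ψ : ∀ i, BanachRep B (F i)) : BanachRep B (lp F ∞) where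
  toHom :=
    { toFun := directSumOp ψ
      map_smul' := fun k b => by ext ξ i; simp [directSumOp_apply]
      map_zero' := by ext ξ i; simp [directSumOp_apply]
      map_add' := fun a b => by ext ξ i; simp [directSumOp_apply]
      map_mul' := fun a b => by ext ξ i; simp [directSumOp_apply] }
  contractive b := ContinuousLinearMap.opNorm_le_bound _ (norm_nonneg _) fun ξ =>
    lp.norm_le_of_forall_le (by positivity) (norm_component_le ψ b ξ)

theorem directSum_apply (ψ : ∀ i, BanachRep B (F i)) (b : B) (ξ : lp F ∞) (i : ι) :
    (directSum ψ b ξ : ∀ i, F i) i = ψ i b (ξ i) := rfl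

theorem norm_directSum_le (ψ : ∀ i, BanachRep B (F i)) (b : B) {C : ℝ} (hC : 0 ≤ C)
    (h : ∀ i, ‖ψ i b‖ ≤ C) : ‖directSum ψ b‖ ≤ C :=
  ContinuousLinearMap.opNorm_le_bound _ hC fun ξ =>
    lp.norm_le_of_forall_le (by positivity) fun i => by
      rw [directSum_apply]
      exact ((ψ i b).le_of_opNorm_le (h i) _).trans
        (mul_le_mul_of_nonneg_left (lp.norm_apply_le_norm ENNReal.top_ne_zero ξ i) hC)

end DirectSum

end BanachRep

/-- A covariant pair `(π, v)` for the action of `G` on `C₀(X)`: a contractive homomorphism `π` of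
`C₀(X)` and an action `v` of `G` by invertible isometries such that `v_t π(a) = π(α_t a) v_t`. -/
structure CovariantRep (G : Type u) (X : Type v) (E : Type w) [Group G] [TopologicalSpace X]
    [MulAction G X] [ContinuousConstSMul G X] [NormedAddCommGroup E] [NormedSpace ℂ E] where
  π : C₀(X, ℂ) →ₙₐ[ℂ] (E →L[ℂ] E)
  norm_π_le : ∀ a, ‖π a‖ ≤ ‖a‖
  v : G →* (E ≃ₗᵢ[ℂ] E)
  covariant : ∀ (t : G) (a : C₀(X, ℂ)) (ξ : E), v t (π a ξ) = π (act t a) (v t ξ)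

namespace CovariantRep

variable {G : Type u} {X : Type v} {E : Type w} [Group G] [TopologicalSpace X]
  [MulAction G X] [ContinuousConstSMul G X] [NormedAddCommGroup E] [NormedSpace ℂ E]

/-- The operator `π(a) v_t`. -/
def term (ρ : CovariantRep G X E) (t : G) (a : C₀(X, ℂ)) : E →L[ℂ] E :=
  ρ.π a ∘L (ρ.v t).toContinuousLinearEquiv

variable (ρ : CovariantRep G X E)

theorem term_apply (t : G) (a : C₀(X, ℂ)) (ξ : E) : ρ.term t a ξ = ρ.π a (ρ.v t ξ) := rfl

theorem norm_term_le (t : G) (a : C₀(X, ℂ)) : ‖ρ.term t a‖ ≤ ‖a‖ :=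
  ContinuousLinearMap.opNorm_le_bound _ (norm_nonneg _) fun ξ => by
    have h := (ρ.π a).le_of_opNorm_le (ρ.norm_π_le a) (ρ.v t ξ)
    simpa [term_apply] using h

theorem term_add (t : G) (a b : C₀(X, ℂ)) : ρ.term t (a + b) = ρ.term t a + ρ.term t b := by
  ext ξ; simp [term_apply]

theorem term_smul (t : G) (k : ℂ) (a : C₀(X, ℂ)) : ρ.term t (k • a) = k • ρ.term t a := by
  ext ξ; simp [term_apply]

theorem term_mul (s t : G) (a b : C₀(X, ℂ)) :
    ρ.term (s * t) (a * act s b) = ρ.term s a * ρ.term t b := by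
  ext ξ; simp [term_apply, ρ.covariant]

/-- `π(·) v_t` as a continuous linear map. -/
def termCLM (t : G) : C₀(X, ℂ) →L[ℂ] (E →L[ℂ] E) :=
  LinearMap.mkContinuous ⟨⟨ρ.term t, ρ.term_add t⟩, ρ.term_smul t⟩ 1 fun a => by
    simpa using ρ.norm_term_le t a

theorem summable_norm_term (b : L1Algebra G X) : Summable fun t => ‖ρ.term t (b t)‖ :=
  b.summable_norm.of_nonneg_of_le (fun _ => norm_nonneg _) fun t => ρ.norm_term_le t (b t)

variable [CompleteSpace E]

theorem summable_term (b : L1Algebra G X) : Summable fun t => ρ.term t (b t) :=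
  (ρ.summable_norm_term b).of_norm

theorem tsum_term_mul (a b : L1Algebra G X) :
    ∑' r, ρ.term r ((a * b) r) = (∑' s, ρ.term s (a s)) * ∑' t, ρ.term t (b t) := by
  have hsum : Summable (Function.uncurry fun r s : G =>
      ρ.term r (a s * act s (b (s⁻¹ * r)))) := by
    rw [Function.uncurry_def]
    refine Summable.of_norm ((L1Algebra.summable_pair_swap a b).of_nonneg_of_le
      (fun _ => norm_nonneg _) fun z => ?_)
    exact (ρ.norm_term_le _ _).trans (L1Algebra.norm_term_le a b z.1 z.2)
  calc ∑' r, ρ.term r ((a * b) r)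
      = ∑' r, ∑' s, ρ.term r (a s * act s (b (s⁻¹ * r))) := by
        refine tsum_congr fun r => ?_
        rw [L1Algebra.mul_apply]
        exact (ρ.termCLM r).map_tsum (L1Algebra.summable_term a b r)
    _ = ∑' s, ∑' r, ρ.term r (a s * act s (b (s⁻¹ * r))) := hsum.tsum_comm.symm
    _ = ∑' s, ρ.term s (a s) * ∑' t, ρ.term t (b t) := by
        refine tsum_congr fun s => ?_
        rw [← (ρ.summable_term b).tsum_mul_left,
          ← (Equiv.mulLeft s).tsum_eq fun r => ρ.term r (a s * act s (b (s⁻¹ * r)))]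
        refine tsum_congr fun t => ?_
        rw [Equiv.coe_mulLeft, inv_mul_cancel_left, ρ.term_mul]
    _ = (∑' s, ρ.term s (a s)) * ∑' t, ρ.term t (b t) := (ρ.summable_term a).tsum_mul_right _

/-- The integrated form `π ⋊ v` of a covariant pair: `(π ⋊ v)(b) = ∑_t π(b(t)) v_t`. -/
def integrated : BanachRep (L1Algebra G X) E where
  toHom :=
    { toFun := fun b => ∑' t, ρ.term t (b t)
      map_smul' := fun k b => by
        simp only [L1Algebra.smul_apply, term_smul]
        exact (ρ.summable_term b).tsum_const_smul k
      map_zero' := by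
        have h (t : G) : ρ.term t 0 = 0 := by ext; simp [term_apply]
        simp [h]
      map_add' := fun a b => by
        simp only [L1Algebra.add_apply, term_add]
        exact (ρ.summable_term a).tsum_add (ρ.summable_term b)
      map_mul' := ρ.tsum_term_mul }
  contractive b := by
    rw [L1Algebra.norm_eq_tsum]
    exact (norm_tsum_le_tsum_norm (ρ.summable_norm_term b)).trans
      ((ρ.summable_norm_term b).tsum_le_tsum (fun t => ρ.norm_term_le t (b t)) b.summable_norm)

theorem integrated_apply (b : L1Algebra G X) :
    ρ.integrated b = ∑' t, ρ.term t (b t) := rfl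

theorem integrated_apply_apply (b : L1Algebra G X) (ξ : E) :
    ρ.integrated b ξ = ∑' t, ρ.π (b t) (ρ.v t ξ) :=
  (ContinuousLinearMap.apply ℂ E ξ).map_tsum (ρ.summable_term b)

theorem integrated_coeff (a : C₀(X, ℂ)) : ρ.integrated (L1Algebra.coeff a) = ρ.π a := by
  rw [integrated_apply, tsum_eq_single 1]
  · ext ξ; simp [term_apply, L1Algebra.coeff_apply_one]
  · intro t ht
    ext ξ; simp [term_apply, L1Algebra.coeff_apply_ne a ht]

end CovariantRep

/-- The exponents `p ∈ [1, ∞]`. -/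
abbrev Exponent : Type := {p : ℝ≥0∞ // 1 ≤ p}

instance (p : Exponent) : Fact (1 ≤ p.1) := ⟨p.2⟩

theorem Exponent.ne_zero (p : Exponent) : p.1 ≠ 0 := (zero_lt_one.trans_le p.2).ne'

/-- The space `ℓ^p(I)` for `p < ∞`, and `c₀(I)` for `p = ∞`: the `p`-summable families that tend
to zero along the cofinite filter (which is automatic for `p < ∞`). -/
def ellSubmodule (p : Exponent) (I : Type w) : Submodule ℂ (lp (fun _ : I => ℂ) p.1) where
  carrier := {ξ | Filter.Tendsto (fun i => ξ i) Filter.cofinite (𝓝 0)}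
  zero_mem' := tendsto_const_nhds
  add_mem' {ξ η} hξ hη := by
    have h := Filter.Tendsto.add hξ hη
    rw [add_zero] at h
    exact h
  smul_mem' k ξ hξ := by
    have h := Filter.Tendsto.const_smul hξ k
    rw [smul_zero] at h
    exact h

/-- The Banach space `ℓ^p(I)` (`p < ∞`) or `c₀(I)` (`p = ∞`). -/
abbrev EllSpace (p : Exponent) (I : Type w) : Type w := ellSubmodule p I

theorem ellSubmodule_eq_top (p : Exponent) (hp : p.1 ≠ ∞) (I : Type w) :
    ellSubmodule p I = ⊤ := by
  refine eq_top_iff.2 fun ξ _ => ?_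
  have h0 : 0 < p.1.toReal := ENNReal.toReal_pos p.ne_zero hp
  have h := ((lp.memℓp ξ).summable h0).tendsto_cofinite_zero
  have h2 := (Real.continuousAt_rpow_const 0 p.1.toReal⁻¹ (Or.inr (by positivity))).tendsto.comp h
  rw [Real.zero_rpow (by positivity)] at h2
  refine tendsto_zero_iff_norm_tendsto_zero.2 (h2.congr fun i => ?_)
  exact Real.rpow_rpow_inv (norm_nonneg _) h0.ne'

theorem isClosed_ellSubmodule (p : Exponent) (I : Type w) :
    IsClosed (ellSubmodule p I : Set (lp (fun _ : I => ℂ) p.1)) := by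
  refine isClosed_of_closure_subset fun ξ hξ => Metric.tendsto_nhds.2 fun ε hε => ?_
  obtain ⟨η, hη, hd⟩ := Metric.mem_closure_iff.1 hξ (ε / 2) (half_pos hε)
  filter_upwards [Metric.tendsto_nhds.1 hη (ε / 2) (half_pos hε)] with i hi
  have h1 : ‖(ξ - η) i‖ ≤ ‖ξ - η‖ := lp.norm_apply_le_norm p.ne_zero _ i
  rw [dist_eq_norm] at hd
  rw [dist_zero_right] at hi ⊢
  calc ‖ξ i‖ = ‖(ξ - η) i + η i‖ := by simp
    _ ≤ ‖(ξ - η) i‖ + ‖η i‖ := norm_add_le _ _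
    _ < ε := by linarith

instance (p : Exponent) (I : Type w) : CompleteSpace (EllSpace p I) :=
  (isClosed_ellSubmodule p I).completeSpace_coe

namespace EllSpace

variable {p : Exponent} {I : Type w} {J : Type w'}

/-- The values of an element of `ℓ^p(I)` or `c₀(I)`. -/
def val (ξ : EllSpace p I) (i : I) : ℂ := ξ.1 i

theorem ext {ξ η : EllSpace p I} (h : ∀ i, ξ.val i = η.val i) : ξ = η :=
  Subtype.ext (lp.ext (funext h))

@[simp] theorem val_add (ξ η : EllSpace p I) (i : I) : (ξ + η).val i = ξ.val i + η.val i := rfl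
@[simp] theorem val_zero (i : I) : (0 : EllSpace p I).val i = 0 := rfl
@[simp] theorem val_smul (k : ℂ) (ξ : EllSpace p I) (i : I) : (k • ξ).val i = k * ξ.val i := rfl

theorem tendsto_val (ξ : EllSpace p I) : Filter.Tendsto ξ.val Filter.cofinite (𝓝 0) := ξ.2

theorem memℓp_val (ξ : EllSpace p I) : Memℓp ξ.val p.1 := lp.memℓp ξ.1

/-- The element with given values. -/
def mk (f : I → ℂ) (hf : Memℓp f p.1) (h0 : Filter.Tendsto f Filter.cofinite (𝓝 0)) :
    EllSpace p I := ⟨⟨f, hf⟩, h0⟩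

@[simp] theorem mk_val (f : I → ℂ) (hf : Memℓp f p.1)
    (h0 : Filter.Tendsto f Filter.cofinite (𝓝 0)) (i : I) : (mk f hf h0).val i = f i := rfl

theorem norm_le_of_top {C : ℝ} (hp : p.1 = ∞) (hC : 0 ≤ C) {ξ : EllSpace p I}
    (h : ∀ i, ‖ξ.val i‖ ≤ C) : ‖ξ‖ ≤ C := by
  obtain ⟨p, hp'⟩ := p
  obtain rfl : p = ∞ := hp
  exact lp.norm_le_of_forall_le hC h

theorem norm_rpow_eq (hp : 0 < p.1.toReal) (ξ : EllSpace p I) :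
    ‖ξ‖ ^ p.1.toReal = ∑' i, ‖ξ.val i‖ ^ p.1.toReal := lp.norm_rpow_eq_tsum hp ξ.1

theorem norm_val_le (ξ : EllSpace p I) (i : I) : ‖ξ.val i‖ ≤ ‖ξ‖ :=
  lp.norm_apply_le_norm p.ne_zero ξ.1 i

theorem norm_mono {ξ : EllSpace p I} {η : EllSpace p I} (h : ∀ i, ‖ξ.val i‖ ≤ ‖η.val i‖) :
    ‖ξ‖ ≤ ‖η‖ := lp.norm_mono (x := ξ.1) (y := η.1) p.ne_zero h

theorem norm_mul_val_le (m : I → ℂ) (C : ℝ) (hC : 0 ≤ C) (hm : ∀ i, ‖m i‖ ≤ C)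
    (ξ : EllSpace p I) (i : I) : ‖m i * ξ.val i‖ ≤ ‖((C : ℂ) • ξ).val i‖ := by
  rw [val_smul, norm_mul, norm_mul, Complex.norm_of_nonneg hC]
  exact mul_le_mul_of_nonneg_right (hm i) (norm_nonneg _)

/-- Multiplication by a function `m` with `|m| ≤ C`. -/
def mulFun (m : I → ℂ) (C : ℝ) (hC : 0 ≤ C) (hm : ∀ i, ‖m i‖ ≤ C) (ξ : EllSpace p I) :
    EllSpace p I :=
  mk (fun i => m i * ξ.val i) ((memℓp_val ((C : ℂ) • ξ)).mono' (norm_mul_val_le m C hC hm ξ))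
    (squeeze_zero_norm (norm_mul_val_le m C hC hm ξ)
      (tendsto_zero_iff_norm_tendsto_zero.1 (tendsto_val ((C : ℂ) • ξ))))

/-- Multiplication by a function `m` with `|m| ≤ C`, as a bounded operator. -/
def mulCLM (m : I → ℂ) (C : ℝ) (hC : 0 ≤ C) (hm : ∀ i, ‖m i‖ ≤ C) :
    EllSpace p I →L[ℂ] EllSpace p I :=
  LinearMap.mkContinuous
    { toFun := mulFun m C hC hm
      map_add' := fun ξ η => ext fun i => mul_add _ _ _
      map_smul' := fun k ξ => ext fun i => mul_left_comm _ _ _ } C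
    fun ξ => by
      refine (norm_mono (ξ := mulFun m C hC hm ξ) (η := (C : ℂ) • ξ)
        (norm_mul_val_le m C hC hm ξ)).trans ?_
      rw [norm_smul, Complex.norm_of_nonneg hC]

theorem norm_mulCLM_le (m : I → ℂ) (C : ℝ) (hC : 0 ≤ C) (hm : ∀ i, ‖m i‖ ≤ C) :
    ‖(mulCLM m C hC hm : EllSpace p I →L[ℂ] EllSpace p I)‖ ≤ C :=
  LinearMap.mkContinuous_norm_le _ hC _

@[simp] theorem mulCLM_val (m : I → ℂ) (C : ℝ) (hC : 0 ≤ C) (hm : ∀ i, ‖m i‖ ≤ C)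
    (ξ : EllSpace p I) (i : I) : (mulCLM m C hC hm ξ).val i = m i * ξ.val i := rfl

theorem memℓp_reindex (e : I ≃ J) (ξ : EllSpace p I) :
    Memℓp (fun j : J => ξ.val (e.symm j)) p.1 := by
  have hξ := memℓp_val ξ
  rcases p.1.trichotomy with h | h | h
  · exact absurd h p.ne_zero
  · rw [h, memℓp_infty_iff] at hξ ⊢
    obtain ⟨C, hC⟩ := hξ
    exact ⟨C, by rintro _ ⟨j, rfl⟩; exact hC ⟨e.symm j, rfl⟩⟩
  · rw [memℓp_gen_iff h] at hξ ⊢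
    exact (e.symm.summable_iff (f := fun i => ‖ξ.val i‖ ^ p.1.toReal)).2 hξ

/-- Reindexing along a bijection. -/
def reindexFun (e : I ≃ J) (ξ : EllSpace p I) : EllSpace p J :=
  mk (fun j => ξ.val (e.symm j)) (memℓp_reindex e ξ)
    ((tendsto_val ξ).comp e.symm.injective.tendsto_cofinite)

@[simp] theorem reindexFun_val (e : I ≃ J) (ξ : EllSpace p I) (j : J) :
    (reindexFun e ξ).val j = ξ.val (e.symm j) := rfl

theorem norm_reindexFun_le (e : I ≃ J) (ξ : EllSpace p I) : ‖reindexFun e ξ‖ ≤ ‖ξ‖ := by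
  rcases p.1.trichotomy with h | h | h
  · exact absurd h p.ne_zero
  · exact norm_le_of_top h (norm_nonneg _) fun j => norm_val_le ξ (e.symm j)
  · rw [← Real.rpow_le_rpow_iff (norm_nonneg _) (norm_nonneg _) h, norm_rpow_eq h,
      norm_rpow_eq h]
    exact (e.symm.tsum_eq fun i => ‖ξ.val i‖ ^ p.1.toReal).le

/-- Reindexing along a bijection, as an isometric isomorphism. -/
def reindex (e : I ≃ J) : EllSpace p I ≃ₗᵢ[ℂ] EllSpace p J where
  toFun := reindexFun e
  invFun := reindexFun e.symm
  left_inv ξ := ext fun i => by simp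
  right_inv ξ := ext fun i => by simp
  map_add' _ _ := ext fun i => by simp
  map_smul' _ _ := ext fun i => by simp
  norm_map' ξ := by
    refine le_antisymm (norm_reindexFun_le e ξ) ?_
    have h := norm_reindexFun_le e.symm (reindexFun e ξ)
    have h2 : reindexFun e.symm (reindexFun e ξ) = ξ := ext fun i => by simp
    rwa [h2] at h

@[simp] theorem reindex_val (e : I ≃ J) (ξ : EllSpace p I) (j : J) :
    (reindex e ξ).val j = ξ.val (e.symm j) := rfl

open Classical in
/-- The restriction of a family to a finite set, extended by zero. -/
def cut (s : Finset I) (ξ : EllSpace p I) : EllSpace p I :=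
  mulCLM (fun i => if i ∈ s then 1 else 0) 1 zero_le_one
    (fun i => by split_ifs <;> simp) ξ

open Classical in
theorem cut_val (s : Finset I) (ξ : EllSpace p I) (i : I) :
    (cut s ξ).val i = if i ∈ s then ξ.val i else 0 := by
  simp [cut]

open Classical in
theorem exists_cut_near (ξ : EllSpace p I) {ε : ℝ} (hε : 0 < ε) :
    ∃ s : Finset I, ‖cut s ξ - ξ‖ ≤ ε := by
  by_cases hp : p.1 = ∞
  · have h : {i | ¬ ‖ξ.val i‖ < ε}.Finite := by
      have := Metric.tendsto_nhds.1 (tendsto_val ξ) ε hε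
      simpa [dist_zero_right] using! this
    refine ⟨h.toFinset, norm_le_of_top hp hε.le fun i => ?_⟩
    change ‖(cut h.toFinset ξ).val i - ξ.val i‖ ≤ ε
    rw [cut_val]
    by_cases hi : ‖ξ.val i‖ < ε
    · rw [if_neg (by simpa using hi)]
      simpa using hi.le
    · rw [if_pos (by simpa using hi)]
      simpa using hε.le
  · have h := lp.hasSum_single hp ξ.1
    obtain ⟨s, hs⟩ := (Metric.tendsto_nhds.1 h ε hε).exists
    refine ⟨s, ?_⟩
    rw [dist_eq_norm] at hs
    have h2 : ((cut s ξ - ξ : EllSpace p I) : lp (fun _ : I => ℂ) p.1) =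
        ∑ i ∈ s, lp.single p.1 i (ξ.1 i) - ξ.1 := by
      refine lp.ext (funext fun i => ?_)
      change (cut s ξ).val i - ξ.val i = _
      rw [cut_val, lp.coeFn_sub, lp.coeFn_sum]
      simp [Finset.sum_apply, lp.single_apply, Pi.single_apply, val]
    change ‖((cut s ξ - ξ : EllSpace p I) : lp (fun _ : I => ℂ) p.1)‖ ≤ ε
    rw [h2]
    exact hs.le

end EllSpace

/-- `E` is an `L^p`-space: it is isometrically isomorphic to `L^p(μ)` for some measure `μ`. -/
def IsLpSpace (p : Exponent) (E : Type w') [NormedAddCommGroup E] [NormedSpace ℂ E] : Prop :=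
  ∃ (Ω : Type w) (_ : MeasurableSpace Ω) (μ : MeasureTheory.Measure Ω),
    Nonempty (E ≃ₗᵢ[ℂ] MeasureTheory.Lp ℂ p.1 μ)

/-- `E` is a `C₀`-space: it is isometrically isomorphic to `C₀(Ω)` for some topological
space `Ω`. -/
def IsC0Space (E : Type w') [NormedAddCommGroup E] [NormedSpace ℂ E] : Prop :=
  ∃ (Ω : Type w) (_ : TopologicalSpace Ω), Nonempty (E ≃ₗᵢ[ℂ] C₀(Ω, ℂ))

/-- The spaces on which `F^p(α)` is represented: `L^p`-spaces for `p < ∞`, and `C₀`-spaces for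
`p = ∞`. -/
def IsModelSpace (p : Exponent) (E : Type w') [NormedAddCommGroup E] [NormedSpace ℂ E] : Prop :=
  (p.1 ≠ ∞ → IsLpSpace.{w} p E) ∧ (p.1 = ∞ → IsC0Space.{w} E)

section Model

variable {p : Exponent} {I : Type w}

theorem isC0Space_ellSpace (hp : p.1 = ∞) : IsC0Space.{w} (EllSpace p I) := by
  let _ : TopologicalSpace I := ⊥
  have : DiscreteTopology I := ⟨rfl⟩
  let g (f : C₀(I, ℂ)) : EllSpace p I := EllSpace.mk f
    (by
      rw [hp]
      exact memℓp_infty ⟨‖f‖, by rintro _ ⟨i, rfl⟩; exact norm_apply_le f i⟩)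
    (by
      have := f.zero_at_infty'
      rwa [Filter.cocompact_eq_cofinite] at this)
  let f (ξ : EllSpace p I) : C₀(I, ℂ) := ⟨⟨ξ.val, continuous_of_discreteTopology⟩, by
    rw [Filter.cocompact_eq_cofinite]; exact ξ.tendsto_val⟩
  refine ⟨I, ⊥, ⟨?_⟩⟩
  exact
  { toFun := f
    invFun := g
    left_inv := fun ξ => rfl
    right_inv := fun f => rfl
    map_add' := fun ξ η => rfl
    map_smul' := fun k ξ => rfl
    norm_map' := fun ξ => le_antisymm (norm_le_of _ (norm_nonneg _) ξ.norm_val_le)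
      (EllSpace.norm_le_of_top hp (norm_nonneg _) fun i => norm_apply_le (f ξ) i) }

theorem isLpSpace_ellSpace (hp : p.1 ≠ ∞) : IsLpSpace.{w} p (EllSpace p I) := by
  have h0 : 0 < p.1.toReal := ENNReal.toReal_pos p.ne_zero hp
  let _ : MeasurableSpace I := ⊤
  let μ : MeasureTheory.Measure I := MeasureTheory.Measure.count
  have hae {f g : I → ℂ} (h : f =ᵐ[μ] g) : f = g := by
    have h2 : MeasureTheory.ae μ = ⊤ := MeasureTheory.ae_eq_top.2 fun a => by simp [μ]
    rw [h2] at h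
    exact Filter.eventuallyEq_top.1 h
  have hsm (f : I → ℂ) : MeasureTheory.AEStronglyMeasurable f μ :=
    (measurable_from_top (f := f)).aestronglyMeasurable
  have hnorm (f : I → ℂ) : MeasureTheory.eLpNorm f p.1 μ =
      (∑' i, ‖f i‖ₑ ^ p.1.toReal) ^ (1 / p.1.toReal) := by
    rw [MeasureTheory.eLpNorm_eq_lintegral_rpow_enorm_toReal p.ne_zero hp,
      MeasureTheory.lintegral_count]
  have hconv (f : I → ℂ) (i : I) : ‖f i‖ₑ ^ p.1.toReal = ENNReal.ofReal (‖f i‖ ^ p.1.toReal) := by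
    rw [← ofReal_norm, ENNReal.ofReal_rpow_of_nonneg (norm_nonneg _) h0.le]
  have hmem (f : I → ℂ) : MeasureTheory.MemLp f p.1 μ ↔ Memℓp f p.1 := by
    rw [MeasureTheory.MemLp, memℓp_gen_iff h0, hnorm]
    simp only [hsm f, true_and, hconv]
    rw [ENNReal.rpow_lt_top_iff_of_pos (by positivity), lt_top_iff_ne_top]
    constructor
    · intro h
      exact (ENNReal.summable_toReal h).congr fun i =>
        ENNReal.toReal_ofReal (by positivity)
    · intro h
      rw [← ENNReal.ofReal_tsum_of_nonneg (fun i => by positivity) h]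
      exact ENNReal.ofReal_ne_top
  have htop (ξ : lp (fun _ : I => ℂ) p.1) : ξ ∈ ellSubmodule p I := by
    rw [ellSubmodule_eq_top p hp I]; trivial
  have hval (ξ : EllSpace p I) : ((hmem ξ.val).2 ξ.memℓp_val).toLp ξ.val = ξ.val :=
    hae (MeasureTheory.MemLp.coeFn_toLp _)
  refine ⟨I, ⊤, μ, ⟨?_⟩⟩
  exact
  { toFun := fun ξ => ((hmem ξ.val).2 ξ.memℓp_val).toLp ξ.val
    invFun := fun f => EllSpace.mk (fun i => f i) ((hmem f).1 (MeasureTheory.Lp.memLp f))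
      (htop ⟨fun i => f i, (hmem f).1 (MeasureTheory.Lp.memLp f)⟩)
    left_inv := fun ξ => EllSpace.ext fun i => congrFun (hval ξ) i
    right_inv := fun f => MeasureTheory.Lp.toLp_coeFn f _
    map_add' := fun ξ η => rfl
    map_smul' := fun k ξ => rfl
    norm_map' := fun ξ => by
      change ‖((hmem ξ.val).2 ξ.memℓp_val).toLp ξ.val‖ = ‖ξ‖
      have hs := (memℓp_gen_iff h0).1 ξ.memℓp_val
      rw [MeasureTheory.Lp.norm_toLp, hnorm]
      simp only [hconv]
      rw [← ENNReal.ofReal_tsum_of_nonneg (fun i => by positivity) hs, ← ENNReal.toReal_rpow,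
        ENNReal.toReal_ofReal (tsum_nonneg fun i => by positivity), ← EllSpace.norm_rpow_eq h0,
        one_div, Real.rpow_rpow_inv (norm_nonneg _) h0.ne'] }

theorem isModelSpace_ellSpace : IsModelSpace.{w} p (EllSpace p I) :=
  ⟨isLpSpace_ellSpace, isC0Space_ellSpace⟩

end Model

section GSet

variable {G : Type u} {X : Type v} [Group G] [TopologicalSpace X] [MulAction G X]
  [ContinuousConstSMul G X] {I : Type w} [MulAction G I]

/-- For a `G`-set `I` with an equivariant map `q : I → X`, the covariant pair on `ℓ^p(I)` (or
`c₀(I)`) given by `(π(a)ξ)(i) = a(q(i)) ξ(i)` and `(v_s ξ)(i) = ξ(s⁻¹ • i)`. -/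
def permCovariant (p : Exponent) (q : I → X) (hq : ∀ (s : G) (i : I), q (s • i) = s • q i) :
    CovariantRep G X (EllSpace p I) where
  π :=
    { toFun := fun a => EllSpace.mulCLM (fun i => a (q i)) ‖a‖ (norm_nonneg a)
        (fun i => norm_apply_le a (q i))
      map_smul' := fun k a => ContinuousLinearMap.ext fun ξ => EllSpace.ext fun i => by
        simp [mul_assoc]
      map_zero' := ContinuousLinearMap.ext fun ξ => EllSpace.ext fun i => by simp
      map_add' := fun a b => ContinuousLinearMap.ext fun ξ => EllSpace.ext fun i => by
        simp [add_mul]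
      map_mul' := fun a b => ContinuousLinearMap.ext fun ξ => EllSpace.ext fun i => by
        simp [mul_assoc] }
  norm_π_le a := EllSpace.norm_mulCLM_le _ _ _ _
  v :=
    { toFun := fun s => EllSpace.reindex (MulAction.toPerm s)
      map_one' := LinearIsometryEquiv.ext fun ξ => EllSpace.ext fun i => by simp
      map_mul' := fun s t => LinearIsometryEquiv.ext fun ξ => EllSpace.ext fun i => by
        simp [mul_smul] }
  covariant t a ξ := EllSpace.ext fun i => by simp [hq]

/-- The integrated form of the covariant pair attached to an equivariant map `q : I → X`. -/
def permRep (p : Exponent) (q : I → X) (hq : ∀ (s : G) (i : I), q (s • i) = s • q i) :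
    BanachRep (L1Algebra G X) (EllSpace p I) := (permCovariant p q hq).integrated

theorem permRep_apply (p : Exponent) (q : I → X) (hq : ∀ (s : G) (i : I), q (s • i) = s • q i)
    (b : L1Algebra G X) (ξ : EllSpace p I) (i : I) :
    (permRep p q hq b ξ).val i = ∑' s, b s (q i) * ξ.val (s⁻¹ • i) := by
  let ev : EllSpace p I →L[ℂ] ℂ := LinearMap.mkContinuous
    ⟨⟨fun ξ => ξ.val i, fun _ _ => rfl⟩, fun _ _ => rfl⟩ 1 fun ξ => by
      rw [one_mul]; exact ξ.norm_val_le i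
  have h := ((permCovariant p q hq).summable_term b)
  have h2 := h.mapL (ContinuousLinearMap.apply ℂ (EllSpace p I) ξ)
  have h3 : permRep p q hq b ξ = ∑' s, (permCovariant p q hq).term s (b s) ξ :=
    (ContinuousLinearMap.apply ℂ (EllSpace p I) ξ).map_tsum h
  rw [h3]
  exact ev.map_tsum h2

theorem nondegenerate_permRep [T2Space X] [LocallyCompactSpace X] (p : Exponent) (q : I → X)
    (hq : ∀ (s : G) (i : I), q (s • i) = s • q i) :
    (permRep p q hq).Nondegenerate := by
  classical
  rw [BanachRep.Nondegenerate, ← Submodule.dense_iff_topologicalClosure_eq_top]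
  intro ξ
  refine Metric.mem_closure_iff.2 fun ε hε => ?_
  obtain ⟨s, hs⟩ := EllSpace.exists_cut_near ξ (half_pos hε)
  refine ⟨EllSpace.cut s ξ, ?_, ?_⟩
  · obtain ⟨f, hf1, -, hf, -⟩ := exists_continuous_one_zero_of_isCompact
      (s.finite_toSet.image q).isCompact isClosed_empty (Set.disjoint_empty _)
    let a : C₀(X, ℂ) := ⟨⟨fun x => (f x : ℂ), by fun_prop⟩, by
      have h := (Complex.continuous_ofReal.tendsto 0).comp hf.is_zero_at_infty
      simpa using! h⟩
    refine Submodule.subset_span ⟨L1Algebra.coeff a, EllSpace.cut s ξ, ?_⟩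
    rw [permRep, CovariantRep.integrated_coeff]
    refine EllSpace.ext fun i => ?_
    change (f (q i) : ℂ) * (EllSpace.cut s ξ).val i = (EllSpace.cut s ξ).val i
    rw [EllSpace.cut_val]
    split_ifs with hi
    · have h1 : f (q i) = 1 := hf1 (Set.mem_image_of_mem q hi)
      rw [h1]; simp
    · simp
  · rw [dist_comm, dist_eq_norm]
    linarith

end GSet

section CrossedProduct

variable (G : Type u) (X : Type v) [Group G] [TopologicalSpace X] [MulAction G X]
  [ContinuousConstSMul G X]

/-- The norm `‖b‖_{L^p} = sup ‖ψ(b)‖` on `F(α)`, where `ψ` runs over the non-degenerate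
representations of `F(α)` on `L^p`-spaces (on `C₀`-spaces for `p = ∞`). The spaces are taken in the
universe of `F(α)`. This loses nothing: up to `ε`, the norm of `ψ(b)` is attained on an invariant
`L^p`-subspace (`C₀`-subspace) whose density character is bounded in terms of `G` and `C₀(X)`. -/
def fullNorm (p : Exponent) : AlgSeminorm (L1Algebra G X) :=
  AlgSeminorm.sup {N | ∃ (E : Type max u v) (_ : NormedAddCommGroup E) (_ : NormedSpace ℂ E)
    (ψ : BanachRep (L1Algebra G X) E),
    IsModelSpace.{max u v} p E ∧ ψ.Nondegenerate ∧ N = ψ.seminorm}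

/-- The regular representation `Λ_p` of `F(α)` on `ℓ^p(X × G)` (on `c₀(X × G)` for `p = ∞`):
`(Λ_p(b)ξ)(x, t) = ∑_s b(s)(x) ξ(s⁻¹ • x, s⁻¹ t)`. -/
def regularRep (p : Exponent) : BanachRep (L1Algebra G X) (EllSpace p (X × G)) :=
  permRep p Prod.fst fun _ _ => rfl

/-- The `C₀(X)`-trivial representation `Λ_p^tr` of `F(α)` on `ℓ^p(X)` (on `c₀(X)` for `p = ∞`):
`(Λ_p^tr(b)ξ)(x) = ∑_s b(s)(x) ξ(s⁻¹ • x)`. -/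
def trivialRep (p : Exponent) : BanachRep (L1Algebra G X) (EllSpace p X) :=
  permRep p id fun _ _ => rfl

variable {G X}

theorem regularRep_apply (p : Exponent) (b : L1Algebra G X) (ξ : EllSpace p (X × G)) (x : X)
    (t : G) : (regularRep G X p b ξ).val (x, t) = ∑' s, b s x * ξ.val (s⁻¹ • x, s⁻¹ * t) :=
  permRep_apply _ _ _ _ _ _

theorem trivialRep_apply (p : Exponent) (b : L1Algebra G X) (ξ : EllSpace p X) (x : X) :
    (trivialRep G X p b ξ).val x = ∑' s, b s x * ξ.val (s⁻¹ • x) :=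
  permRep_apply _ _ _ _ _ _

theorem norm_le_fullNorm {p : Exponent} {E : Type w} [NormedAddCommGroup E] [NormedSpace ℂ E]
    (hE : IsModelSpace.{max u v} p E) (ψ : BanachRep (L1Algebra G X) E) (hψ : ψ.Nondegenerate)
    (b : L1Algebra G X) : ‖ψ b‖ ≤ fullNorm G X p b := by
  by_cases hp : p.1 = ∞
  · obtain ⟨Ω, _, ⟨e⟩⟩ := hE.2 hp
    refine (ψ.norm_le_conj e b).trans (AlgSeminorm.le_sup (N := (ψ.conj e).seminorm) ?_ b)
    exact ⟨C₀(Ω, ℂ), inferInstance, inferInstance, ψ.conj e,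
        ⟨fun h => absurd hp h, fun _ => ⟨Ω, inferInstance, ⟨LinearIsometryEquiv.refl ℂ _⟩⟩⟩,
        hψ.conj e, rfl⟩
  · obtain ⟨Ω, _, μ, ⟨e⟩⟩ := hE.1 hp
    refine (ψ.norm_le_conj e b).trans (AlgSeminorm.le_sup (N := (ψ.conj e).seminorm) ?_ b)
    exact ⟨MeasureTheory.Lp ℂ p.1 μ, inferInstance, inferInstance, ψ.conj e,
        ⟨fun _ => ⟨Ω, inferInstance, μ, ⟨LinearIsometryEquiv.refl ℂ _⟩⟩, fun h => absurd h hp⟩,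
        hψ.conj e, rfl⟩

theorem IsModelSpace.congr {p : Exponent} {E : Type w} {E' : Type w'} [NormedAddCommGroup E]
    [NormedSpace ℂ E] [NormedAddCommGroup E'] [NormedSpace ℂ E']
    (h : IsModelSpace.{v} p E) (e : E' ≃ₗᵢ[ℂ] E) : IsModelSpace.{v} p E' := by
  refine ⟨fun hp => ?_, fun hp => ?_⟩
  · obtain ⟨Ω, m, μ, ⟨f⟩⟩ := h.1 hp
    exact ⟨Ω, m, μ, ⟨e.trans f⟩⟩
  · obtain ⟨Ω, m, ⟨f⟩⟩ := h.2 hp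
    exact ⟨Ω, m, ⟨e.trans f⟩⟩

variable [T2Space X] [LocallyCompactSpace X]

theorem norm_regularRep_le (p : Exponent) (b : L1Algebra G X) :
    ‖regularRep G X p b‖ ≤ fullNorm G X p b :=
  norm_le_fullNorm isModelSpace_ellSpace _ (nondegenerate_permRep _ _ _) b

theorem norm_trivialRep_le (p : Exponent) (b : L1Algebra G X) :
    ‖trivialRep G X p b‖ ≤ fullNorm G X p b :=
  norm_le_fullNorm ((isModelSpace_ellSpace (I := ULift.{u} X)).congr
    (EllSpace.reindex Equiv.ulift.symm)) _ (nondegenerate_permRep _ _ _) b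

end CrossedProduct

section PCrossedProduct

variable (G : Type u) (X : Type v) [Group G] [TopologicalSpace X] [MulAction G X]
  [ContinuousConstSMul G X]

open Classical in
/-- The norm `‖b‖_P = sup_{p ∈ P} ‖b‖_{L^p}` on `F(α)`; for `P = ∅` it is the norm of `F(α)`. -/
def fullNormP (P : Set Exponent) : AlgSeminorm (L1Algebra G X) :=
  if P = ∅ then AlgSeminorm.ofNorm (L1Algebra G X) else AlgSeminorm.sup (fullNorm G X '' P)

open Classical in
/-- The norm `‖b‖_{P,red} = sup_{p ∈ P} ‖Λ_p(b)‖` on `F(α)`; for `P = ∅` it is the norm of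
`F(α)`. -/
def reducedNormP (P : Set Exponent) : AlgSeminorm (L1Algebra G X) :=
  if P = ∅ then AlgSeminorm.ofNorm (L1Algebra G X)
  else AlgSeminorm.sup ((fun p => (regularRep G X p).seminorm) '' P)

/-- The crossed product `F^P(α)`. -/
abbrev FullCrossedProduct (P : Set Exponent) : Type max u v :=
  HausdorffCompletion (fullNormP G X P)

/-- The reduced crossed product `F^P_red(α)`. -/
abbrev ReducedCrossedProduct (P : Set Exponent) : Type max u v :=
  HausdorffCompletion (reducedNormP G X P)

/-- The exponents used in the `C₀(X)`-trivial representation: those in `P`, and all exponents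
if `P = ∅`. -/
def trivialExponents (P : Set Exponent) : Set Exponent := {p | P = ∅ ∨ p ∈ P}

/-- The `ℓ^∞`-direct sum of the representations `Λ_p^tr` of `F(α)` over `p ∈ P` (over all
`p ∈ [1, ∞]` if `P = ∅`). -/
def trivialSum (P : Set Exponent) : BanachRep (L1Algebra G X)
    (lp (fun p : trivialExponents P => EllSpace p.1 X) ∞) :=
  BanachRep.directSum fun p => trivialRep G X p.1

/-- The canonical copy of `C₀(X)` in `F^P(α)`. -/
def coefficients (P : Set Exponent) : NonUnitalSubalgebra ℂ (FullCrossedProduct G X P) :=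
  NonUnitalAlgHom.range ((HausdorffCompletion.ofHom (fullNormP G X P)).comp L1Algebra.coeff)

variable {G X}

theorem le_fullNormP {P : Set Exponent} {p : Exponent} (hp : p ∈ P) (b : L1Algebra G X) :
    fullNorm G X p b ≤ fullNormP G X P b := by
  rw [fullNormP, if_neg (Set.nonempty_iff_ne_empty.1 ⟨p, hp⟩)]
  exact AlgSeminorm.le_sup (Set.mem_image_of_mem _ hp) b

variable [T2Space X] [LocallyCompactSpace X]

theorem reducedNormP_le (P : Set Exponent) (b : L1Algebra G X) :
    reducedNormP G X P b ≤ fullNormP G X P b := by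
  by_cases hP : P = ∅
  · rw [reducedNormP, fullNormP, if_pos hP, if_pos hP]
  · rw [reducedNormP, if_neg hP]
    refine AlgSeminorm.sup_le (AlgSeminorm.nonneg _ b) ?_
    rintro _ ⟨p, hp, rfl⟩
    exact (norm_regularRep_le p b).trans (le_fullNormP hp b)

theorem norm_trivialSum_le (P : Set Exponent) (b : L1Algebra G X) :
    ‖trivialSum G X P b‖ ≤ fullNormP G X P b := by
  refine BanachRep.norm_directSum_le _ _ (AlgSeminorm.nonneg _ b) fun p => ?_
  rcases p.2 with hP | hp
  · rw [fullNormP, if_pos hP]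
    exact (trivialRep G X p.1).contractive b
  · exact (norm_trivialRep_le p.1 b).trans (le_fullNormP hp b)

variable (G X)

/-- The regular representation `Λ_P : F^P(α) → F^P_red(α)`, which is the identity on `F(α)`. -/
def regularHom (P : Set Exponent) : FullCrossedProduct G X P →ₙₐ[ℂ] ReducedCrossedProduct G X P :=
  HausdorffCompletion.extend (HausdorffCompletion.ofHom (reducedNormP G X P)) fun b =>
    (HausdorffCompletion.norm_of b).le.trans (reducedNormP_le P b)

/-- The `C₀(X)`-trivial representation `Λ_P^tr` of `F^P(α)`: the extension of the `ℓ^∞`-direct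
sum of the representations `Λ_p^tr`. -/
def trivialHom (P : Set Exponent) : FullCrossedProduct G X P →ₙₐ[ℂ]
    (lp (fun p : trivialExponents P => EllSpace p.1 X) ∞ →L[ℂ]
      lp (fun p : trivialExponents P => EllSpace p.1 X) ∞) :=
  HausdorffCompletion.extend (trivialSum G X P).toHom (norm_trivialSum_le P)

end PCrossedProduct

section Ideals

variable {B : Type u} [NonUnitalNormedRing B] [NormedSpace ℂ B]

/-- A (closed, two-sided) ideal of a Banach algebra. -/
structure IsClosedIdeal (J : Submodule ℂ B) : Prop where
  isClosed : IsClosed (J : Set B)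
  mul_mem_left : ∀ (b : B) {x : B}, x ∈ J → b * x ∈ J
  mul_mem_right : ∀ (b : B) {x : B}, x ∈ J → x * b ∈ J

/-- `A ⊆ B` has the generalised intersection property with hidden ideal `J`: `J` is the largest
ideal of `B` with `J ∩ A = {0}`. -/
def HasHiddenIdeal (A : NonUnitalSubalgebra ℂ B) (J : Submodule ℂ B) : Prop :=
  IsGreatest {I : Submodule ℂ B | IsClosedIdeal I ∧ (I : Set B) ∩ A = {0}} J

/-- `A` detects ideals in `B`: every non-zero ideal of `B` meets `A` non-trivially. -/
def DetectsIdeals (A : NonUnitalSubalgebra ℂ B) : Prop :=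
  ∀ I : Submodule ℂ B, IsClosedIdeal I → I ≠ ⊥ → (I : Set B) ∩ A ≠ {0}

end Ideals

/-- The kernel of an algebra homomorphism, as a subspace. -/
def kernel {A : Type u} {B : Type v} [NonUnitalNonAssocSemiring A] [Module ℂ A]
    [NonUnitalNonAssocSemiring B] [Module ℂ B] (f : A →ₙₐ[ℂ] B) : Submodule ℂ A :=
  LinearMap.ker (f : A →ₗ[ℂ] B)

/-- The action of `G` on `X` is topologically free: for `t ≠ 1` the fixed point set of `t` has
empty interior. -/
def TopologicallyFree (G : Type u) (X : Type v) [Group G] [TopologicalSpace X] [MulAction G X] :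
    Prop :=
  ∀ t : G, t ≠ 1 → interior {x : X | t • x = x} = ∅

end BanachCrossedProduct

end

open BanachCrossedProduct

/-! The link between freeness and ideals is the family of coefficients `b ↦ b t`. Suppose the action
is topologically free and `M` is a submultiplicative seminorm on F(α), below the ℓ¹-norm and
faithful on C₀(X). Near a point moved by every `s ≠ 1` in the finite support of `b`, a bump `f`
compresses `b` to the function `f b(1) f`. By Kaplansky's theorem `M` dominates the supremum norm on
C₀(X), so `‖b 1‖ ≤ M b`, and translation gives `‖b t‖ ≤ M b` (`TopologicallyFree.norm_apply_le`).

1 → 2: take for `M` the quotient seminorm of an ideal `I` with `I ∩ C₀(X) = 0`. All coefficients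
then vanish on `I`, and an element of the reduced algebra is determined by its coefficients
(`eq_zero_of_reducedCoeff_eq_zero`), so `I ≤ ker Λ_P`. 2 → 3: the kernel of the trivial
representation is itself an ideal that meets C₀(X) in zero. 3 → 1: if `t ≠ 1` fixes an open set
pointwise and `f` lives there, `f δ_1 - f δ_t` is killed by every trivial representation but has
coefficient `f` at the identity.

Detection of ideals for `T ⊆ {1, ∞}` rests on the equality of full and reduced norms
(`fullNormP_le_reducedNormP`), which makes `Λ_T` injective. Real functions in C₀(X) act by hermitian
operators in every non-degenerate representation. On C₀-spaces and L¹-spaces, hermitian operators do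
not enlarge zero sets, so C₀(X) acts pointwise. This bounds `‖ψ(b)‖` by `sup_x Σ_s |b(s)(x)|` for `p
= ∞` and by `sup_x Σ_s |b(s)(s x)|` for `p = 1`; the rows of `Λ_∞` and the columns of `Λ_1` show
that the regular representations reach these values. Conversely, if C₀(X) detects ideals, the kernel
of the trivial representation is zero, so condition 3 holds with `P = T`. -/

namespace BanachCrossedProduct

/-! ### Functions in C₀(X) and Kaplansky's theorem -/

section Functions

variable {X : Type v} [TopologicalSpace X]

/-- The product of a function in `C₀(X)` and a continuous function bounded by one. -/
noncomputable def mulBounded (m : C(X, ℂ)) (hm : ∀ x, ‖m x‖ ≤ 1) (f : C₀(X, ℂ)) : C₀(X, ℂ) :=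
  ⟨m * f.toContinuousMap, squeeze_zero_norm (fun x => by
    simpa using mul_le_mul_of_nonneg_right (hm x) (norm_nonneg (f x)))
    (tendsto_zero_iff_norm_tendsto_zero.1 f.zero_at_infty')⟩

@[simp] theorem mulBounded_apply (m : C(X, ℂ)) (hm : ∀ x, ‖m x‖ ≤ 1) (f : C₀(X, ℂ)) (x : X) :
    mulBounded m hm f x = m x * f x := rfl

theorem norm_mulBounded_le (m : C(X, ℂ)) (hm : ∀ x, ‖m x‖ ≤ 1) (f : C₀(X, ℂ)) :
    ‖mulBounded m hm f‖ ≤ ‖f‖ :=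
  norm_le_of _ (norm_nonneg _) fun x => by
    rw [mulBounded_apply, norm_mul]
    exact (mul_le_of_le_one_left (norm_nonneg _) (hm x)).trans (norm_apply_le f x)

theorem realPart_apply_im (a : C₀(X, ℂ)) (x : X) :
    ((realPart a : C₀(X, ℂ)) x).im = 0 := by
  have h := DFunLike.congr_fun (realPart a).2.star_eq x
  exact Complex.conj_eq_iff_im.1 h

theorem imaginaryPart_apply_im (a : C₀(X, ℂ)) (x : X) :
    ((imaginaryPart a : C₀(X, ℂ)) x).im = 0 := by
  have h := DFunLike.congr_fun (imaginaryPart a).2.star_eq x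
  exact Complex.conj_eq_iff_im.1 h

variable [T2Space X] [LocallyCompactSpace X]

/-- Real values are recorded for the approximate unit: if `e` and `a` are real, then `e` and `i t a`
are orthogonal at each point, which is what makes real functions act by hermitian operators. -/
theorem exists_one_zero {K U : Set X} (hK : IsCompact K) (hU : IsOpen U) (hKU : K ⊆ U) :
    ∃ f : C₀(X, ℂ), (∀ x ∈ K, f x = 1) ∧ (∀ x ∉ U, f x = 0) ∧ ‖f‖ ≤ 1 ∧ ∀ x, (f x).im = 0 := by
  obtain ⟨f, hf1, hf0, hf, hf'⟩ := exists_continuous_one_zero_of_isCompact hK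
    hU.isClosed_compl (Set.disjoint_compl_right_iff_subset.2 hKU)
  let a : C₀(X, ℂ) := ⟨⟨fun x => (f x : ℂ), by fun_prop⟩, by
    have h := (Complex.continuous_ofReal.tendsto 0).comp hf.is_zero_at_infty
    simpa using! h⟩
  refine ⟨a, fun x hx => ?_, fun x hx => ?_, norm_le_of _ zero_le_one fun x => ?_, fun x => ?_⟩
  · change (f x : ℂ) = 1
    rw [hf1 hx]; simp
  · change (f x : ℂ) = 0
    rw [hf0 hx]; simp
  · change ‖(f x : ℂ)‖ ≤ 1
    rw [Complex.norm_of_nonneg (hf' x).1]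
    exact (hf' x).2
  · exact Complex.ofReal_im _

theorem exists_bump {x : X} {V : Set X} (hV : V ∈ 𝓝 x) :
    ∃ f : C₀(X, ℂ), f x = 1 ∧ (∀ y ∉ V, f y = 0) ∧ ‖f‖ ≤ 1 := by
  obtain ⟨U, hUV, hU, hx⟩ := mem_nhds_iff.1 hV
  obtain ⟨f, h1, h0, hf, -⟩ := exists_one_zero (isCompact_singleton (x := x)) hU
    (Set.singleton_subset_iff.2 hx)
  exact ⟨f, h1 x rfl, fun y hy => h0 y fun h => hy (hUV h), hf⟩

/-- Kaplansky's theorem: an algebra norm on `C₀(X)` dominates the supremum norm. -/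
theorem norm_apply_le_algSeminorm (M : AlgSeminorm C₀(X, ℂ)) (hM : ∀ a, M a = 0 → a = 0)
    (a : C₀(X, ℂ)) (x : X) : ‖a x‖ ≤ M a := by
  by_contra! hlt
  obtain ⟨r, hr, hr'⟩ := exists_between hlt
  have hr0 : 0 < r := (M.nonneg a).trans_lt hr
  -- `c` is `r / a` where `|a| > r`. The maximum with `r` keeps it continuous and bounded by one on
  -- all of `X`.
  let c : C(X, ℂ) := ⟨fun y => r * (starRingEnd ℂ (a y) / (max ‖a y‖ r : ℝ) ^ 2), by
    refine continuous_const.mul (Continuous.div (by fun_prop) (by fun_prop) fun y => ?_)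
    exact pow_ne_zero _ (Complex.ofReal_ne_zero.2 (hr0.trans_le (le_max_right _ _)).ne')⟩
  have hc (y : X) : ‖c y‖ ≤ 1 := by
    have h2 : 0 < max ‖a y‖ r := hr0.trans_le (le_max_right _ _)
    change ‖(r : ℂ) * (starRingEnd ℂ (a y) / (max ‖a y‖ r : ℝ) ^ 2)‖ ≤ 1
    rw [norm_mul, norm_div, norm_pow, RCLike.norm_conj, Complex.norm_of_nonneg hr0.le,
      Complex.norm_of_nonneg h2.le, ← mul_div_assoc, div_le_one (by positivity), sq]
    exact mul_le_mul (le_max_right _ _) (le_max_left _ _) (norm_nonneg _) h2.le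
  let V : Set X := {y | r < ‖a y‖}
  have hV : V ∈ 𝓝 x := (isOpen_lt continuous_const (by fun_prop)).mem_nhds hr'
  -- On functions supported in `V`, `r f = a (c f)`, and `c f` is again supported in `V` with no
  -- larger norm. Each use gains a factor `M a / r < 1`, so `M` vanishes on a bump at `x`, against
  -- faithfulness.
  have key (n : ℕ) : ∀ f : C₀(X, ℂ), (∀ y ∉ V, f y = 0) → M f ≤ (M a / r) ^ n * ‖f‖ := by
    induction n with
    | zero => intro f _; simpa using M.le_norm f
    | succ n ih =>
      intro f hf
      have h1 : (r : ℂ) • f = a * mulBounded c hc f := by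
        ext y
        change r * f y = a y * (c y * f y)
        by_cases hy : y ∈ V
        · have h2 : max ‖a y‖ r = ‖a y‖ := max_eq_left (le_of_lt hy)
          have h3 : (‖a y‖ : ℂ) ≠ 0 := Complex.ofReal_ne_zero.2 (hr0.trans hy).ne'
          change r * f y = a y * (r * (starRingEnd ℂ (a y) / (max ‖a y‖ r : ℝ) ^ 2) * f y)
          rw [h2]
          have h4 : a y * starRingEnd ℂ (a y) = (‖a y‖ : ℂ) ^ 2 := Complex.mul_conj' _
          field_simp
          rw [← h4]; ring
        · rw [hf y hy]; simp
      have h2 := M.mul_le a (mulBounded c hc f)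
      rw [← h1, M.map_smul, Complex.norm_of_nonneg hr0.le] at h2
      have h3 := ih (mulBounded c hc f) fun y hy => by simp [hf y hy]
      have h4 : 0 ≤ M a / r := div_nonneg (M.nonneg a) hr0.le
      calc M f = (r * M f) / r := by field_simp
        _ ≤ (M a * ((M a / r) ^ n * ‖f‖)) / r := by
          refine div_le_div_of_nonneg_right (h2.trans (mul_le_mul_of_nonneg_left ?_ (M.nonneg a)))
            hr0.le
          exact h3.trans (mul_le_mul_of_nonneg_left (norm_mulBounded_le _ _ _) (by positivity))
        _ = (M a / r) ^ (n + 1) * ‖f‖ := by ring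
  obtain ⟨f, hfx, hfV, -⟩ := exists_bump hV
  have hlim : Filter.Tendsto (fun n : ℕ => (M a / r) ^ n * ‖f‖) Filter.atTop (𝓝 0) := by
    have := (tendsto_pow_atTop_nhds_zero_of_lt_one (div_nonneg (M.nonneg a) hr0.le)
      ((div_lt_one hr0).2 hr)).mul_const ‖f‖
    simpa using this
  have h0 : f = 0 := hM f (le_antisymm (ge_of_tendsto' hlim fun n => key n f hfV) (M.nonneg f))
  rw [h0] at hfx
  simp at hfx

end Functions

/-! ### Pull-backs of seminorms, and the elements `a δ_s` of F(α) -/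

namespace AlgSeminorm

variable {A : Type u} {B : Type v} [NonUnitalNormedRing A] [NormedSpace ℂ A]
  [NonUnitalNormedRing B] [NormedSpace ℂ B]

/-- The pull-back of an algebra seminorm along a contractive homomorphism. -/
noncomputable def comap (M : AlgSeminorm B) (f : A →ₙₐ[ℂ] B) (hf : ∀ a, ‖f a‖ ≤ ‖a‖) : AlgSeminorm A where
  toSeminorm := M.toSeminorm.comp (f : A →ₗ[ℂ] B)
  mul_le' a b := (congrArg M (map_mul f a b)).le.trans (M.mul_le (f a) (f b))
  le_norm' a := (M.le_norm (f a)).trans (hf a)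

protected theorem continuous (M : AlgSeminorm B) : Continuous fun b => M b :=
  Seminorm.continuous_of_le (q := normSeminorm ℂ B) continuous_norm fun b => M.le_norm b

end AlgSeminorm

namespace L1Algebra

section Single

variable {G : Type u} {X : Type v} [TopologicalSpace X]

open Classical in
/-- The element `a δ_s` of `F(α)`. -/
noncomputable def single (s : G) (a : C₀(X, ℂ)) : L1Algebra G X :=
  (lp.single 1 s a : lp (fun _ : G => C₀(X, ℂ)) 1)

open Classical in
@[simp] theorem single_apply_self (s : G) (a : C₀(X, ℂ)) : single s a s = a :=
  lp.single_apply_self (E := fun _ : G => C₀(X, ℂ)) 1 s a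

open Classical in
theorem single_apply_ne {s t : G} (h : t ≠ s) (a : C₀(X, ℂ)) : single s a t = 0 :=
  lp.single_apply_ne (E := fun _ : G => C₀(X, ℂ)) 1 s a h

open Classical in
theorem norm_single (s : G) (a : C₀(X, ℂ)) : ‖single s a‖ = ‖a‖ :=
  lp.norm_single (E := fun _ : G => C₀(X, ℂ)) (by simp) s a

open Classical in
theorem hasSum_single (b : L1Algebra G X) : HasSum (fun s => single s (b s)) b :=
  lp.hasSum_single (E := fun _ : G => C₀(X, ℂ)) ENNReal.one_ne_top
    (show lp (fun _ : G => C₀(X, ℂ)) 1 from b)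

/-- The map `b ↦ b t`. -/
noncomputable def evalLinear (t : G) : L1Algebra G X →ₗ[ℂ] C₀(X, ℂ) where
  toFun b := b t
  map_add' _ _ := rfl
  map_smul' _ _ := rfl

@[simp] theorem evalLinear_apply (t : G) (b : L1Algebra G X) : evalLinear t b = b t := rfl

theorem continuous_eval (t : G) : Continuous fun b : L1Algebra G X => b t :=
  AddMonoidHomClass.continuous_of_bound (evalLinear t) 1 fun b => by
    simpa using norm_apply_le b t

end Single

section Product

variable {G : Type u} {X : Type v} [Group G] [TopologicalSpace X] [MulAction G X]
  [ContinuousConstSMul G X]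

theorem coeff_eq_single (a : C₀(X, ℂ)) : (coeff a : L1Algebra G X) = single 1 a :=
  ext fun t => by
    by_cases h : t = 1
    · subst h; rw [coeff_apply_one, single_apply_self]
    · rw [coeff_apply_ne a h, single_apply_ne h]

theorem single_mul_apply (s : G) (a : C₀(X, ℂ)) (b : L1Algebra G X) (r : G) :
    (single s a * b) r = a * act s (b (s⁻¹ * r)) := by
  rw [mul_apply, tsum_eq_single s fun t ht => by rw [single_apply_ne ht, zero_mul],
    single_apply_self]

theorem mul_single_apply (s : G) (a : C₀(X, ℂ)) (b : L1Algebra G X) (r : G) :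
    (b * single s a) r = b (r * s⁻¹) * act (r * s⁻¹) a := by
  rw [mul_apply, tsum_eq_single (r * s⁻¹), mul_inv_rev, inv_inv, inv_mul_cancel_right,
    single_apply_self]
  intro t ht
  rw [single_apply_ne, map_zero, mul_zero]
  rintro rfl
  simp at ht

theorem single_mul_single (s t : G) (a c : C₀(X, ℂ)) :
    (single s a * single t c : L1Algebra G X) = single (s * t) (a * act s c) :=
  ext fun r => by
    rw [single_mul_apply]
    by_cases h : r = s * t
    · subst h; simp
    · rw [single_apply_ne h, single_apply_ne, map_zero, mul_zero]
      rintro rfl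
      simp at h

theorem coeff_mul_apply (a : C₀(X, ℂ)) (b : L1Algebra G X) (r : G) :
    (coeff a * b : L1Algebra G X) r = a * b r := by
  rw [coeff_eq_single, single_mul_apply, act_one, inv_one, one_mul]

theorem norm_coeff (a : C₀(X, ℂ)) : ‖(coeff a : L1Algebra G X)‖ = ‖a‖ := by
  rw [coeff_eq_single, norm_single]

theorem mul_coeff_apply (a : C₀(X, ℂ)) (b : L1Algebra G X) (r : G) :
    (b * coeff a : L1Algebra G X) r = b r * act r a := by
  rw [coeff_eq_single, mul_single_apply, inv_one, mul_one]

end Product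

end L1Algebra

/-! ### Coefficient bounds for topologically free actions -/

section Free

variable {G : Type u} {X : Type v} [Group G] [TopologicalSpace X] [T2Space X]
  [MulAction G X] [ContinuousConstSMul G X]

/-- Separate `x` from `s⁻¹ • x`, pull the second neighbourhood back to `x`, and intersect over the
finite set `S`. For `f` supported in `V`, the product `f α_s(f)` is then zero for each `s ∈ S`. -/
theorem exists_nhds_smul_disjoint {x : X} (S : Finset G) (hS : ∀ s ∈ S, s • x ≠ x) :
    ∃ V ∈ 𝓝 x, ∀ s ∈ S, ∀ y ∈ V, s⁻¹ • y ∉ V := by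
  have h (s : G) : ∃ V ∈ 𝓝 x, s ∈ S → ∀ y ∈ V, s⁻¹ • y ∉ V := by
    by_cases hs : s ∈ S
    · have hne : x ≠ s⁻¹ • x := fun h => hS s hs (by rw [h, smul_inv_smul, ← h])
      obtain ⟨U, W, hU, hW, hxU, hxW, hd⟩ := t2_separation hne
      refine ⟨U ∩ (fun y => s⁻¹ • y) ⁻¹' W, Filter.inter_mem (hU.mem_nhds hxU)
        ((hW.preimage (continuous_const_smul _)).mem_nhds hxW), fun _ y hy hy' => ?_⟩
      exact Set.disjoint_left.1 hd hy'.1 hy.2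
    · exact ⟨Set.univ, Filter.univ_mem, fun h => absurd h hs⟩
  choose V hV hV' using h
  refine ⟨⋂ s ∈ S, V s, (Filter.biInter_finset_mem S).2 fun s _ => hV s, fun s hs y hy hy' => ?_⟩
  exact hV' s hs y (Set.mem_iInter₂.1 hy s hs) (Set.mem_iInter₂.1 hy' s hs)

variable [LocallyCompactSpace X]

theorem dense_setOf_smul_ne (h : TopologicallyFree G X) (S : Finset G) (hS : 1 ∉ S) :
    Dense {x : X | ∀ s ∈ S, s • x ≠ x} := by
  have h1 (s : G) : IsOpen {x : X | s • x ≠ x} :=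
    isOpen_ne_fun (continuous_const_smul s) continuous_id
  have h2 : {x : X | ∀ s ∈ S, s • x ≠ x} = ⋂ s ∈ (S : Set G), {x : X | s • x ≠ x} := by
    ext x; simp
  rw [h2]
  refine dense_biInter_of_isOpen (fun s _ => h1 s) S.countable_toSet fun s hs => ?_
  have h3 := interior_eq_empty_iff_dense_compl.1 (h s (by rintro rfl; exact hS hs))
  exact h3

/-- For a topologically free action, every algebra seminorm on `F(α)` that is faithful on
`C₀(X)` dominates the norm of the coefficient at the identity. -/
theorem TopologicallyFree.norm_apply_one_le (h : TopologicallyFree G X)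
    (M : AlgSeminorm (L1Algebra G X))
    (hM : ∀ a : C₀(X, ℂ), M (L1Algebra.coeff a) = 0 → a = 0) (b : L1Algebra G X) :
    ‖b 1‖ ≤ M b := by
  classical
  have hK (a : C₀(X, ℂ)) (x : X) : ‖a x‖ ≤ M (L1Algebra.coeff a) :=
    norm_apply_le_algSeminorm (M.comap L1Algebra.coeff fun a => (L1Algebra.norm_coeff a).le) hM a x
  have hfin (b : L1Algebra G X) (S : Finset G) (hb : ∀ s ∉ S, b s = 0) : ‖b 1‖ ≤ M b := by
    refine norm_le_of _ (M.nonneg b) ?_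
    have hd := dense_setOf_smul_ne h (S.erase 1) (by simp)
    refine fun x => closure_minimal (s := {x : X | ∀ s ∈ S.erase 1, s • x ≠ x})
      (t := {x | ‖b 1 x‖ ≤ M b}) (fun x hx => ?_)
      (isClosed_le (by fun_prop) continuous_const) (hd x)
    obtain ⟨V, hV, hdisj⟩ := exists_nhds_smul_disjoint _ hx
    obtain ⟨f, hfx, hf0, hf⟩ := exists_bump hV
    -- The coefficient of the left side at `r ≠ 1` has the factor `f y * f (r⁻¹ • y)`, which
    -- vanishes by the choice of `V` when `r ∈ S`; for `r ∉ S` already `b r = 0`.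
    have he : L1Algebra.coeff f * b * L1Algebra.coeff f = L1Algebra.coeff (f * b 1 * f) := by
      refine L1Algebra.ext fun r => ?_
      rw [L1Algebra.mul_coeff_apply, L1Algebra.coeff_mul_apply]
      by_cases hr : r = 1
      · subst hr; rw [L1Algebra.coeff_apply_one, act_one]
      rw [L1Algebra.coeff_apply_ne _ hr]
      by_cases hrS : r ∈ S
      · ext y
        change f y * b r y * f (r⁻¹ • y) = 0
        by_cases hy : y ∈ V
        · rw [hf0 _ (hdisj r (Finset.mem_erase.2 ⟨hr, hrS⟩) y hy), mul_zero]
        · rw [hf0 y hy]; simp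
      · rw [hb r hrS]; simp
    have hMf : M (L1Algebra.coeff f) ≤ 1 :=
      (M.le_norm _).trans ((L1Algebra.norm_coeff f).le.trans hf)
    calc ‖b 1 x‖ = ‖(f * b 1 * f) x‖ := by
          change _ = ‖f x * b 1 x * f x‖
          rw [hfx]; simp
      _ ≤ M (L1Algebra.coeff f * b * L1Algebra.coeff f) := by rw [he]; exact hK _ _
      _ ≤ M (L1Algebra.coeff f) * M b * M (L1Algebra.coeff f) :=
          (M.mul_le _ _).trans (mul_le_mul_of_nonneg_right (M.mul_le _ _) (M.nonneg _))
      _ ≤ 1 * M b * 1 := mul_le_mul (mul_le_mul_of_nonneg_right hMf (M.nonneg _)) hMf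
          (M.nonneg _) (by have := M.nonneg b; positivity)
      _ = M b := by ring
  -- Finite truncations converge in the ℓ¹-norm, and both sides of the estimate are continuous for
  -- it.
  have hlim : Filter.Tendsto (fun S : Finset G => ∑ s ∈ S, L1Algebra.single s (b s))
      Filter.atTop (𝓝 b) := b.hasSum_single
  refine le_of_tendsto_of_tendsto' ((L1Algebra.continuous_eval 1).norm.tendsto b |>.comp hlim)
    ((M.continuous.tendsto b).comp hlim) fun S => hfin _ S fun s hs => ?_
  rw [← L1Algebra.evalLinear_apply, map_sum]
  refine Finset.sum_eq_zero fun t ht => ?_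
  exact L1Algebra.single_apply_ne (by rintro rfl; exact hs ht) _

/-- Right multiplication by `f δ_{t⁻¹}` moves the coefficient at `t` to the identity, up to the
factor `α_t(f)`, which is one at `x`. Since `‖f‖ ≤ 1`, this does not increase `M`. -/
theorem TopologicallyFree.norm_apply_le (h : TopologicallyFree G X)
    (M : AlgSeminorm (L1Algebra G X))
    (hM : ∀ a : C₀(X, ℂ), M (L1Algebra.coeff a) = 0 → a = 0) (b : L1Algebra G X) (t : G) :
    ‖b t‖ ≤ M b := by
  refine norm_le_of _ (M.nonneg b) fun x => ?_
  obtain ⟨f, hfx, -, hf⟩ := exists_bump (x := t⁻¹ • x) Filter.univ_mem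
  have h1 := h.norm_apply_one_le M hM (b * L1Algebra.single t⁻¹ f)
  rw [L1Algebra.mul_single_apply, inv_inv, one_mul] at h1
  have h2 : ‖b t x‖ = ‖(b t * act t f) x‖ := by
    change _ = ‖b t x * f (t⁻¹ • x)‖
    rw [hfx, mul_one]
  rw [h2]
  refine (BanachCrossedProduct.norm_apply_le _ _).trans (h1.trans ((M.mul_le _ _).trans ?_))
  exact mul_le_of_le_one_right (M.nonneg b)
    ((M.le_norm _).trans ((L1Algebra.norm_single _ _).le.trans hf))

end Free

/-! ### Point masses in ℓ^p and c₀, and extensions of representations to completions -/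

namespace EllSpace

variable {p : Exponent} {I : Type w}

open Classical in
/-- The family with the value one at `i` and zero elsewhere. -/
noncomputable def point (p : Exponent) (i : I) : EllSpace p I :=
  mk (fun j => if j = i then 1 else 0) (by
    convert lp.memℓp (lp.single (E := fun _ : I => ℂ) p.1 i 1) using 2 with j
    simp [lp.single_apply, Pi.single_apply])
    (tendsto_const_nhds.congr' <| by
      filter_upwards [(Set.finite_singleton i).compl_mem_cofinite] with j hj
      exact (if_neg hj).symm)

theorem point_val_self (i : I) : (point p i).val i = 1 := if_pos rfl

theorem point_val_ne {i j : I} (h : j ≠ i) : (point p i).val j = 0 := if_neg h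

theorem norm_point_le (i : I) : ‖point p i‖ ≤ 1 := by
  classical
  have h := lp.norm_single (E := fun _ : I => ℂ) (p := p.1) (zero_lt_one.trans_le p.2) i 1
  have h2 : (point p i : lp (fun _ : I => ℂ) p.1) = lp.single p.1 i (1 : ℂ) := by
    refine lp.ext (funext fun j => ?_)
    rw [lp.single_apply, Pi.single_apply]
    rfl
  rw [← h2, norm_one] at h
  exact h.le

/-- The evaluation of a family at an index. -/
noncomputable def evalCLM (p : Exponent) (i : I) : EllSpace p I →L[ℂ] ℂ :=
  LinearMap.mkContinuous ⟨⟨fun ξ => ξ.val i, fun _ _ => rfl⟩, fun _ _ => rfl⟩ 1 fun ξ => by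
    rw [one_mul]; exact ξ.norm_val_le i

@[simp] theorem evalCLM_apply (i : I) (ξ : EllSpace p I) : evalCLM p i ξ = ξ.val i := rfl

theorem cut_eq_sum (S : Finset I) (ξ : EllSpace p I) :
    cut S ξ = ∑ i ∈ S, ξ.val i • point p i := by
  classical
  refine ext fun j => ?_
  rw [cut_val, ← evalCLM_apply j (∑ i ∈ S, _), map_sum]
  simp only [map_smul, evalCLM_apply, smul_eq_mul]
  split_ifs with hj
  · rw [Finset.sum_eq_single_of_mem j hj fun i _ hi => by rw [point_val_ne hi.symm, mul_zero],
      point_val_self, mul_one]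
  · refine (Finset.sum_eq_zero fun i hi => ?_).symm
    rw [point_val_ne (by rintro rfl; exact hj hi), mul_zero]

/-- Finite combinations of point masses are dense, for `p = ∞` as well because the space is then c₀
and not ℓ^∞. -/
theorem clm_ext_zero {E : Type w'} [NormedAddCommGroup E] [NormedSpace ℂ E]
    {T : EllSpace p I →L[ℂ] E} (h : ∀ i, T (point p i) = 0) : T = 0 := by
  refine ContinuousLinearMap.ext fun ξ => ?_
  refine closure_minimal (s := {ξ | T ξ = 0}) (t := {ξ | T ξ = 0}) subset_rfl
    (isClosed_eq T.continuous continuous_const) (Metric.mem_closure_iff.2 fun ε hε => ?_)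
  obtain ⟨S, hS⟩ := exists_cut_near ξ (half_pos hε)
  refine ⟨cut S ξ, ?_, ?_⟩
  · change T (cut S ξ) = 0
    simp [cut_eq_sum, h]
  · rw [dist_comm, dist_eq_norm]; linarith

end EllSpace

namespace HausdorffCompletion

variable {B : Type u} {E : Type w} [NonUnitalNormedRing B] [NormedSpace ℂ B]
  [NormedAddCommGroup E] [NormedSpace ℂ E] [CompleteSpace E] {N : AlgSeminorm B}

/-- The extension of a representation to a Hausdorff completion. -/
noncomputable def extendRep (ψ : BanachRep B E) (h : ∀ b, ‖ψ b‖ ≤ N b) :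
    HausdorffCompletion N →ₙₐ[ℂ] (E →L[ℂ] E) := extend ψ.toHom h

theorem extendRep_of (ψ : BanachRep B E) (h : ∀ b, ‖ψ b‖ ≤ N b) (b : B) :
    extendRep ψ h (of b) = ψ b := extend_of _ _ b

theorem continuous_extendRep_apply (ψ : BanachRep B E) (h : ∀ b, ‖ψ b‖ ≤ N b) (ξ : E) :
    Continuous fun z => extendRep ψ h z ξ :=
  (ContinuousLinearMap.apply ℂ E ξ).continuous.comp (continuous_extend _ _)

/-- The extension is contractive and kills `y`. The bound does not depend on `ψ`, so it survives a
supremum over a family of representations. -/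
theorem norm_le_of_extendRep_eq_zero (ψ : BanachRep B E) (h : ∀ b, ‖ψ b‖ ≤ N b)
    {y : HausdorffCompletion N} (hy : extendRep ψ h y = 0) (b : B) : ‖ψ b‖ ≤ ‖y - of b‖ := by
  have h1 : ‖extendRep ψ h (y - of b)‖ ≤ ‖y - of b‖ := norm_extend_le _ _ _
  rwa [map_sub, hy, zero_sub, norm_neg, extendRep_of] at h1

end HausdorffCompletion

theorem continuous_apply_point {X : Type v} [TopologicalSpace X] (x : X) :
    Continuous fun a : C₀(X, ℂ) => a x :=
  AddMonoidHomClass.continuous_of_bound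
    (⟨⟨fun a => a x, rfl⟩, fun _ _ => rfl⟩ : C₀(X, ℂ) →+ ℂ) 1
    fun a => by rw [one_mul]; exact norm_apply_le a x

/-! ### Coefficients of elements of the reduced crossed product -/

section Reduced

variable {G : Type u} {X : Type v} [Group G] [TopologicalSpace X] [MulAction G X]
  [ContinuousConstSMul G X]

open Classical in
-- The coordinate in `G` separates the group elements: only `s = r * t⁻¹` carries `t` to `r`. Every
-- matrix entry of `Λ_p(b)` is therefore zero or a single value of a single coefficient.
theorem regularRep_point_val (p : Exponent) (b : L1Algebra G X) (x y : X) (t r : G) :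
    (regularRep G X p b (EllSpace.point p (x, t))).val (y, r) =
      if (r * t⁻¹) • x = y then b (r * t⁻¹) y else 0 := by
  rw [regularRep_apply, tsum_eq_single (r * t⁻¹)]
  · rw [mul_inv_rev, inv_inv, inv_mul_cancel_right]
    split_ifs with h
    · rw [← h]
      simp only [← mul_smul, mul_assoc, inv_mul_cancel_left, mul_inv_cancel, one_smul]
      rw [EllSpace.point_val_self, mul_one]
    · rw [EllSpace.point_val_ne, mul_zero]
      intro h'
      have h1 : (t * r⁻¹) • y = x := (Prod.ext_iff.1 h').1
      refine h ?_
      rw [← h1, smul_smul]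
      simp
  · intro s hs
    rw [EllSpace.point_val_ne, mul_zero]
    intro h'
    refine hs ?_
    have h1 : s⁻¹ * r = t := (Prod.ext_iff.1 h').2
    rw [← h1]
    simp

theorem norm_apply_le_norm_regularRep (p : Exponent) (b : L1Algebra G X) (t : G) :
    ‖b t‖ ≤ ‖regularRep G X p b‖ := by
  classical
  refine norm_le_of _ ((regularRep G X p).seminorm.nonneg b) fun x => ?_
  have h := regularRep_point_val p b (t⁻¹ • x) x 1 t
  rw [inv_one, mul_one, smul_inv_smul, if_pos rfl] at h
  rw [← h]
  refine (EllSpace.norm_val_le _ _).trans (((regularRep G X p b).le_opNorm _).trans ?_)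
  exact mul_le_of_le_one_right ((regularRep G X p).seminorm.nonneg b) (EllSpace.norm_point_le _)

theorem norm_regularRep_le_reducedNormP {P : Set Exponent} {p : Exponent} (hp : p ∈ P)
    (b : L1Algebra G X) : ‖regularRep G X p b‖ ≤ reducedNormP G X P b := by
  rw [reducedNormP, if_neg (Set.nonempty_iff_ne_empty.1 ⟨p, hp⟩)]
  exact AlgSeminorm.le_sup (Set.mem_image_of_mem (fun p => (regularRep G X p).seminorm) hp) b

theorem norm_apply_le_reducedNormP (P : Set Exponent) (b : L1Algebra G X) (t : G) :
    ‖b t‖ ≤ reducedNormP G X P b := by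
  rcases P.eq_empty_or_nonempty with hP | ⟨p, hp⟩
  · rw [reducedNormP, if_pos hP]
    exact L1Algebra.norm_apply_le b t
  · exact (norm_apply_le_norm_regularRep p b t).trans (norm_regularRep_le_reducedNormP hp b)

/-- The coefficient at `t` of an element of the reduced crossed product. -/
noncomputable def reducedCoeff (P : Set Exponent) (t : G) :
    ReducedCrossedProduct G X P →L[ℂ] C₀(X, ℂ) :=
  HausdorffCompletion.extendCLM (L1Algebra.evalLinear t) fun b =>
    norm_apply_le_reducedNormP P b t

theorem reducedCoeff_of (P : Set Exponent) (t : G) (b : L1Algebra G X) :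
    reducedCoeff P t (HausdorffCompletion.of b) = b t :=
  HausdorffCompletion.extendCLM_of _ _ b

/-- The extension of `Λ_p` to the reduced crossed product, for `p ∈ P`. -/
noncomputable def regularExtend {P : Set Exponent} {p : Exponent} (hp : p ∈ P) :
    ReducedCrossedProduct G X P →ₙₐ[ℂ] (EllSpace p (X × G) →L[ℂ] EllSpace p (X × G)) :=
  HausdorffCompletion.extendRep (regularRep G X p) (norm_regularRep_le_reducedNormP hp)

theorem regularExtend_of {P : Set Exponent} {p : Exponent} (hp : p ∈ P) (b : L1Algebra G X) :
    regularExtend hp (HausdorffCompletion.of b) = regularRep G X p b :=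
  HausdorffCompletion.extendRep_of (regularRep G X p) (norm_regularRep_le_reducedNormP hp) b

open Classical in
-- Both sides are continuous in `z` and agree on F(α). Hence the coefficients still determine all
-- matrix entries after completion.
theorem regularExtend_point_val {P : Set Exponent} {p : Exponent} (hp : p ∈ P)
    (z : ReducedCrossedProduct G X P) (x y : X) (t r : G) :
    (regularExtend hp z (EllSpace.point p (x, t))).val (y, r) =
      if (r * t⁻¹) • x = y then reducedCoeff P (r * t⁻¹) z y else 0 := by
  induction z using HausdorffCompletion.induction with
  | hp =>
    refine isClosed_eq ((EllSpace.evalCLM p (y, r)).continuous.comp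
      (HausdorffCompletion.continuous_extendRep_apply (regularRep G X p)
        (norm_regularRep_le_reducedNormP hp) _)) ?_
    split_ifs
    · exact (continuous_apply_point y).comp (reducedCoeff P (r * t⁻¹)).continuous
    · exact continuous_const
  | h b => rw [regularExtend_of, regularRep_point_val, reducedCoeff_of]

theorem regularExtend_eq_zero {P : Set Exponent} {p : Exponent} (hp : p ∈ P)
    {y : ReducedCrossedProduct G X P} (hy : ∀ t, reducedCoeff P t y = 0) :
    regularExtend hp y = 0 := by
  classical
  refine EllSpace.clm_ext_zero fun i => EllSpace.ext fun j => ?_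
  rw [regularExtend_point_val hp y i.1 j.1 i.2 j.2, hy]
  simp

theorem reducedNormP_le_of_forall {P : Set Exponent} (hP : P.Nonempty) {b : L1Algebra G X} {C : ℝ}
    (hC : 0 ≤ C) (h : ∀ p ∈ P, ‖regularRep G X p b‖ ≤ C) : reducedNormP G X P b ≤ C := by
  rw [reducedNormP, if_neg hP.ne_empty]
  refine AlgSeminorm.sup_le hC ?_
  rintro _ ⟨p, hp, rfl⟩
  exact h p hp

theorem reducedNormP_empty (b : L1Algebra G X) : reducedNormP G X ∅ b = ‖b‖ := by
  rw [reducedNormP, if_pos rfl]; rfl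

/-- The isomorphism of the reduced crossed product for `P = ∅` with `F(α)`. -/
noncomputable def reducedEmpty : ReducedCrossedProduct G X ∅ →ₙₐ[ℂ] L1Algebra G X :=
  HausdorffCompletion.extend (NonUnitalAlgHom.id ℂ (L1Algebra G X)) fun b =>
    (reducedNormP_empty b).ge

theorem reducedEmpty_of (b : L1Algebra G X) : reducedEmpty (HausdorffCompletion.of b) = b :=
  HausdorffCompletion.extend_of _ _ b

theorem continuous_reducedEmpty :
    Continuous (reducedEmpty : ReducedCrossedProduct G X ∅ → L1Algebra G X) :=
  HausdorffCompletion.continuous_extend _ _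

theorem norm_reducedEmpty (z : ReducedCrossedProduct G X ∅) : ‖reducedEmpty z‖ = ‖z‖ := by
  induction z using HausdorffCompletion.induction with
  | hp => exact isClosed_eq continuous_reducedEmpty.norm continuous_norm
  | h b => rw [reducedEmpty_of, HausdorffCompletion.norm_of, reducedNormP_empty]

theorem reducedEmpty_apply (z : ReducedCrossedProduct G X ∅) (t : G) :
    reducedEmpty z t = reducedCoeff ∅ t z := by
  induction z using HausdorffCompletion.induction with
  | hp =>
    exact isClosed_eq ((L1Algebra.continuous_eval (X := X) t).comp continuous_reducedEmpty)
      (reducedCoeff ∅ t).continuous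
  | h b => rw [reducedEmpty_of, reducedCoeff_of]

/-- An element of the reduced crossed product is determined by its coefficients. -/
theorem eq_zero_of_reducedCoeff_eq_zero (P : Set Exponent) (y : ReducedCrossedProduct G X P)
    (hy : ∀ t, reducedCoeff P t y = 0) : y = 0 := by
  rcases P.eq_empty_or_nonempty with rfl | hP
  · rw [← norm_eq_zero, ← norm_reducedEmpty, norm_eq_zero]
    exact L1Algebra.ext fun t => (reducedEmpty_apply y t).trans (hy t)
  · rw [← norm_eq_zero]
    refine le_antisymm (le_of_forall_pos_le_add fun ε hε => ?_) (norm_nonneg _)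
    obtain ⟨b, hb⟩ := HausdorffCompletion.denseRange_of.exists_dist_lt y (half_pos hε)
    rw [dist_eq_norm] at hb
    -- Every `Λ_p` with `p ∈ P` kills `y`, so each `‖Λ_p(b)‖` is at most the distance from `y` to
    -- `b`; the supremum over `p` is the reduced norm of `b`.
    have h1 : ‖(HausdorffCompletion.of b : ReducedCrossedProduct G X P)‖ ≤
        ‖y - HausdorffCompletion.of b‖ := by
      rw [HausdorffCompletion.norm_of]
      refine reducedNormP_le_of_forall hP (norm_nonneg _) fun p hp => ?_
      exact HausdorffCompletion.norm_le_of_extendRep_eq_zero (regularRep G X p)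
        (norm_regularRep_le_reducedNormP hp) (regularExtend_eq_zero hp hy) b
    have h2 := norm_le_norm_sub_add y (HausdorffCompletion.of b)
    linarith

end Reduced

/-! ### Quotient seminorms of closed ideals -/

section Quotient

variable {B : Type u} [NonUnitalNormedRing B] [NormedSpace ℂ B]

theorem IsClosedIdeal.mul_sub_mul_mem {I : Submodule ℂ B} (hI : IsClosedIdeal I) {a a' b b' : B}
    (ha : a - a' ∈ I) (hb : b - b' ∈ I) : a * b - a' * b' ∈ I := by
  have h : a * b - a' * b' = (a - a') * b + a' * (b - b') := by
    rw [sub_mul, mul_sub]; abel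
  rw [h]
  exact I.add_mem (hI.mul_mem_right _ ha) (hI.mul_mem_left _ hb)

/-- The seminorm on a Banach algebra given by the norm of the quotient by a closed ideal. -/
noncomputable def quotientSeminorm (I : Submodule ℂ B) (hI : IsClosedIdeal I) :
    AlgSeminorm B where
  toSeminorm := (normSeminorm ℂ (B ⧸ I)).comp I.mkQ
  mul_le' a b := by
    change ‖I.mkQ (a * b)‖ ≤ ‖I.mkQ a‖ * ‖I.mkQ b‖
    -- The quotient norm is an infimum that need not be attained, so representatives are chosen up
    -- to `ε`.
    have h (ε : ℝ) (hε : 0 < ε) : ‖I.mkQ (a * b)‖ ≤ (‖I.mkQ a‖ + ε) * (‖I.mkQ b‖ + ε) := by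
      obtain ⟨a', ha', hna⟩ := Submodule.Quotient.norm_mk_lt (I.mkQ a) hε
      obtain ⟨b', hb', hnb⟩ := Submodule.Quotient.norm_mk_lt (I.mkQ b) hε
      have h1 : I.mkQ (a * b) = I.mkQ (a' * b') :=
        (Submodule.Quotient.eq I).2 (hI.mul_sub_mul_mem ((Submodule.Quotient.eq I).1 ha'.symm)
          ((Submodule.Quotient.eq I).1 hb'.symm))
      rw [h1]
      exact (Submodule.Quotient.norm_mk_le I _).trans ((norm_mul_le _ _).trans
        (mul_le_mul hna.le hnb.le (norm_nonneg _) (by positivity)))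
    have hlim : Filter.Tendsto (fun ε : ℝ => (‖I.mkQ a‖ + ε) * (‖I.mkQ b‖ + ε)) (𝓝[>] 0)
        (𝓝 (‖I.mkQ a‖ * ‖I.mkQ b‖)) := by
      have : Continuous fun ε : ℝ => (‖I.mkQ a‖ + ε) * (‖I.mkQ b‖ + ε) := by fun_prop
      simpa using (this.tendsto 0).mono_left nhdsWithin_le_nhds
    exact ge_of_tendsto hlim (by filter_upwards [self_mem_nhdsWithin] with ε hε using h ε hε)
  le_norm' a := Submodule.Quotient.norm_mk_le I a

theorem quotientSeminorm_eq_zero {I : Submodule ℂ B} {hI : IsClosedIdeal I} {a : B} :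
    quotientSeminorm I hI a = 0 ↔ a ∈ I := by
  change ‖(Submodule.Quotient.mk a : B ⧸ I)‖ = 0 ↔ a ∈ I
  have := hI.isClosed
  rw [norm_eq_zero, Submodule.Quotient.mk_eq_zero]

theorem isClosedIdeal_kernel {A : Type w} [NonUnitalNormedRing A] [NormedSpace ℂ A]
    (f : B →ₙₐ[ℂ] A) (hf : Continuous f) : IsClosedIdeal (kernel f) where
  isClosed := isClosed_eq hf continuous_const
  mul_mem_left b x hx := by
    change f (b * x) = 0
    rw [map_mul, show f x = 0 from hx, mul_zero]
  mul_mem_right b x hx := by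
    change f (x * b) = 0
    rw [map_mul, show f x = 0 from hx, zero_mul]

end Quotient

/-! ### The implications between freeness, hidden ideals and detection of ideals -/

section Implications

variable {G : Type u} {X : Type v} [Group G] [TopologicalSpace X]
  [MulAction G X] [ContinuousConstSMul G X]

/-- An ideal meets `C₀(X)` trivially as soon as its only member of the form `a δ_1` is zero. -/
theorem inter_coefficients_eq {P : Set Exponent} (I : Submodule ℂ (FullCrossedProduct G X P))
    (h : ∀ a : C₀(X, ℂ), (HausdorffCompletion.of (L1Algebra.coeff a) :
      FullCrossedProduct G X P) ∈ I → a = 0) :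
    (I : Set (FullCrossedProduct G X P)) ∩ coefficients G X P = {0} := by
  refine Set.eq_singleton_iff_unique_mem.2 ⟨⟨I.zero_mem, zero_mem _⟩, ?_⟩
  rintro _ ⟨hc, a, rfl⟩
  have h0 := h a hc
  subst h0
  exact map_zero ((HausdorffCompletion.ofHom (fullNormP G X P)).comp L1Algebra.coeff)

theorem trivialRep_coeff_val (p : Exponent) (a : C₀(X, ℂ)) (ξ : EllSpace p X) (x : X) :
    (trivialRep G X p (L1Algebra.coeff a) ξ).val x = a x * ξ.val x := by
  rw [trivialRep_apply, tsum_eq_single 1]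
  · rw [L1Algebra.coeff_apply_one, inv_one, one_smul]
  · intro s hs
    rw [L1Algebra.coeff_apply_ne a hs]
    simp

variable [T2Space X] [LocallyCompactSpace X]

theorem regularHom_of (P : Set Exponent) (b : L1Algebra G X) :
    regularHom G X P (HausdorffCompletion.of b) = HausdorffCompletion.of b :=
  HausdorffCompletion.extend_of _ _ b

theorem continuous_regularHom (P : Set Exponent) : Continuous (regularHom G X P) :=
  HausdorffCompletion.continuous_extend _ _

theorem trivialHom_of (P : Set Exponent) (b : L1Algebra G X) :
    trivialHom G X P (HausdorffCompletion.of b) = trivialSum G X P b :=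
  HausdorffCompletion.extend_of _ _ b

theorem continuous_trivialHom (P : Set Exponent) : Continuous (trivialHom G X P) :=
  HausdorffCompletion.continuous_extend _ _

/-- The full norm dominates the reduced norm, which dominates the coefficient at the identity; so
C₀(X) embeds in the completion. -/
theorem eq_zero_of_of_coeff_eq_zero {P : Set Exponent} {a : C₀(X, ℂ)}
    (h : (HausdorffCompletion.of (L1Algebra.coeff a) : FullCrossedProduct G X P) = 0) :
    a = 0 := by
  have h1 := norm_apply_le_reducedNormP P (L1Algebra.coeff a : L1Algebra G X) 1
  have h2 := reducedNormP_le P (L1Algebra.coeff a : L1Algebra G X)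
  rw [← HausdorffCompletion.norm_of (N := fullNormP G X P), h, norm_zero] at h2
  rw [L1Algebra.coeff_apply_one] at h1
  exact norm_le_zero_iff.1 (h1.trans h2)

theorem kernel_regularHom_inter (P : Set Exponent) :
    (kernel (regularHom G X P) : Set (FullCrossedProduct G X P)) ∩ coefficients G X P = {0} := by
  refine inter_coefficients_eq _ fun a ha => ?_
  have h0 : regularHom G X P (HausdorffCompletion.of (L1Algebra.coeff a)) = 0 := ha
  rw [regularHom_of] at h0
  have h1 := norm_apply_le_reducedNormP P (L1Algebra.coeff a : L1Algebra G X) 1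
  rw [← HausdorffCompletion.norm_of (N := reducedNormP G X P), h0, norm_zero,
    L1Algebra.coeff_apply_one] at h1
  exact norm_le_zero_iff.1 h1

/-- The distance to `I` restricts to an algebra seminorm `M` on F(α), faithful on C₀(X) because `I`
meets C₀(X) trivially. It dominates all coefficients, so these vanish on `I`. -/
theorem TopologicallyFree.le_kernel_regularHom (h : TopologicallyFree G X) (P : Set Exponent)
    {I : Submodule ℂ (FullCrossedProduct G X P)} (hI : IsClosedIdeal I)
    (hIA : (I : Set (FullCrossedProduct G X P)) ∩ coefficients G X P = {0}) :
    I ≤ kernel (regularHom G X P) := by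
  let M : AlgSeminorm (L1Algebra G X) := (quotientSeminorm I hI).comap
    ((HausdorffCompletion.ofHom (fullNormP G X P))) fun b =>
      (HausdorffCompletion.norm_of b).le.trans ((fullNormP G X P).le_norm b)
  have hM (a : C₀(X, ℂ)) (ha : M (L1Algebra.coeff a) = 0) : a = 0 := by
    refine eq_zero_of_of_coeff_eq_zero (G := G) (P := P) ?_
    have h1 : (HausdorffCompletion.of (L1Algebra.coeff a) : FullCrossedProduct G X P) ∈
        (I : Set (FullCrossedProduct G X P)) ∩ coefficients G X P :=
      ⟨(quotientSeminorm_eq_zero (hI := hI)).1 ha, a, rfl⟩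
    rwa [hIA] at h1
  -- Elements of `I` need not come from F(α), so the coefficient bound is first carried to the
  -- completion by density.
  have key (c : FullCrossedProduct G X P) (t : G) :
      ‖reducedCoeff P t (regularHom G X P c)‖ ≤ quotientSeminorm I hI c := by
    induction c using HausdorffCompletion.induction with
    | hp =>
      exact isClosed_le ((reducedCoeff P t).continuous.comp (continuous_regularHom P)).norm
        (quotientSeminorm I hI).continuous
    | h b =>
      rw [regularHom_of, reducedCoeff_of]
      exact h.norm_apply_le M hM b t
  intro c hc
  refine eq_zero_of_reducedCoeff_eq_zero P _ fun t => ?_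
  have h1 := key c t
  rw [quotientSeminorm_eq_zero.2 hc] at h1
  exact norm_le_zero_iff.1 h1

theorem TopologicallyFree.hasHiddenIdeal (h : TopologicallyFree G X) (P : Set Exponent) :
    HasHiddenIdeal (coefficients G X P) (kernel (regularHom G X P)) :=
  ⟨⟨isClosedIdeal_kernel _ (continuous_regularHom P), kernel_regularHom_inter P⟩,
    fun _ hI => h.le_kernel_regularHom P hI.1 hI.2⟩

theorem trivialExponents_nonempty (P : Set Exponent) : Nonempty (trivialExponents P) := by
  rcases P.eq_empty_or_nonempty with hP | ⟨p, hp⟩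
  · exact ⟨⟨⟨1, le_rfl⟩, Or.inl hP⟩⟩
  · exact ⟨⟨p, Or.inr hp⟩⟩

theorem isClosedIdeal_kernel_trivialHom (P : Set Exponent) :
    IsClosedIdeal (kernel (trivialHom G X P)) where
  isClosed := isClosed_eq (continuous_trivialHom P) continuous_const
  mul_mem_left b x hx := by
    change trivialHom G X P (b * x) = 0
    rw [map_mul, show trivialHom G X P x = 0 from hx, mul_zero]
  mul_mem_right b x hx := by
    change trivialHom G X P (x * b) = 0
    rw [map_mul, show trivialHom G X P x = 0 from hx, zero_mul]

/-- C₀(X) acts by multiplication on each summand, so applying `a δ_1` to the point mass at `x` in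
one summand reads off `a x`. A summand exists also for `P = ∅`, where all exponents are used. -/
theorem kernel_trivialHom_inter (P : Set Exponent) :
    (kernel (trivialHom G X P) : Set (FullCrossedProduct G X P)) ∩ coefficients G X P = {0} := by
  classical
  refine inter_coefficients_eq _ fun a ha => ?_
  have h0 : trivialHom G X P (HausdorffCompletion.of (L1Algebra.coeff a)) = 0 := ha
  rw [trivialHom_of] at h0
  obtain ⟨p⟩ := trivialExponents_nonempty P
  ext x
  let ξ : lp (fun p : trivialExponents P => EllSpace p.1 X) ∞ :=
    lp.single ∞ p (EllSpace.point p.1 x)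
  have hξ : (ξ : ∀ p : trivialExponents P, EllSpace p.1 X) p = EllSpace.point p.1 x :=
    lp.single_apply_self _ _ _
  have h1 : (trivialSum G X P (L1Algebra.coeff a) ξ :
      ∀ p : trivialExponents P, EllSpace p.1 X) p = 0 := by rw [h0]; rfl
  have h2 : trivialRep G X p.1 (L1Algebra.coeff a) (EllSpace.point p.1 x) = 0 := by
    rw [← hξ]; exact h1
  have h3 := trivialRep_coeff_val (G := G) p.1 a (EllSpace.point p.1 x) x
  rw [h2, EllSpace.point_val_self, mul_one] at h3
  exact h3.symm

/-- If the kernel of the trivial representation lies in that of the regular representation,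
then the action is topologically free. -/
theorem topologicallyFree_of_kernel_le {P : Set Exponent}
    (h : kernel (trivialHom G X P) ≤ kernel (regularHom G X P)) : TopologicallyFree G X := by
  intro t ht
  by_contra hne
  obtain ⟨x, hx⟩ := Set.nonempty_iff_ne_empty.2 hne
  obtain ⟨f, hfx, hf0, -⟩ := exists_bump (isOpen_interior.mem_nhds hx)
  -- `f` vanishes off the interior of the fixed points of `t`. Where `f` is non-zero, translation by
  -- `t⁻¹` does nothing, so `f δ_1` and `f δ_t` agree in every trivial representation.
  let b : L1Algebra G X := L1Algebra.coeff f - L1Algebra.single t f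
  have hfix (y : X) (hy : f y ≠ 0) : t⁻¹ • y = y := by
    have h1 : y ∈ interior {x : X | t • x = x} := by
      by_contra h2
      exact hy (hf0 y h2)
    have h2 : t • y = y := interior_subset (s := {x : X | t • x = x}) h1
    rw [inv_smul_eq_iff, h2]
  have hb (p : Exponent) : trivialRep G X p b = 0 := by
    refine ContinuousLinearMap.ext fun ξ => EllSpace.ext fun y => ?_
    have hs : trivialRep G X p (L1Algebra.single t f) ξ =
        trivialRep G X p (L1Algebra.coeff f) ξ := by
      refine EllSpace.ext fun y => ?_
      rw [trivialRep_coeff_val, trivialRep_apply, tsum_eq_single t]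
      · rw [L1Algebra.single_apply_self]
        by_cases hy : f y = 0
        · rw [hy, zero_mul, zero_mul]
        · rw [hfix y hy]
      · intro s hs
        rw [L1Algebra.single_apply_ne hs]
        simp
    change ((trivialRep G X p).toHom (L1Algebra.coeff f - L1Algebra.single t f) ξ).val y = 0
    rw [map_sub, sub_apply, hs, sub_self]
    rfl
  have hmem : (HausdorffCompletion.of b : FullCrossedProduct G X P) ∈
      kernel (trivialHom G X P) := by
    change trivialHom G X P (HausdorffCompletion.of b) = 0
    rw [trivialHom_of]
    refine ContinuousLinearMap.ext fun ξ => lp.ext (funext fun p => ?_)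
    change trivialRep G X p.1 b _ = 0
    rw [hb]; rfl
  have h0 : regularHom G X P (HausdorffCompletion.of b) = 0 := h hmem
  rw [regularHom_of] at h0
  have h1 := reducedCoeff_of P 1 b
  rw [h0, map_zero] at h1
  have h2 : b 1 = f := by
    change L1Algebra.evalLinear 1 (L1Algebra.coeff f - L1Algebra.single t f) = f
    rw [map_sub, L1Algebra.evalLinear_apply, L1Algebra.evalLinear_apply,
      L1Algebra.coeff_apply_one, L1Algebra.single_apply_ne ht.symm, sub_zero]
  rw [h2] at h1
  rw [← h1] at hfx
  simp at hfx

/-- Maximality of the hidden ideal, tested on the kernel of the trivial representation. -/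
theorem kernel_le_of_hasHiddenIdeal {P : Set Exponent}
    (h : HasHiddenIdeal (coefficients G X P) (kernel (regularHom G X P))) :
    kernel (trivialHom G X P) ≤ kernel (regularHom G X P) :=
  h.2 ⟨isClosedIdeal_kernel_trivialHom P, kernel_trivialHom_inter P⟩

/-- Detection forces the kernel of the trivial representation to be zero, so it lies in the kernel
of the regular one. This argument works for every `T`. -/
theorem topologicallyFree_of_detectsIdeals {T : Set Exponent}
    (h : DetectsIdeals (coefficients G X T)) : TopologicallyFree G X := by
  refine topologicallyFree_of_kernel_le (P := T) ?_
  by_cases h0 : kernel (trivialHom G X T) = ⊥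
  · rw [h0]; exact bot_le
  · exact absurd (kernel_trivialHom_inter T) (h _ (isClosedIdeal_kernel_trivialHom T) h0)

/-- Under `hT` the regular representation does not decrease norms, so the hidden ideal is zero. -/
theorem TopologicallyFree.detectsIdeals (h : TopologicallyFree G X) {T : Set Exponent}
    (hT : ∀ b, fullNormP G X T b ≤ reducedNormP G X T b) :
    DetectsIdeals (coefficients G X T) := by
  intro I hI hne hIA
  refine hne (eq_bot_iff.2 ((h.le_kernel_regularHom T hI hIA).trans fun c hc => ?_))
  have hnorm : ‖c‖ ≤ ‖regularHom G X T c‖ := by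
    clear hc
    induction c using HausdorffCompletion.induction with
    | hp => exact isClosed_le continuous_norm (continuous_regularHom T).norm
    | h b =>
      rw [regularHom_of, HausdorffCompletion.norm_of, HausdorffCompletion.norm_of]
      exact hT b
  rw [show regularHom G X T c = 0 from hc, norm_zero] at hnorm
  exact norm_le_zero_iff.1 hnorm

end Implications

/-! ### The approximate unit of C₀(X) -/

section ApproximateUnit

variable (X : Type v) [TopologicalSpace X]

/-- The filter on `C₀(X)` generated by the sets of real contractions that are one on a given
compact set. -/
def unitFilter : Filter C₀(X, ℂ) :=
  ⨅ K : {K : Set X // IsCompact K},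
    Filter.principal {e | (∀ x ∈ K.1, e x = 1) ∧ ‖e‖ ≤ 1 ∧ ∀ x, (e x).im = 0}

instance [T2Space X] [LocallyCompactSpace X] : (unitFilter X).NeBot := by
  have : Nonempty {K : Set X // IsCompact K} := ⟨⟨∅, isCompact_empty⟩⟩
  refine Filter.iInf_neBot_of_directed' ?_ fun K => ?_
  · intro K L
    refine ⟨⟨K.1 ∪ L.1, K.2.union L.2⟩, ?_, ?_⟩
    · exact Filter.principal_mono.2 fun e he => ⟨fun x hx => he.1 x (Or.inl hx), he.2⟩
    · exact Filter.principal_mono.2 fun e he => ⟨fun x hx => he.1 x (Or.inr hx), he.2⟩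
  · obtain ⟨f, h1, -, h2, h3⟩ := exists_one_zero K.2 isOpen_univ (Set.subset_univ _)
    exact Filter.principal_neBot_iff.2 ⟨f, h1, h2, h3⟩

variable {X}

theorem eventually_unitFilter {K : Set X} (hK : IsCompact K) :
    ∀ᶠ e in unitFilter X, (∀ x ∈ K, e x = 1) ∧ ‖e‖ ≤ 1 ∧ ∀ x, (e x).im = 0 :=
  Filter.mem_iInf_of_mem ⟨K, hK⟩ (Filter.mem_principal_self _)

theorem eventually_norm_le_one : ∀ᶠ e in unitFilter X, ‖e‖ ≤ 1 :=
  (eventually_unitFilter isCompact_empty).mono fun _ h => h.2.1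

/-- Take `K` with `a` small outside it: on `K` the difference is zero, and off `K` it is at most `2
|a|` because `‖e‖ ≤ 1`. -/
theorem tendsto_mul_unitFilter (a : C₀(X, ℂ)) :
    Filter.Tendsto (fun e => e * a) (unitFilter X) (𝓝 a) := by
  refine Metric.tendsto_nhds.2 fun ε hε => ?_
  have h := Metric.tendsto_nhds.1 a.zero_at_infty' (ε / 4) (by positivity)
  obtain ⟨K, hK, hKa⟩ := Filter.mem_cocompact.1 h
  filter_upwards [eventually_unitFilter hK] with e he
  obtain ⟨h1, h2, -⟩ := he
  rw [dist_eq_norm]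
  refine (norm_le_of _ (by positivity) fun x => ?_).trans_lt (half_lt_self hε)
  change ‖e x * a x - a x‖ ≤ ε / 2
  by_cases hx : x ∈ K
  · rw [h1 x hx, one_mul, sub_self, norm_zero]; positivity
  · have h3 : ‖a x‖ < ε / 4 := by simpa [dist_zero_right] using! hKa hx
    have h4 : ‖e x * a x‖ ≤ ‖a x‖ := by
      rw [norm_mul]
      exact mul_le_of_le_one_left (norm_nonneg _) ((norm_apply_le e x).trans h2)
    linarith [norm_sub_le (e x * a x) (a x)]

end ApproximateUnit

/-- The vectors to which a net of contractions converges pointwise form a closed subspace. -/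
theorem isClosed_setOf_tendsto {ι : Type u} {E : Type v} [NormedAddCommGroup E]
    [NormedSpace ℂ E] {l : Filter ι} (T : ι → E →L[ℂ] E) (hT : ∀ᶠ i in l, ‖T i‖ ≤ 1) :
    IsClosed {ξ | Filter.Tendsto (fun i => T i ξ) l (𝓝 ξ)} := by
  refine isClosed_of_closure_subset fun ξ hξ => Metric.tendsto_nhds.2 fun ε hε => ?_
  obtain ⟨η, hη, hd⟩ := Metric.mem_closure_iff.1 hξ (ε / 3) (by positivity)
  filter_upwards [hT, Metric.tendsto_nhds.1 hη (ε / 3) (by positivity)] with i hi hi'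
  rw [dist_eq_norm] at hd hi' ⊢
  have h1 : ‖T i (ξ - η)‖ ≤ ‖ξ - η‖ := by simpa using (T i).le_of_opNorm_le hi (ξ - η)
  have h2 : T i ξ - ξ = T i (ξ - η) + (T i η - η) + -(ξ - η) := by rw [map_sub]; abel
  rw [h2]
  have h3 := norm_add_le (T i (ξ - η) + (T i η - η)) (-(ξ - η))
  have h4 := norm_add_le (T i (ξ - η)) (T i η - η)
  rw [norm_neg] at h3
  linarith

/-- The vectors to which a net of contractions converges pointwise. -/
def tendstoSubmodule {ι : Type u} {E : Type v} [NormedAddCommGroup E] [NormedSpace ℂ E]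
    (l : Filter ι) (T : ι → E →L[ℂ] E) : Submodule ℂ E where
  carrier := {ξ | Filter.Tendsto (fun i => T i ξ) l (𝓝 ξ)}
  zero_mem' := by simpa using! tendsto_const_nhds
  add_mem' {ξ η} hξ hη := by
    have h := Filter.Tendsto.add hξ hη
    exact h.congr fun i => ((T i).map_add ξ η).symm
  smul_mem' k ξ hξ := by
    have h := Filter.Tendsto.const_smul hξ k
    exact h.congr fun i => ((T i).map_smul k ξ).symm

namespace L1Algebra

variable {G : Type u} {X : Type v} [Group G] [TopologicalSpace X] [MulAction G X]
  [ContinuousConstSMul G X]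

theorem coeff_mul_single (s : G) (e a : C₀(X, ℂ)) :
    (coeff e * single s a : L1Algebra G X) = single s (e * a) := by
  rw [coeff_eq_single, single_mul_single, one_mul, act_one]

theorem continuous_single (s : G) : Continuous (single s : C₀(X, ℂ) → L1Algebra G X) := by
  classical
  exact AddMonoidHomClass.continuous_of_bound
    (lp.singleAddMonoidHom (E := fun _ : G => C₀(X, ℂ)) 1 s) 1
    fun a => by rw [one_mul]; exact (norm_single s a).le

/-- Left multiplication by `e δ_1` acts on each coefficient separately, which settles finite sums.
The vectors at which contractions converge form a closed subspace, which settles the rest. -/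
theorem tendsto_coeff_mul (b : L1Algebra G X) :
    Filter.Tendsto (fun e => coeff e * b) (unitFilter X) (𝓝 b) := by
  let T (e : C₀(X, ℂ)) : L1Algebra G X →L[ℂ] L1Algebra G X :=
    ContinuousLinearMap.mul ℂ (L1Algebra G X) (coeff e)
  have hT : ∀ᶠ e in unitFilter X, ‖T e‖ ≤ 1 := by
    filter_upwards [eventually_norm_le_one] with e he
    exact (ContinuousLinearMap.opNorm_mul_apply_le ℂ (L1Algebra G X) (coeff e)).trans
      ((norm_coeff e).le.trans he)
  have hc : IsClosed (tendstoSubmodule (unitFilter X) T : Set (L1Algebra G X)) :=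
    isClosed_setOf_tendsto T hT
  refine hc.mem_of_tendsto b.hasSum_single (Filter.Eventually.of_forall fun S => ?_)
  refine Submodule.sum_mem _ fun s _ => ?_
  change Filter.Tendsto (fun e => coeff e * single s (b s)) (unitFilter X) (𝓝 (single s (b s)))
  simp only [coeff_mul_single]
  exact ((continuous_single s).tendsto _).comp (tendsto_mul_unitFilter (b s))

end L1Algebra

/-! ### Hermitian operators and non-degenerate representations -/

/-- Hermitian operators on a normed space, in the sense of numerical ranges. -/
def IsHermitianOperator {E : Type w} [NormedAddCommGroup E] [NormedSpace ℂ E]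
    (T : E →L[ℂ] E) : Prop :=
  ∃ C : ℝ, ∀ (t : ℝ) (ξ : E), ‖ξ + ((t : ℂ) * Complex.I) • T ξ‖ ≤ (1 + C * t ^ 2) * ‖ξ‖

/-- A hermitian operator has real numerical range. -/
theorem IsHermitianOperator.im_eq_zero {E : Type w} [NormedAddCommGroup E] [NormedSpace ℂ E]
    {T : E →L[ℂ] E} (hT : IsHermitianOperator T) (φ : E →ₗ[ℂ] ℂ) (hφ : ∀ η, ‖φ η‖ ≤ ‖η‖)
    {ξ : E} (hξ : φ ξ = ‖ξ‖) : (φ (T ξ)).im = 0 := by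
  obtain ⟨C, hC⟩ := hT
  -- The real part of `φ (ξ + i t T ξ)` is `‖ξ‖ - t Im φ(T ξ)`. A linear term bounded by a quadratic
  -- one, for both signs of `t`, must vanish.
  have h1 (t : ℝ) : -(t * (φ (T ξ)).im) ≤ C * ‖ξ‖ * t ^ 2 := by
    have h2 := (hφ _).trans (hC t ξ)
    rw [map_add, map_smul, hξ] at h2
    have h3 := (Complex.re_le_norm _).trans h2
    simp at h3
    linarith
  set y := (φ (T ξ)).im with hy
  have h4 (t : ℝ) (ht : 0 < t) : |y| ≤ C * ‖ξ‖ * t := by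
    refine abs_le'.2 ⟨?_, ?_⟩
    · have := h1 (-t)
      refine le_of_mul_le_mul_left ?_ ht
      linarith
    · have := h1 t
      refine le_of_mul_le_mul_left ?_ ht
      linarith
  have hlim : Filter.Tendsto (fun t : ℝ => C * ‖ξ‖ * t) (𝓝[>] 0) (𝓝 0) := by
    have : Continuous fun t : ℝ => C * ‖ξ‖ * t := by fun_prop
    simpa using (this.tendsto 0).mono_left nhdsWithin_le_nhds
  have h5 : |y| ≤ 0 := ge_of_tendsto hlim
    (by filter_upwards [self_mem_nhdsWithin] with t ht using h4 t ht)
  exact abs_nonpos_iff.1 h5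

section Representation

variable {G : Type u} {X : Type v} [Group G] [TopologicalSpace X] [MulAction G X] [ContinuousConstSMul G X]
  {E : Type w} [NormedAddCommGroup E] [NormedSpace ℂ E]

namespace BanachRep

theorem continuous_apply {B : Type u} [NonUnitalNormedRing B] [NormedSpace ℂ B]
    (ψ : BanachRep B E) (ξ : E) : Continuous fun b => ψ b ξ :=
  (ContinuousLinearMap.apply ℂ E ξ).continuous.comp
    (AddMonoidHomClass.continuous_of_bound ψ.toHom 1 fun b => by
      rw [one_mul]; exact ψ.contractive b)

/-- Convergence on the vectors `ψ(b) η` comes from the approximate unit of F(α), and these span a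
dense subspace. -/
theorem Nondegenerate.tendsto_coeff {ψ : BanachRep (L1Algebra G X) E} (hψ : ψ.Nondegenerate)
    (ξ : E) : Filter.Tendsto (fun e => ψ (L1Algebra.coeff e) ξ) (unitFilter X) (𝓝 ξ) := by
  let T (e : C₀(X, ℂ)) : E →L[ℂ] E := ψ (L1Algebra.coeff e)
  have hT : ∀ᶠ e in unitFilter X, ‖T e‖ ≤ 1 := by
    filter_upwards [eventually_norm_le_one] with e he
    exact (ψ.contractive _).trans ((L1Algebra.norm_coeff e).le.trans he)
  have hc : IsClosed (tendstoSubmodule (unitFilter X) T : Set E) := isClosed_setOf_tendsto T hT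
  have hle : (Submodule.span ℂ {η : E | ∃ (b : L1Algebra G X) (ξ : E),
      ψ b ξ = η}).topologicalClosure ≤ tendstoSubmodule (unitFilter X) T := by
    refine Submodule.topologicalClosure_minimal _ (Submodule.span_le.2 ?_) hc
    rintro _ ⟨b, η, rfl⟩
    have h := ((ψ.continuous_apply η).tendsto b).comp (L1Algebra.tendsto_coeff_mul b)
    refine h.congr fun e => ?_
    change ψ.toHom (L1Algebra.coeff e * b) η = ψ (L1Algebra.coeff e) (ψ b η)
    rw [map_mul]; rfl
  rw [hψ] at hle
  exact hle Submodule.mem_top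

theorem apply_coeff_eq (ψ : BanachRep (L1Algebra G X) E) (a : C₀(X, ℂ)) (ξ : E) :
    ψ (L1Algebra.coeff a) ξ = ψ (L1Algebra.coeff (realPart a : C₀(X, ℂ))) ξ +
      Complex.I • ψ (L1Algebra.coeff (imaginaryPart a : C₀(X, ℂ))) ξ := by
  conv_lhs => rw [← realPart_add_I_smul_imaginaryPart a]
  rw [map_add, map_smul, map_add, map_smul]; rfl

/-- `δ_s` need not belong to F(α), so `e δ_s` stands in for it. This splits off the C₀(X)-factor on
the left. -/
theorem tendsto_coeff_single (ψ : BanachRep (L1Algebra G X) E) (s : G) (a : C₀(X, ℂ)) (ξ : E) :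
    Filter.Tendsto (fun e => ψ (L1Algebra.coeff a) (ψ (L1Algebra.single s e) ξ)) (unitFilter X)
      (𝓝 (ψ (L1Algebra.single s a) ξ)) := by
  have hlim := (((ψ.continuous_apply ξ).comp (L1Algebra.continuous_single s)).tendsto a).comp
    (tendsto_mul_unitFilter a)
  refine hlim.congr fun e => ?_
  change ψ (L1Algebra.single s (e * a)) ξ = _
  rw [mul_comm, ← L1Algebra.coeff_mul_single, map_mul]; rfl

variable [T2Space X] [LocallyCompactSpace X]

/-- Non-degeneracy lets `ψ(e)` replace the identity operator. For real `e` and `a` with `‖e‖ ≤ 1`,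
one has `|e + i t a|² = e² + t² a² ≤ 1 + t² ‖a‖²` at each point, hence no first-order term in `t`.
-/
theorem Nondegenerate.isHermitianOperator {ψ : BanachRep (L1Algebra G X) E}
    (hψ : ψ.Nondegenerate) {a : C₀(X, ℂ)} (ha : ∀ x, (a x).im = 0) :
    IsHermitianOperator (ψ (L1Algebra.coeff a)) := by
  refine ⟨‖a‖ ^ 2, fun t ξ => ?_⟩
  have hlim := ((hψ.tendsto_coeff ξ).add_const
    (((t : ℂ) * Complex.I) • ψ (L1Algebra.coeff a) ξ)).norm
  refine le_of_tendsto hlim ?_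
  filter_upwards [eventually_unitFilter (X := X) isCompact_empty] with e h
  obtain ⟨-, he, he'⟩ := h
  have h1 : ψ (L1Algebra.coeff e) ξ + ((t : ℂ) * Complex.I) • ψ (L1Algebra.coeff a) ξ =
      ψ (L1Algebra.coeff (e + ((t : ℂ) * Complex.I) • a)) ξ := by
    rw [map_add, map_smul, map_add, map_smul]; rfl
  rw [h1]
  refine (ψ _).le_of_opNorm_le ((ψ.contractive _).trans ((L1Algebra.norm_coeff _).le.trans ?_)) ξ
  refine norm_le_of _ (by positivity) fun x => ?_
  change ‖e x + (t * Complex.I) * a x‖ ≤ _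
  have h2 : ‖e x + (t * Complex.I) * a x‖ ^ 2 = (e x).re ^ 2 + (t * (a x).re) ^ 2 := by
    rw [Complex.sq_norm, Complex.normSq_apply]
    simp [he' x, ha x]; ring
  have h3 : (e x).re ^ 2 ≤ 1 := by
    rw [sq_le_one_iff_abs_le_one]
    exact (Complex.abs_re_le_norm _).trans ((norm_apply_le e x).trans he)
  have h4 : (a x).re ^ 2 ≤ ‖a‖ ^ 2 := by
    rw [← sq_abs]
    exact pow_le_pow_left₀ (abs_nonneg _) ((Complex.abs_re_le_norm _).trans (norm_apply_le a x)) 2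
  refine le_of_sq_le_sq ?_ (by positivity)
  rw [h2, mul_pow]
  nlinarith [mul_le_mul_of_nonneg_left h4 (sq_nonneg t), sq_nonneg (‖a‖ ^ 2 * t ^ 2),
    mul_nonneg (sq_nonneg ‖a‖) (sq_nonneg t)]

/-- The group acts by contractions, on the left. -/
theorem norm_single_apply_le (ψ : BanachRep (L1Algebra G X) E) (s : G) (a : C₀(X, ℂ)) (ξ : E) :
    ‖ψ (L1Algebra.single s a) ξ‖ ≤ ‖ψ (L1Algebra.coeff (act s⁻¹ a)) ξ‖ := by
  have hlim := (((ψ.continuous_apply ξ).comp (L1Algebra.continuous_single s)).tendsto a).comp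
    (tendsto_mul_unitFilter a)
  refine le_of_tendsto hlim.norm ?_
  filter_upwards [eventually_norm_le_one] with e he
  -- This is the identity `a δ_s = δ_s α_{s⁻¹}(a)`, with `e δ_s` in place of `δ_s`.
  have h1 : (L1Algebra.single s (e * a) : L1Algebra G X) =
      L1Algebra.single s e * L1Algebra.coeff (act s⁻¹ a) := by
    rw [L1Algebra.coeff_eq_single, L1Algebra.single_mul_single, mul_one, ← act_mul,
      mul_inv_cancel, act_one]
  change ‖ψ (L1Algebra.single s (e * a)) ξ‖ ≤ _
  rw [h1, map_mul]
  refine ((ψ _).le_of_opNorm_le ((ψ.contractive _).trans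
    ((L1Algebra.norm_single s e).le.trans he)) _).trans (one_mul _).le

end BanachRep

end Representation

/-- The conjugate of the sign of a complex number. -/
noncomputable def conjSign (z : ℂ) : ℂ := starRingEnd ℂ z / ‖z‖

theorem norm_conjSign_le (z : ℂ) : ‖conjSign z‖ ≤ 1 := by
  rw [conjSign, norm_div, RCLike.norm_conj, Complex.norm_of_nonneg (norm_nonneg z)]
  exact div_self_le_one _

theorem conjSign_mul (z : ℂ) : conjSign z * z = ‖z‖ := by
  rw [conjSign, div_mul_eq_mul_div, Complex.conj_mul', sq]
  by_cases h : z = 0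
  · simp [h]
  · have : (‖z‖ : ℂ) ≠ 0 := by simpa using h
    field_simp

theorem measurable_conjSign : Measurable conjSign := by
  unfold conjSign
  fun_prop

/-- The phases `θ s` are chosen to cancel the arguments of the `z s`. -/
theorem sum_norm_le_of_forall {ι : Type u} (S : Finset ι) (z : ι → ℂ) {C : ℝ}
    (h : ∀ θ : ι → ℂ, (∀ s, ‖θ s‖ ≤ 1) → ‖∑ s ∈ S, θ s * z s‖ ≤ C) : ∑ s ∈ S, ‖z s‖ ≤ C := by
  have h1 := h (fun s => conjSign (z s)) fun s => norm_conjSign_le _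
  simp only [conjSign_mul, ← Complex.ofReal_sum] at h1
  rwa [Complex.norm_of_nonneg (Finset.sum_nonneg fun _ _ => norm_nonneg _)] at h1

/-! ### Representations on C₀-spaces -/

section C0

variable {Ω : Type w} [TopologicalSpace Ω]

/-- The evaluation functional at a point. -/
noncomputable def evalLinearMap (x : Ω) : C₀(Ω, ℂ) →ₗ[ℂ] ℂ where
  toFun f := f x
  map_add' _ _ := rfl
  map_smul' _ _ := rfl

/-- A point at which some function does not vanish is a peak value of some contraction. -/
theorem exists_norm_le_one_eq_one {x : Ω} {g : C₀(Ω, ℂ)} (hg : g x ≠ 0) :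
    ∃ h : C₀(Ω, ℂ), ‖h‖ ≤ 1 ∧ h x = 1 := by
  let f : C₀(Ω, ℂ) := (g x)⁻¹ • g
  have hfx : f x = 1 := inv_mul_cancel₀ hg
  have hpos (y : Ω) : 0 < max 1 ‖f y‖ := zero_lt_one.trans_le (le_max_left _ _)
  let m : C(Ω, ℂ) := ⟨fun y => ((max 1 ‖f y‖)⁻¹ : ℝ), by
    refine Complex.continuous_ofReal.comp (Continuous.inv₀ (by fun_prop) fun y => (hpos y).ne')⟩
  have hm (y : Ω) : ‖m y‖ = (max 1 ‖f y‖)⁻¹ :=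
    Complex.norm_of_nonneg (inv_nonneg.2 (hpos y).le)
  have hm1 (y : Ω) : ‖m y‖ ≤ 1 := by
    rw [hm]; exact inv_le_one_of_one_le₀ (le_max_left _ _)
  refine ⟨mulBounded m hm1 f, norm_le_of _ zero_le_one fun y => ?_, ?_⟩
  · rw [mulBounded_apply, norm_mul, hm, inv_mul_le_one₀ (hpos y)]
    exact le_max_right _ _
  · rw [mulBounded_apply, hfx, mul_one]
    change (((max 1 ‖f x‖)⁻¹ : ℝ) : ℂ) = 1
    rw [hfx]; simp

/-- Hermitian operators on a `C₀`-space do not enlarge zero sets. -/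
theorem IsHermitianOperator.apply_eq_zero {T : C₀(Ω, ℂ) →L[ℂ] C₀(Ω, ℂ)}
    (hT : IsHermitianOperator T) {f : C₀(Ω, ℂ)} {x : Ω} (hf : f x = 0) : T f x = 0 := by
  by_contra hne
  -- `Ω` is an arbitrary topological space, without Urysohn functions. The function `T f`, non-zero
  -- at `x` by assumption, supplies the peak function.
  obtain ⟨h, hh, hhx⟩ := exists_norm_le_one_eq_one hne
  obtain ⟨r, hr, hrf⟩ : ∃ r : ℝ, 0 < r ∧ r * ‖f‖ ≤ 1 :=
    ⟨(‖f‖ + 1)⁻¹, by positivity, by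
      rw [inv_mul_le_one₀ (by positivity)]; linarith⟩
  have hfr (y : Ω) : r * ‖f y‖ ≤ 1 :=
    (mul_le_mul_of_nonneg_left (norm_apply_le f y) hr.le).trans hrf
  -- Damping `h` by `1 - r |f|` leaves room for a multiple of `f`: `h' + θ r f` stays a contraction
  -- when `|θ| ≤ 1`, and still has value one at `x` because `f x = 0`.
  let m : C(Ω, ℂ) := ⟨fun y => ((1 - r * ‖f y‖ : ℝ) : ℂ), by fun_prop⟩
  have hm (y : Ω) : ‖m y‖ = 1 - r * ‖f y‖ :=
    Complex.norm_of_nonneg (sub_nonneg.2 (hfr y))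
  have hm1 (y : Ω) : ‖m y‖ ≤ 1 := by
    rw [hm]; have := norm_nonneg (f y); nlinarith
  let h' := mulBounded m hm1 h
  have hx' : h' x = 1 := by
    change ((1 - r * ‖f x‖ : ℝ) : ℂ) * h x = 1
    rw [hf, hhx]; simp
  -- Evaluation at `x` norms each `h' + θ r f`, so the numerical range is real there. The values `θ
  -- = 0, 1, i` then kill both parts of `T f x`.
  have key (θ : ℂ) (hθ : ‖θ‖ ≤ 1) : (T h' x + θ * r * T f x).im = 0 := by
    have hk : ‖h' + (θ * r) • f‖ ≤ 1 := by
      refine norm_le_of _ zero_le_one fun y => ?_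
      change ‖m y * h y + θ * r * f y‖ ≤ 1
      refine (norm_add_le _ _).trans ?_
      rw [norm_mul, norm_mul, norm_mul, hm, Complex.norm_of_nonneg hr.le]
      have h1 : (1 - r * ‖f y‖) * ‖h y‖ ≤ (1 - r * ‖f y‖) * 1 :=
        mul_le_mul_of_nonneg_left ((norm_apply_le h y).trans hh) (sub_nonneg.2 (hfr y))
      have h2 : ‖θ‖ * r * ‖f y‖ ≤ 1 * r * ‖f y‖ := by gcongr
      linarith
    have hval : (h' + (θ * r) • f) x = 1 := by
      change h' x + θ * r * f x = 1
      rw [hx', hf]; simp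
    have hk1 : ‖h' + (θ * r) • f‖ = 1 := by
      refine le_antisymm hk ?_
      have := norm_apply_le (h' + (θ * r) • f) x
      rwa [hval, norm_one] at this
    have h3 := hT.im_eq_zero (evalLinearMap x) (fun η => norm_apply_le η x)
      (ξ := h' + (θ * r) • f) (by rw [hk1]; exact hval.trans (by simp))
    rw [map_add, map_smul] at h3
    exact h3
  have h0 := key 0 (by simp)
  have h1 := key 1 (by simp)
  have hI := key Complex.I (by simp)
  refine hne (Complex.ext ?_ ?_)
  · simp at h0 hI
    simpa [h0, hr.ne'] using hI
  · simp at h0 h1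
    simpa [h0, hr.ne'] using h1

variable {G : Type u} {X : Type v} [Group G] [TopologicalSpace X] [T2Space X]
  [LocallyCompactSpace X] [MulAction G X] [ContinuousConstSMul G X]

theorem BanachRep.Nondegenerate.apply_coeff_eq_zero {ψ : BanachRep (L1Algebra G X) C₀(Ω, ℂ)}
    (hψ : ψ.Nondegenerate) (a : C₀(X, ℂ)) {f : C₀(Ω, ℂ)} {x : Ω} (hf : f x = 0) :
    ψ (L1Algebra.coeff a) f x = 0 := by
  rw [ψ.apply_coeff_eq]
  change ψ (L1Algebra.coeff (realPart a : C₀(X, ℂ))) f x +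
    Complex.I * ψ (L1Algebra.coeff (imaginaryPart a : C₀(X, ℂ))) f x = 0
  rw [(hψ.isHermitianOperator (realPart_apply_im a)).apply_eq_zero hf,
    (hψ.isHermitianOperator (imaginaryPart_apply_im a)).apply_eq_zero hf]
  simp

/-- At a fixed `x`, operators that do not enlarge zero sets see only the value of a function at `x`:
with `h x = 1`, replacing `f s` by `f s x • h` changes nothing. The sum becomes the value at `x` of
one operator `ψ(Σ_s f_s(x) a_s)` on `h`, and contractivity applies. Points where every function
vanishes are trivial. -/
theorem BanachRep.Nondegenerate.norm_sum_coeff_apply_le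
    {ψ : BanachRep (L1Algebra G X) C₀(Ω, ℂ)} (hψ : ψ.Nondegenerate) (S : Finset G)
    (a : G → C₀(X, ℂ)) {C D : ℝ} (ha : ∀ y, ∑ s ∈ S, ‖a s y‖ ≤ C) (hC : 0 ≤ C)
    (f : G → C₀(Ω, ℂ)) (hf : ∀ s, ‖f s‖ ≤ D) (hD : 0 ≤ D) (x : Ω) :
    ‖∑ s ∈ S, ψ (L1Algebra.coeff (a s)) (f s) x‖ ≤ C * D := by
  by_cases hx : ∃ g : C₀(Ω, ℂ), g x ≠ 0
  · obtain ⟨g, hg⟩ := hx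
    obtain ⟨h, hh, hhx⟩ := exists_norm_le_one_eq_one hg
    have h1 (s : G) : ψ (L1Algebra.coeff (a s)) (f s) x =
        f s x * ψ (L1Algebra.coeff (a s)) h x := by
      have h2 : (f s - f s x • h) x = 0 := by
        change f s x - f s x * h x = 0
        rw [hhx]; ring
      have h3 := hψ.apply_coeff_eq_zero (a s) h2
      rw [map_sub, map_smul] at h3
      exact sub_eq_zero.1 h3
    have h4 : ∑ s ∈ S, ψ (L1Algebra.coeff (a s)) (f s) x =
        ψ (L1Algebra.coeff (∑ s ∈ S, f s x • a s)) h x := by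
      have h5 : ψ (L1Algebra.coeff (∑ s ∈ S, f s x • a s)) h =
          ∑ s ∈ S, f s x • ψ (L1Algebra.coeff (a s)) h := by
        rw [map_sum, map_sum, sum_apply]
        simp only [map_smul]
        rfl
      rw [h5]
      change _ = evalLinearMap x (∑ s ∈ S, f s x • ψ (L1Algebra.coeff (a s)) h)
      rw [map_sum]
      exact Finset.sum_congr rfl fun s _ => h1 s
    rw [h4]
    refine (norm_apply_le _ _).trans (((ψ _).le_of_opNorm_le ((ψ.contractive _).trans
      (L1Algebra.norm_coeff _).le) h).trans ((mul_le_of_le_one_right (norm_nonneg _) hh).trans ?_))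
    refine norm_le_of _ (mul_nonneg hC hD) fun y => ?_
    change ‖evalLinearMap y (∑ s ∈ S, f s x • a s)‖ ≤ C * D
    rw [map_sum]
    refine (norm_sum_le _ _).trans (le_trans ?_ (mul_le_mul_of_nonneg_right (ha y) hD))
    rw [Finset.sum_mul]
    refine Finset.sum_le_sum fun s _ => ?_
    change ‖f s x * a s y‖ ≤ _
    rw [norm_mul, mul_comm]
    exact mul_le_mul_of_nonneg_left ((norm_apply_le _ _).trans (hf s)) (norm_nonneg _)
  · push Not at hx
    rw [Finset.sum_eq_zero fun s _ => hx _, norm_zero]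
    positivity

/-- The norm of a finitely supported element in a representation on a `C₀`-space. -/
theorem BanachRep.Nondegenerate.norm_sum_single_le_of_C0
    {ψ : BanachRep (L1Algebra G X) C₀(Ω, ℂ)} (hψ : ψ.Nondegenerate) (S : Finset G)
    (a : G → C₀(X, ℂ)) {C : ℝ} (ha : ∀ y, ∑ s ∈ S, ‖a s y‖ ≤ C) (hC : 0 ≤ C) :
    ‖ψ (∑ s ∈ S, L1Algebra.single s (a s))‖ ≤ C := by
  refine ContinuousLinearMap.opNorm_le_bound _ hC fun f => ?_
  refine norm_le_of _ (by positivity) fun x => ?_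
  have h1 : ψ (∑ s ∈ S, L1Algebra.single s (a s)) f x =
      ∑ s ∈ S, ψ (L1Algebra.single s (a s)) f x := by
    rw [map_sum, sum_apply]
    exact map_sum (evalLinearMap x) _ _
  rw [h1]
  -- Writing `ψ(a_s δ_s) f` as a limit of `ψ(a_s) ψ(e δ_s) f` brings the sum into the form of the
  -- pointwise estimate, with vectors of norm at most `‖f‖`.
  have hlim : Filter.Tendsto (fun e => ‖∑ s ∈ S,
      ψ (L1Algebra.coeff (a s)) (ψ (L1Algebra.single s e) f) x‖) (unitFilter X)
      (𝓝 ‖∑ s ∈ S, ψ (L1Algebra.single s (a s)) f x‖) :=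
    (tendsto_finsetSum S fun s _ =>
      ((continuous_apply_point x).tendsto _).comp (ψ.tendsto_coeff_single s (a s) f)).norm
  refine le_of_tendsto hlim ?_
  filter_upwards [eventually_norm_le_one] with e he
  refine hψ.norm_sum_coeff_apply_le S a ha hC _ (fun s => ?_) (norm_nonneg f) x
  refine ((ψ _).le_of_opNorm_le ((ψ.contractive _).trans
    ((L1Algebra.norm_single s e).le.trans he)) f).trans (one_mul _).le

end C0

/-! ### Representations on L¹-spaces -/

section L1

open MeasureTheory

variable {Ω : Type w} [MeasurableSpace Ω] {μ : Measure Ω}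

/-- The functional on `L¹(μ)` given by a bounded measurable function. -/
noncomputable def pairing (g : Ω → ℂ) (hg : AEStronglyMeasurable g μ) (hb : ∀ x, ‖g x‖ ≤ 1) :
    Lp ℂ 1 μ →ₗ[ℂ] ℂ where
  toFun η := ∫ x, g x * η x ∂μ
  map_add' ξ η := by
    rw [← integral_add ((L1.integrable_coeFn ξ).bdd_mul hg (ae_of_all _ hb))
      ((L1.integrable_coeFn η).bdd_mul hg (ae_of_all _ hb))]
    refine integral_congr_ae ?_
    filter_upwards [Lp.coeFn_add ξ η] with x hx
    rw [hx, Pi.add_apply, mul_add]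
  map_smul' c ξ := by
    rw [RingHom.id_apply, smul_eq_mul, ← integral_const_mul]
    refine integral_congr_ae ?_
    filter_upwards [Lp.coeFn_smul c ξ] with x hx
    rw [hx, Pi.smul_apply, smul_eq_mul, mul_left_comm]

theorem norm_pairing_le (g : Ω → ℂ) (hg : AEStronglyMeasurable g μ) (hb : ∀ x, ‖g x‖ ≤ 1)
    (η : Lp ℂ 1 μ) : ‖pairing g hg hb η‖ ≤ ‖η‖ := by
  rw [L1.norm_eq_integral_norm]
  refine (norm_integral_le_integral_norm _).trans (integral_mono_of_nonneg
    (ae_of_all _ fun _ => norm_nonneg _) (L1.integrable_coeFn η).norm (ae_of_all _ fun x => ?_))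
  change ‖g x * η x‖ ≤ ‖η x‖
  rw [norm_mul]
  exact mul_le_of_le_one_left (norm_nonneg _) (hb x)

/-- Hermitian operators on `L¹(μ)` do not enlarge zero sets. -/
theorem IsHermitianOperator.ae_eq_zero {T : Lp ℂ 1 μ →L[ℂ] Lp ℂ 1 μ}
    (hT : IsHermitianOperator T) (ξ : Lp ℂ 1 μ) : ∀ᵐ x ∂μ, ξ x = 0 → T ξ x = 0 := by
  classical
  have hξm : Measurable ξ := (Lp.stronglyMeasurable ξ).measurable
  have hTm : Measurable (T ξ) := (Lp.stronglyMeasurable (T ξ)).measurable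
  have hZ : MeasurableSet {x | ξ x = 0} := hξm (measurableSet_singleton 0)
  -- A functional that norms `ξ` is free on the zero set of `ξ`. There it is aligned with `T ξ`;
  -- comparing `θ = i` with `θ = 0` isolates the integral of `|T ξ|` over the zero set.
  let g (θ : ℂ) (x : Ω) : ℂ := if ξ x = 0 then θ * conjSign (T ξ x) else conjSign (ξ x)
  have hg (θ : ℂ) : AEStronglyMeasurable (g θ) μ :=
    (Measurable.ite hZ ((measurable_conjSign.comp hTm).const_mul θ)
      (measurable_conjSign.comp hξm)).aestronglyMeasurable
  have hb (θ : ℂ) (hθ : ‖θ‖ ≤ 1) (x : Ω) : ‖g θ x‖ ≤ 1 := by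
    change ‖if ξ x = 0 then θ * conjSign (T ξ x) else conjSign (ξ x)‖ ≤ 1
    split_ifs
    · rw [norm_mul]
      exact mul_le_one₀ hθ (norm_nonneg _) (norm_conjSign_le _)
    · exact norm_conjSign_le _
  have hgξ (θ : ℂ) (x : Ω) : g θ x * ξ x = ‖ξ x‖ := by
    change (if ξ x = 0 then θ * conjSign (T ξ x) else conjSign (ξ x)) * ξ x = ‖ξ x‖
    split_ifs with h
    · simp [h]
    · exact conjSign_mul _
  have key (θ : ℂ) (hθ : ‖θ‖ ≤ 1) : (∫ x, g θ x * T ξ x ∂μ).im = 0 := by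
    refine hT.im_eq_zero (pairing (g θ) (hg θ) (hb θ hθ)) (norm_pairing_le _ _ _) ?_
    change ∫ x, g θ x * ξ x ∂μ = ‖ξ‖
    simp only [hgξ]
    rw [integral_complex_ofReal, L1.norm_eq_integral_norm]
  have hint (θ : ℂ) (hθ : ‖θ‖ ≤ 1) : Integrable (fun x => g θ x * T ξ x) μ :=
    (L1.integrable_coeFn (T ξ)).bdd_mul (hg θ) (ae_of_all _ (hb θ hθ))
  have hdiff (x : Ω) : g Complex.I x * T ξ x - g 0 x * T ξ x =
      Complex.I * (({x | ξ x = 0}.indicator (fun x => ‖T ξ x‖) x : ℝ) : ℂ) := by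
    change (if ξ x = 0 then Complex.I * conjSign (T ξ x) else conjSign (ξ x)) * T ξ x -
      (if ξ x = 0 then 0 * conjSign (T ξ x) else conjSign (ξ x)) * T ξ x = _
    by_cases h : ξ x = 0
    · rw [if_pos h, if_pos h, Set.indicator_of_mem (show x ∈ {x | ξ x = 0} from h), mul_assoc,
        conjSign_mul]
      simp
    · rw [if_neg h, if_neg h, Set.indicator_of_notMem (show x ∉ {x | ξ x = 0} from h)]
      simp
  have h1 := integral_sub (hint Complex.I (by simp)) (hint 0 (by simp))
  simp only [hdiff] at h1
  rw [integral_const_mul, integral_complex_ofReal] at h1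
  have h2 := congrArg Complex.im h1
  rw [Complex.sub_im, key _ (by simp), key _ (by simp)] at h2
  simp only [Complex.I_mul_im, Complex.ofReal_re, sub_zero] at h2
  rw [integral_eq_zero_iff_of_nonneg (fun x => Set.indicator_nonneg (fun _ _ => norm_nonneg _) x)
    ((L1.integrable_coeFn (T ξ)).norm.indicator hZ)] at h2
  filter_upwards [h2] with x hx h
  rw [Set.indicator_of_mem (show x ∈ {x | ξ x = 0} from h)] at hx
  exact norm_eq_zero.1 hx

/-- An operator on `L¹(μ)` that does not enlarge zero sets is dominated by its norm. -/
theorem ae_norm_apply_le {T : Lp ℂ 1 μ →L[ℂ] Lp ℂ 1 μ}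
    (hT : ∀ ξ : Lp ℂ 1 μ, ∀ᵐ x ∂μ, ξ x = 0 → T ξ x = 0) {C : ℝ} (hC : ‖T‖ ≤ C)
    (ξ : Lp ℂ 1 μ) : ∀ᵐ x ∂μ, ‖T ξ x‖ ≤ C * ‖ξ x‖ := by
  refine ae_le_of_forall_setIntegral_le (L1.integrable_coeFn (T ξ)).norm
    ((L1.integrable_coeFn ξ).norm.const_mul C) fun A hA _ => ?_
  let η : Lp ℂ 1 μ := ((Lp.memLp ξ).indicator hA).toLp
  have hη : η =ᵐ[μ] A.indicator ξ := MemLp.coeFn_toLp _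
  -- `ξ - η` vanishes on `A`, hence so does `T (ξ - η)`. The integral of `|T ξ|` over `A` is thus
  -- controlled by `‖T η‖`.
  have h1 : ∀ᵐ x ∂μ, x ∈ A → ‖T ξ x‖ = ‖T η x‖ := by
    have h2 : T (ξ - η) = T ξ - T η := map_sub T ξ η
    filter_upwards [hη, Lp.coeFn_sub ξ η, Lp.coeFn_sub (T ξ) (T η), hT (ξ - η)] with
      x hx hs hTs h0 hxA
    rw [Pi.sub_apply] at hs hTs
    rw [Set.indicator_of_mem hxA] at hx
    rw [h2, hs, hTs, hx, sub_self] at h0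
    rw [sub_eq_zero.1 (h0 rfl)]
  have h3 : ∫ x in A, ‖ξ x‖ ∂μ = ‖η‖ := by
    rw [L1.norm_eq_integral_norm, ← integral_indicator hA]
    refine integral_congr_ae ?_
    filter_upwards [hη] with x hx
    rw [hx, norm_indicator_eq_indicator_norm]
  rw [integral_const_mul, h3, setIntegral_congr_ae hA h1]
  calc ∫ x in A, ‖T η x‖ ∂μ ≤ ∫ x, ‖T η x‖ ∂μ :=
        setIntegral_le_integral (L1.integrable_coeFn (T η)).norm
          (ae_of_all _ fun _ => norm_nonneg _)
    _ = ‖T η‖ := (L1.norm_eq_integral_norm _).symm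
    _ ≤ C * ‖η‖ := T.le_of_opNorm_le hC η

variable {G : Type u} {X : Type v} [Group G] [TopologicalSpace X] [T2Space X]
  [LocallyCompactSpace X] [MulAction G X] [ContinuousConstSMul G X]

theorem BanachRep.Nondegenerate.ae_norm_coeff_apply_le
    {ψ : BanachRep (L1Algebra G X) (Lp ℂ 1 μ)} (hψ : ψ.Nondegenerate) (a : C₀(X, ℂ)) {C : ℝ}
    (hC : ‖a‖ ≤ C) (ξ : Lp ℂ 1 μ) : ∀ᵐ x ∂μ, ‖ψ (L1Algebra.coeff a) ξ x‖ ≤ C * ‖ξ x‖ := by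
  refine ae_norm_apply_le (fun ξ => ?_)
    ((ψ.contractive _).trans ((L1Algebra.norm_coeff a).le.trans hC)) ξ
  rw [ψ.apply_coeff_eq]
  filter_upwards [(hψ.isHermitianOperator (realPart_apply_im a)).ae_eq_zero ξ,
    (hψ.isHermitianOperator (imaginaryPart_apply_im a)).ae_eq_zero ξ,
    Lp.coeFn_add (ψ (L1Algebra.coeff (realPart a : C₀(X, ℂ))) ξ)
      (Complex.I • ψ (L1Algebra.coeff (imaginaryPart a : C₀(X, ℂ))) ξ),
    Lp.coeFn_smul Complex.I (ψ (L1Algebra.coeff (imaginaryPart a : C₀(X, ℂ))) ξ)]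
    with x h1 h2 h3 h4 h0
  rw [h3, Pi.add_apply, h4, Pi.smul_apply, h1 h0, h2 h0]
  simp

/-- The pointwise bound for the single function `Σ θ_s a_s`, of norm at most `C ‖θ‖`, gives `Σ_s
|ψ(a_s) ξ| ≤ C |ξ|` almost everywhere after optimising the phases; then integrate. -/
theorem BanachRep.Nondegenerate.sum_norm_coeff_apply_le
    {ψ : BanachRep (L1Algebra G X) (Lp ℂ 1 μ)} (hψ : ψ.Nondegenerate) {ι : Type u} [Fintype ι]
    (a : ι → C₀(X, ℂ)) {C : ℝ} (ha : ∀ y, ∑ s, ‖a s y‖ ≤ C) (hC : 0 ≤ C) (ξ : Lp ℂ 1 μ) :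
    ∑ s, ‖ψ (L1Algebra.coeff (a s)) ξ‖ ≤ C * ‖ξ‖ := by
  have hle (θ : ι → ℂ) : ∀ᵐ x ∂μ,
      ‖∑ s, θ s * ψ (L1Algebra.coeff (a s)) ξ x‖ ≤ C * ‖θ‖ * ‖ξ x‖ := by
    have hnorm : ‖∑ s, θ s • a s‖ ≤ C * ‖θ‖ := by
      refine norm_le_of _ (by positivity) fun y => ?_
      change ‖evalLinearMap y (∑ s, θ s • a s)‖ ≤ C * ‖θ‖
      rw [map_sum]
      refine (norm_sum_le _ _).trans (le_trans ?_
        (mul_le_mul_of_nonneg_right (ha y) (norm_nonneg θ)))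
      rw [Finset.sum_mul]
      refine Finset.sum_le_sum fun s _ => ?_
      change ‖θ s * a s y‖ ≤ _
      rw [norm_mul, mul_comm]
      exact mul_le_mul_of_nonneg_left (norm_le_pi_norm θ s) (norm_nonneg _)
    have heq : ψ (L1Algebra.coeff (∑ s, θ s • a s)) ξ =
        ∑ s, θ s • ψ (L1Algebra.coeff (a s)) ξ := by
      rw [map_sum, map_sum, sum_apply]
      simp only [map_smul]
      rfl
    have hsmul : ∀ᵐ x ∂μ, ∀ s, (θ s • ψ (L1Algebra.coeff (a s)) ξ : Lp ℂ 1 μ) x =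
        θ s * ψ (L1Algebra.coeff (a s)) ξ x :=
      ae_all_iff.2 fun s => Lp.coeFn_smul (θ s) (ψ (L1Algebra.coeff (a s)) ξ)
    have hmain := hψ.ae_norm_coeff_apply_le _ hnorm ξ
    rw [heq] at hmain
    filter_upwards [hmain, hsmul, Lp.coeFn_fun_finsetSum Finset.univ
      fun s => θ s • ψ (L1Algebra.coeff (a s)) ξ] with x h1 h2 h3
    rw [h3] at h1
    simpa only [h2] using h1
  -- The exceptional null set depends on `θ`, while the optimal phases depend on the point. A
  -- countable dense set of `θ` gives one null set for all.
  obtain ⟨D, hDc, hD⟩ := TopologicalSpace.exists_countable_dense (ι → ℂ)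
  have hall : ∀ᵐ x ∂μ, ∀ θ ∈ D,
      ‖∑ s, θ s * ψ (L1Algebra.coeff (a s)) ξ x‖ ≤ C * ‖θ‖ * ‖ξ x‖ :=
    (ae_ball_iff hDc).2 fun θ _ => hle θ
  have hsum : ∀ᵐ x ∂μ, ∑ s, ‖ψ (L1Algebra.coeff (a s)) ξ x‖ ≤ C * ‖ξ x‖ := by
    filter_upwards [hall] with x hx
    refine sum_norm_le_of_forall _ _ fun θ hθ => ?_
    have hc : IsClosed {θ : ι → ℂ | ‖∑ s, θ s * ψ (L1Algebra.coeff (a s)) ξ x‖ ≤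
        C * ‖θ‖ * ‖ξ x‖} :=
      isClosed_le (continuous_finsetSum _ fun s _ => (_root_.continuous_apply s).mul_const _).norm
        ((continuous_norm.const_mul _).mul_const _)
    have h1 : θ ∈ {θ : ι → ℂ | ‖∑ s, θ s * ψ (L1Algebra.coeff (a s)) ξ x‖ ≤
        C * ‖θ‖ * ‖ξ x‖} :=
      closure_minimal (s := D) hx hc (hD θ)
    refine le_trans h1 (mul_le_mul_of_nonneg_right ?_ (norm_nonneg _))
    exact mul_le_of_le_one_right hC ((pi_norm_le_iff_of_nonneg zero_le_one).2 hθ)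
  simp only [L1.norm_eq_integral_norm]
  rw [← integral_finsetSum _ fun s _ => (L1.integrable_coeFn _).norm, ← integral_const_mul]
  exact integral_mono_ae (integrable_finsetSum _ fun s _ => (L1.integrable_coeFn _).norm)
    ((L1.integrable_coeFn ξ).norm.const_mul C) hsum

/-- The norm of a finitely supported element in a representation on an `L¹`-space. -/
theorem BanachRep.Nondegenerate.norm_sum_single_le_of_L1
    {ψ : BanachRep (L1Algebra G X) (Lp ℂ 1 μ)} (hψ : ψ.Nondegenerate) (S : Finset G)
    (a : G → C₀(X, ℂ)) {C : ℝ} (ha : ∀ y, ∑ s ∈ S, ‖a s (s • y)‖ ≤ C) (hC : 0 ≤ C) :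
    ‖ψ (∑ s ∈ S, L1Algebra.single s (a s))‖ ≤ C := by
  refine ContinuousLinearMap.opNorm_le_bound _ hC fun ξ => ?_
  rw [map_sum, sum_apply]
  refine (norm_sum_le _ _).trans ((Finset.sum_le_sum fun s _ =>
    ψ.norm_single_apply_le s (a s) ξ).trans ?_)
  -- Moving the group element to the left replaces `a_s` by `α_{s⁻¹}(a_s)`, whose value at `y` is
  -- `a_s (s • y)`; this is the source of the twist in `ha`.
  have h := hψ.sum_norm_coeff_apply_le (fun s : S => act (s : G)⁻¹ (a s)) (C := C) (fun y => by
    simp only [act_apply, inv_inv]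
    rw [Finset.sum_coe_sort S fun s => ‖a s (s • y)‖]
    exact ha y) hC ξ
  rwa [Finset.sum_coe_sort S fun s => ‖ψ (L1Algebra.coeff (act s⁻¹ (a s))) ξ‖] at h

end L1

/-! ### Lower bounds for the regular representations -/

section Lower

variable {G : Type u} {X : Type v} [Group G] [TopologicalSpace X] [MulAction G X]
  [ContinuousConstSMul G X]

/-- A column of `Λ_1(b)`: the point mass at `(x, 1)` goes to the family with value `b(s)(s x)` at
`(s x, s)`, and these indices are distinct. -/
theorem sum_norm_smul_le_norm_regularRep (b : L1Algebra G X) (S : Finset G) (x : X) :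
    ∑ s ∈ S, ‖b s (s • x)‖ ≤ ‖regularRep G X ⟨1, le_rfl⟩ b‖ := by
  classical
  let η := regularRep G X ⟨1, le_rfl⟩ b (EllSpace.point _ (x, 1))
  have h1 (s : G) : η.val (s • x, s) = b s (s • x) := by
    have h := regularRep_point_val ⟨1, le_rfl⟩ b x (s • x) 1 s
    rw [inv_one, mul_one, if_pos rfl] at h
    exact h
  have hinj : Function.Injective fun s : G => (s • x, s) := fun s t h => (Prod.ext_iff.1 h).2
  have h2 := lp.sum_rpow_le_norm_rpow (p := 1) (by simp) η.1 (S.map ⟨_, hinj⟩)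
  rw [Finset.sum_map] at h2
  simp only [ENNReal.toReal_one, Real.rpow_one] at h2
  have h3 : ‖η‖ ≤ ‖regularRep G X ⟨1, le_rfl⟩ b‖ :=
    ((regularRep G X ⟨1, le_rfl⟩ b).le_opNorm _).trans (mul_le_of_le_one_right
      ((regularRep G X ⟨1, le_rfl⟩).seminorm.nonneg b) (EllSpace.norm_point_le _))
  refine le_trans (le_of_eq (Finset.sum_congr rfl fun s _ => ?_)) (h2.trans h3)
  rw [← h1]; rfl

/-- A row of `Λ_∞(b)`: phases placed at the distinct indices `(s⁻¹ x, s⁻¹)` form a vector of norm at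
most one, and the value of its image at `(x, 1)` is `Σ θ_s b(s)(x)`. -/
theorem sum_norm_le_norm_regularRep {p : Exponent} (hp : p.1 = ∞) (b : L1Algebra G X)
    (S : Finset G) (x : X) : ∑ s ∈ S, ‖b s x‖ ≤ ‖regularRep G X p b‖ := by
  classical
  refine sum_norm_le_of_forall S (fun s => b s x) fun θ hθ => ?_
  let ξ : EllSpace p (X × G) := ∑ s ∈ S, θ s • EllSpace.point p (s⁻¹ • x, s⁻¹)
  have hξ : ‖ξ‖ ≤ 1 := by
    refine EllSpace.norm_le_of_top hp zero_le_one fun i => ?_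
    rw [← EllSpace.evalCLM_apply, map_sum]
    simp only [map_smul, EllSpace.evalCLM_apply, smul_eq_mul]
    have h0 (s : G) (hs : s ≠ i.2⁻¹) :
        θ s * (EllSpace.point p (s⁻¹ • x, s⁻¹)).val i = 0 := by
      rw [EllSpace.point_val_ne, mul_zero]
      rintro rfl
      simp at hs
    by_cases hi : i.2⁻¹ ∈ S
    · rw [Finset.sum_eq_single_of_mem _ hi fun s _ hs => h0 s hs, norm_mul]
      exact mul_le_one₀ (hθ _) (norm_nonneg _)
        ((EllSpace.norm_val_le _ _).trans (EllSpace.norm_point_le _))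
    · rw [Finset.sum_eq_zero fun s hs => h0 s (by rintro rfl; exact hi hs), norm_zero]
      exact zero_le_one
  have h2 : (regularRep G X p b ξ).val (x, 1) = ∑ s ∈ S, θ s * b s x := by
    rw [← EllSpace.evalCLM_apply, map_sum, map_sum]
    refine Finset.sum_congr rfl fun s _ => ?_
    rw [map_smul, map_smul, EllSpace.evalCLM_apply, regularRep_point_val, inv_inv, one_mul,
      smul_inv_smul, if_pos rfl, smul_eq_mul]
  rw [← h2]
  exact (EllSpace.norm_val_le _ _).trans (((regularRep G X p b).le_opNorm _).trans
    (mul_le_of_le_one_right ((regularRep G X p).seminorm.nonneg b) hξ))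

end Lower

/-! ### Equality of full and reduced norms for exponents 1 and ∞ -/

section FullReduced

variable {G : Type u} {X : Type v} [Group G] [TopologicalSpace X]
  [MulAction G X] [ContinuousConstSMul G X]

theorem BanachRep.norm_le_of_forall_sum_single {E : Type w} [NormedAddCommGroup E]
    [NormedSpace ℂ E] (ψ : BanachRep (L1Algebra G X) E) {b : L1Algebra G X} {C : ℝ}
    (h : ∀ S : Finset G, ‖ψ (∑ s ∈ S, L1Algebra.single s (b s))‖ ≤ C) : ‖ψ b‖ ≤ C :=
  le_of_tendsto' ((ψ.seminorm.continuous.tendsto b).comp b.hasSum_single) h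

variable [T2Space X] [LocallyCompactSpace X]

theorem fullNorm_one_le (b : L1Algebra G X) :
    fullNorm G X ⟨1, le_rfl⟩ b ≤ ‖regularRep G X ⟨1, le_rfl⟩ b‖ := by
  have h0 := (regularRep G X ⟨1, le_rfl⟩).seminorm.nonneg b
  refine AlgSeminorm.sup_le h0 ?_
  rintro _ ⟨E, _, _, ψ, hE, hψ, rfl⟩
  obtain ⟨Ω, _, μ, ⟨e⟩⟩ := hE.1 ENNReal.one_ne_top
  refine (ψ.norm_le_conj e b).trans (BanachRep.norm_le_of_forall_sum_single _ fun S => ?_)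
  exact BanachRep.Nondegenerate.norm_sum_single_le_of_L1 (μ := μ) (hψ.conj e) S b
    (sum_norm_smul_le_norm_regularRep b S) h0

theorem fullNorm_top_le (b : L1Algebra G X) :
    fullNorm G X ⟨∞, le_top⟩ b ≤ ‖regularRep G X ⟨∞, le_top⟩ b‖ := by
  have h0 := (regularRep G X ⟨∞, le_top⟩).seminorm.nonneg b
  refine AlgSeminorm.sup_le h0 ?_
  rintro _ ⟨E, _, _, ψ, hE, hψ, rfl⟩
  obtain ⟨Ω, _, ⟨e⟩⟩ := hE.2 rfl
  refine (ψ.norm_le_conj e b).trans (BanachRep.norm_le_of_forall_sum_single _ fun S => ?_)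
  exact (hψ.conj e).norm_sum_single_le_of_C0 S b (sum_norm_le_norm_regularRep rfl b S) h0

/-- For `T = ∅` both norms are the ℓ¹-norm. Otherwise the bounds for `p = 1` and `p = ∞` are
compared one exponent at a time. -/
theorem fullNormP_le_reducedNormP {T : Set Exponent}
    (hT : T ⊆ {⟨1, le_rfl⟩, ⟨∞, le_top⟩}) (b : L1Algebra G X) :
    fullNormP G X T b ≤ reducedNormP G X T b := by
  rcases T.eq_empty_or_nonempty with rfl | hne
  · rw [reducedNormP_empty]
    exact (fullNormP G X ∅).le_norm b
  rw [fullNormP, if_neg hne.ne_empty]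
  refine AlgSeminorm.sup_le ((reducedNormP G X T).nonneg b) ?_
  rintro _ ⟨p, hp, rfl⟩
  refine le_trans ?_ (norm_regularRep_le_reducedNormP hp b)
  rcases hT hp with rfl | rfl
  · exact fullNorm_one_le b
  · exact fullNorm_top_le b

end FullReduced

end BanachCrossedProduct

open BanachCrossedProduct
theorem mainTheorem1 {G : Type u} {X : Type v} [Group G] [TopologicalSpace X] [T2Space X]
    [LocallyCompactSpace X] [MulAction G X] [ContinuousConstSMul G X] (P : Set Exponent) :
    List.TFAE [
      TopologicallyFree G X,
      HasHiddenIdeal (coefficients G X P) (kernel (regularHom G X P)),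
      kernel (trivialHom G X P) ≤ kernel (regularHom G X P),
      ∃ T : Set Exponent, T ⊆ {⟨1, le_rfl⟩, ⟨∞, le_top⟩} ∧ DetectsIdeals (coefficients G X T),
      ∀ T : Set Exponent, T ⊆ {⟨1, le_rfl⟩, ⟨∞, le_top⟩} → DetectsIdeals (coefficients G X T)] := by
  tfae_have 1 → 2 := fun h => h.hasHiddenIdeal P
  tfae_have 2 → 3 := kernel_le_of_hasHiddenIdeal
  tfae_have 3 → 1 := topologicallyFree_of_kernel_le
  tfae_have 1 → 5 := fun h T hT => h.detectsIdeals (fullNormP_le_reducedNormP hT)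
  tfae_have 5 → 4 := fun h => ⟨∅, Set.empty_subset _, h ∅ (Set.empty_subset _)⟩
  tfae_have 4 → 1 := fun ⟨_, _, h⟩ => topologicallyFree_of_detectsIdeals h
  tfae_finish
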